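/- **Setting.** Let $\mathcal S,\mathcal A$ be finite sets of sizes $S,A$ and let $M,H,K\ge 1$. For $u\in\mathbb R^M$ and $\eta>0$ let $z_i(u)=\frac{e^{\eta u_i}}{1+\sum_{m\le M} e^{\eta u_m}}$ $(i\le M)$ and $z_{M+1}(u)=1-\sum_{i\le M}z_i(u)$. A logistic DCMDP with contexts $\mathcal X=\{1,\dots,M+1\}$ and horizon $H$ has rewards $r_{x,h}(s,a)\in[0,1]$, transition kernels $P_{x,h}(\cdot\mid s,a)$, features $f^*_t:\mathcal S\times\mathcal A\times\mathcal X\to\mathbb R^M$ $(0\le t\le H-1)$ and a discount $\alpha\in[0,1]$. At step $h$, with history $\tau_h=(s_t,a_t,x_t)_{1\le t<h}$ and state $s_h$, the agent picks $a_h$; then $x_h=i$ with probability $z_i(\sigma(\tau_h;f^*))$, where $\sigma(\tau_h;f)=\sum_{t=0}^{h-1}\alpha^{h-1-t}f_t(s_t,a_t,x_t)$ and $(s_0,a_0,x_0)$ is a fixed placeholder; a $[0,1]$-valued reward with conditional mean $r_{x_h,h}(s_h,a_h)$ is received, and $s_{h+1}\sim P_{x_h,h}(\cdot\mid s_h,a_h)$.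 Put $H_\alpha=\sum_{t=0}^{2H-1}\alpha^t$ $\big(=\frac{1-\alpha^{2H}}{1-\alpha}$ for $\alpha<1\big)$ and let the temperature satisfy $0<\eta\le H_\alpha^{-1/2}$. Regard features as vectors in $\mathbb R^{M(M+1)SAH}$, and assume $\|f^*\|_2\le L$ and $|f^*|\le b$ coordinatewise for a known vector $b$. Let $V_1^\pi(s)$ be the expected total reward of an episode under a history-dependent randomised policy $\pi$, $V_1^*=\sup_\pi V_1^\pi$, and $\mathrm{Reg}(K)=\sum_{k=1}^K\big(V_1^*(s_1^k)-V_1^{\pi^k}(s_1^k)\big)$; the initial states $s_1^k$ may be random and depend on the past. Let $A(u)=\mathrm{diag}(z_i(u))_{i\le M}-(z_iz_j)_{i,j\le M}$, and let $1/\kappa=\inf_\tau\lambda_{\min}\big(A(\sigma(\tau;f^*))\big)$ over all histories $\tau$ of length less than $H$. **Algorithm (LDC-UCB), with parameters $\lambda>0$, $\delta\in(0,1)$.** Before episode $k$, using episodes $k'<k$, let $n=n_h^k(s,a,x)$ be the visit counts at step $h$, and $\hat r,\hat P$ the empirical rewards and transitions ($0$ if $n=0$). Let $\iota=\log\frac{8SAMHK}{\delta}$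 and $$\bar r=\hat r+\min\Big\{\sqrt{\tfrac{\iota}{n\vee1}},1\Big\}+\min\Big\{H\sqrt{\tfrac{4S\iota}{n\vee1}},2H\Big\}.$$ Let $d_h^{k'}(t,s,a,x)=\eta\,\alpha^{h-1-t}\mathbf 1\{0\le t\le h-1,\ (s_t^{k'},a_t^{k'},x_t^{k'})=(s,a,x)\}$, let $\hat f_k$ be the (unconstrained) maximiser of $\sum_{k'<k}\sum_{h\le H}\log z_{x_h^{k'}}(\sigma(\tau_h^{k'};f))-\frac\lambda2\|f\|_2^2$, and, with sums over $k'<k$, $h\le H$, and $z,A$ evaluated at $\sigma(\tau_h^{k'};f)$ (first $M$ coordinates), $$g_k(f)=\lambda f+\sum z\otimes d_h^{k'},\qquad H_k(f)=\lambda I+\sum A\otimes d_h^{k'}(d_h^{k'})^{T},$$ $$\beta_k(\delta)=\tfrac{M^{3/2}(M+1)SAH}{\sqrt\lambda}\Big(\log\big(1+\tfrac{k}{(M+1)SA\lambda}\big)+2\log\tfrac2\delta\Big)+\sqrt{\tfrac{\lambda}{4M}}+\sqrt\lambda L,$$ $$\mathcal C_k=\big\{f:\ |f|\le b,\ \|g_k(f)-g_k(\hat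 f_k)\|_{H_k(f)^{-1}}\le\beta_k(\delta/4)\big\}.$$ For a feature vector $f$ let $\bar V^{f}_{H+1}=0$ and $\bar V^{f}_h(s,\tau)=\min\{H,\max_a\bar Q^f_h(s,\tau,a)\}$, where $\bar Q^f_h(s,\tau,a)=\sum_x z_x(\sigma(\tau;f))\big(\bar r_{x,h}(s,a)+\sum_{s'}\hat P_{x,h}(s'|s,a)\bar V^f_{h+1}(s',\tau\cdot(s,a,x))\big)$. The algorithm picks $\bar f_k\in\arg\max_{f\in\mathcal C_k}\bar V^f_1(s_1^k)$ and plays, in episode $k$, a policy $\pi^k$ that is greedy for $\bar Q^{\bar f_k}$ (an arbitrary policy if $\mathcal C_k=\emptyset$); $\bar f_k$ and $\pi^k$ are measurable with respect to the information at the start of episode $k$. **Theorem.** For all $c_1,c_2,\ell_0>0$ there are $C>0$ and $q\in\mathbb N$, depending only on $c_1,c_2,\ell_0$, such that in every such setting with $L\ge\ell_0$, every $\delta\in(0,1)$ and every $\lambda$ with $c_1\frac{HM^{5/2}SA}{L}\le\lambda\le c_2\frac{HM^{5/2}SA}{L}$, with probability at least $1-\delta$ the regret of LDC-UCB satisfies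 $$\mathrm{Reg}(K)\le C\,\sqrt{H^6M^{9/2}S^2A^2L^2\,\kappa\,K}\ \Big(\log\big(2+SAMHKL/\delta\big)\Big)^{q}.$$ -/

import Mathlib

open scoped Kronecker

noncomputable section

namespace LogisticDCMDP

/-- A history `τ = [(s₁,a₁,x₁), …, (s_{h-1},a_{h-1},x_{h-1})]`, in chronological order.  The step
at which the agent stands after `τ` is `h = τ.length + 1`.  The `M + 1` contexts are
`Fin (M + 1)`; the last one is the reference class of the softmax. -/
abbrev Hist (S A : Type*) (M : ℕ) := List (S × A × Fin (M + 1))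

/-- Index set of the scalar features of one output coordinate: time `t = 0, …, H - 1` and a
state-action-context triple. -/
abbrev Idx (S A : Type*) (M H : ℕ) := Fin H × S × A × Fin (M + 1)

/-- Latent feature maps `f_{t,i}(s,a,x)`, `i ∈ [M]`, regarded as a vector with `M(M+1)SAH` real
coordinates: `f (i, t, s, a, x)`. -/
abbrev Feat (S A : Type*) (M H : ℕ) := Fin M × Idx S A M H → ℝ

/-- The course of one episode: states `s₁, …, s_{H+1}`, actions and contexts at the `H` steps
(numbered from `0`). -/
abbrev Traj (S A : Type*) (M H : ℕ) := (Fin (H + 1) → S) × (Fin H → A) × (Fin H → Fin (M + 1))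

/-- A (randomised, history-dependent) policy. -/
abbrev Policy (S A : Type*) [Fintype A] (M : ℕ) := Hist S A M → S → stdSimplex ℝ A

/-- The softmax with temperature `η`: `z_i(u) = exp(η u_i) / (1 + ∑ₘ exp(η u_m))` for `i ∈ [M]`
and `z_{M+1}(u) = 1 - ∑_{i ≤ M} z_i(u)`. -/
def softmax (η : ℝ) {M : ℕ} (u : Fin M → ℝ) : Fin (M + 1) → ℝ :=
  Fin.snoc (α := fun _ => ℝ) (fun i => Real.exp (η * u i) / (1 + ∑ m, Real.exp (η * u m)))
    (1 - ∑ i, Real.exp (η * u i) / (1 + ∑ m, Real.exp (η * u m)))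

/-- `A(u) = diag(z(u)) - z(u) z(u)ᵀ`, for the first `M` softmax coordinates. -/
def softmaxGrad (η : ℝ) {M : ℕ} (u : Fin M → ℝ) : Matrix (Fin M) (Fin M) ℝ :=
  Matrix.diagonal (fun i : Fin M => softmax η u i.castSucc) -
    Matrix.vecMulVec (fun i : Fin M => softmax η u i.castSucc)
      (fun i : Fin M => softmax η u i.castSucc)

/-- The effective horizon `H_α = (α^{2H} - 1) / (α - 1)`, read as `2H` at `α = 1`. -/
def effHorizon (α : ℝ) (H : ℕ) : ℝ := ∑ t ∈ Finset.range (2 * H), α ^ t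

/-- A logistic DCMDP with `M + 1` contexts and horizon `H`.  Rewards and transitions may depend on
the step.  `start` is the placeholder for `(s₀, a₀, x₀)`, so that `feat` enters at time `0` only
through the constant vector `f₀(start)`. -/
structure Model (S A : Type*) [Fintype S] (M H : ℕ) where
  /-- (mean) reward `r_{x,h}(s,a)` -/
  rew : Fin H → S → A → Fin (M + 1) → ℝ
  rew_mem : ∀ h s a x, rew h s a x ∈ Set.Icc (0 : ℝ) 1
  /-- transition probabilities `P_{x,h}(· | s,a)` -/
  trans : Fin H → S → A → Fin (M + 1) → stdSimplex ℝ S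
  /-- the placeholder `(s₀, a₀, x₀)` -/
  start : S × A × Fin (M + 1)
  /-- the latent feature maps `f*` -/
  feat : Feat S A M H
  /-- history discount factor -/
  α : ℝ
  α_mem : α ∈ Set.Icc (0 : ℝ) 1
  /-- softmax temperature -/
  η : ℝ
  η_pos : 0 < η

variable {S A : Type*} [Fintype S] [Fintype A] [DecidableEq S] [DecidableEq A] {M H : ℕ}

/-- The list of the state-action-context triples of an episode; its first `h` entries are the
history before step `h` (steps numbered from `0`). -/
def Traj.steps (e : Traj S A M H) : Hist S A M :=
  List.ofFn fun h : Fin H => (e.1 h.castSucc, e.2.1 h, e.2.2 h)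

/-- The history observed before step `h` (numbered from `0`). -/
def Traj.hist (e : Traj S A M H) (h : Fin H) : Hist S A M := (Traj.steps e).take h

/-- The deterministic policy that plays `p τ s`. -/
def detPolicy (p : Hist S A M → S → A) : Policy S A M :=
  fun τ s => ⟨Pi.single (p τ s) 1, single_mem_stdSimplex ℝ (p τ s)⟩

namespace Model

/-- `σ(τ; f) = ∑_{t=0}^{h-1} α^{h-1-t} f_t(s_t, a_t, x_t)`, where `h - 1 = τ.length` and
`(s₀,a₀,x₀)` is the placeholder. -/
def suff (m : Model S A M H) (f : Feat S A M H) (τ : Hist S A M) : Fin M → ℝ := fun i =>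
  ∑ t : Fin H, match (m.start :: τ)[t.val]? with
    | some (s, a, x) => m.α ^ (τ.length - t.val) * f (i, t, s, a, x)
    | none => 0

/-- The discounted visitation vector `d(τ)`; it satisfies `η σ_i(τ; f) = ⟨f_i, d(τ)⟩`. -/
def visit (m : Model S A M H) (τ : Hist S A M) : Idx S A M H → ℝ := fun p =>
  if (m.start :: τ)[p.1.val]? = some p.2 then m.η * m.α ^ (τ.length - p.1.val) else 0

/-- The context distribution `z(σ(τ; f))` after the history `τ` under the features `f`. -/
def ctxProb (m : Model S A M H) (f : Feat S A M H) (τ : Hist S A M) : Fin (M + 1) → ℝ :=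
  softmax m.η (m.suff f τ)

/-- The probability of the episode `e` when the policy `π` is played in the model from the initial
state `s₁`: at each step an action is drawn from the policy, then a context from
`z(σ(τ_h; f*))`, then the next state from `P_{x,h}(· | s,a)`. -/
def trajProb (m : Model S A M H) (π : Policy S A M) (s₁ : S) (e : Traj S A M H) : ℝ :=
  (if e.1 0 = s₁ then 1 else 0) *
    ∏ h : Fin H, (π (Traj.hist e h) (e.1 h.castSucc)).1 (e.2.1 h) *
      m.ctxProb m.feat (Traj.hist e h) (e.2.2 h) *
      (m.trans h (e.1 h.castSucc) (e.2.1 h) (e.2.2 h)).1 (e.1 h.succ)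

/-- The value `V₁^π(s₁)`: the expected total reward of an episode. -/
def value (m : Model S A M H) (π : Policy S A M) (s₁ : S) : ℝ :=
  ∑ e : Traj S A M H, m.trajProb π s₁ e *
    ∑ h : Fin H, m.rew h (e.1 h.castSucc) (e.2.1 h) (e.2.2 h)

/-- The optimal value `V₁*(s₁)`, over all history-dependent randomised policies. -/
def optValue (m : Model S A M H) (s₁ : S) : ℝ := ⨆ π : Policy S A M, m.value π s₁

/-- The saturation constant `κ`: `1/κ` is the infimum over all histories of the least eigenvalue
of `A(σ(τ; f*))`. -/
def kappa (m : Model S A M H) : ℝ :=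
  (⨅ τ : {τ : Hist S A M // τ.length < H},
    sInf (spectrum ℝ (softmaxGrad m.η (m.suff m.feat τ.1))))⁻¹

end Model

/-! ### The algorithm

`D k` is the course of episode `k` and `R k h` the reward received at its step `h`.  Before episode
`k` the algorithm uses the episodes `1, …, k - 1`. -/

/-- Number `n_h^k(s,a,x)` of visits before episode `k`. -/
def visits (D : ℕ → Traj S A M H) (k : ℕ) (h : Fin H) (s : S) (a : A) (x : Fin (M + 1)) : ℕ :=
  ((Finset.Ico 1 k).filter fun k' =>
    (D k').1 h.castSucc = s ∧ (D k').2.1 h = a ∧ (D k').2.2 h = x).card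

/-- Empirical mean reward `r̂_{x,h}^k(s,a)` (`0` if there was no visit). -/
def rewHat (D : ℕ → Traj S A M H) (R : ℕ → Fin H → ℝ) (k : ℕ) (h : Fin H) (s : S) (a : A)
    (x : Fin (M + 1)) : ℝ :=
  (∑ k' ∈ (Finset.Ico 1 k).filter fun k' =>
    (D k').1 h.castSucc = s ∧ (D k').2.1 h = a ∧ (D k').2.2 h = x, R k' h) /
    (visits D k h s a x : ℝ)

/-- Empirical transition frequency `P̂_{x,h}^k(s' | s,a)` (`0` if there was no visit). -/
def transHat (D : ℕ → Traj S A M H) (k : ℕ) (h : Fin H) (s : S) (a : A)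
    (x : Fin (M + 1)) (s' : S) : ℝ :=
  (((Finset.Ico 1 k).filter fun k' =>
    (D k').1 h.castSucc = s ∧ (D k').2.1 h = a ∧ (D k').2.2 h = x ∧
      (D k').1 h.succ = s').card : ℝ) /
    (visits D k h s a x : ℝ)

/-- The logarithmic factor `log (8 S A M H K / δ)` of the bonuses. -/
def bonusLog (S A : Type*) [Fintype S] [Fintype A] (M H K : ℕ) (δ : ℝ) : ℝ :=
  Real.log (8 * Fintype.card S * Fintype.card A * M * H * K / δ)

/-- Reward bonus, with `n` visits. -/
def bonusRew (S A : Type*) [Fintype S] [Fintype A] (M H K : ℕ) (δ : ℝ) (n : ℕ) : ℝ :=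
  min (Real.sqrt (bonusLog S A M H K δ / max (n : ℝ) 1)) 1

/-- Transition bonus, with `n` visits. -/
def bonusTrans (S A : Type*) [Fintype S] [Fintype A] (M H K : ℕ) (δ : ℝ) (n : ℕ) : ℝ :=
  min (H * Real.sqrt (4 * Fintype.card S * bonusLog S A M H K δ / max (n : ℝ) 1)) (2 * H)

/-- The optimistic reward `r̄ = r̂ + b^r + b^p`. -/
def rewBar (D : ℕ → Traj S A M H) (R : ℕ → Fin H → ℝ) (K : ℕ) (δ : ℝ) (k : ℕ) (h : Fin H) (s : S)
    (a : A) (x : Fin (M + 1)) : ℝ :=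
  rewHat D R k h s a x + bonusRew S A M H K δ (visits D k h s a x) +
    bonusTrans S A M H K δ (visits D k h s a x)

namespace Model

/-- The regularised log-likelihood
`∑_{k' < k} ∑_h log z_{x_h^{k'}}(σ(τ_h^{k'}; f)) - (lam / 2) ‖f‖₂²`. -/
def logLik (m : Model S A M H) (lam : ℝ) (D : ℕ → Traj S A M H) (k : ℕ) (f : Feat S A M H) : ℝ :=
  (∑ k' ∈ Finset.Ico 1 k, ∑ h : Fin H,
    Real.log (m.ctxProb f (Traj.hist (D k') h) ((D k').2.2 h))) - lam / 2 * ∑ p, f p ^ 2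

/-- `g_k(f) = lam f + ∑_{k' < k} ∑_h z(σ(τ_h^{k'}; f)) ⊗ d_h^{k'}`. -/
def gVec (m : Model S A M H) (lam : ℝ) (D : ℕ → Traj S A M H) (k : ℕ) (f : Feat S A M H) :
    Feat S A M H := fun p =>
  lam * f p + ∑ k' ∈ Finset.Ico 1 k, ∑ h : Fin H,
    m.ctxProb f (Traj.hist (D k') h) p.1.castSucc * m.visit (Traj.hist (D k') h) p.2

/-- `H_k(f) = lam I + ∑_{k' < k} ∑_h A(σ(τ_h^{k'}; f)) ⊗ d_h^{k'} (d_h^{k'})ᵀ`. -/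
def hessMat (m : Model S A M H) (lam : ℝ) (D : ℕ → Traj S A M H) (k : ℕ) (f : Feat S A M H) :
    Matrix (Fin M × Idx S A M H) (Fin M × Idx S A M H) ℝ :=
  lam • (1 : Matrix (Fin M × Idx S A M H) (Fin M × Idx S A M H) ℝ) +
    ∑ k' ∈ Finset.Ico 1 k, ∑ h : Fin H,
      softmaxGrad m.η (m.suff f (Traj.hist (D k') h)) ⊗ₖ
        Matrix.vecMulVec (m.visit (Traj.hist (D k') h)) (m.visit (Traj.hist (D k') h))

end Model

/-- The confidence radius `β_k(δ)`. -/
def radius (S A : Type*) [Fintype S] [Fintype A] (M H : ℕ) (lam L δ : ℝ) (k : ℕ) : ℝ :=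
  (M : ℝ) ^ (3 / 2 : ℝ) * (M + 1) * Fintype.card S * Fintype.card A * H / Real.sqrt lam *
      (Real.log (1 + k / ((M + 1) * Fintype.card S * Fintype.card A * lam)) +
        2 * Real.log (2 / δ)) +
    Real.sqrt (lam / (4 * M)) + Real.sqrt lam * L

namespace Model

/-- The confidence set `C_k(δ)` around the estimate `fhat`: those `f` in the rectangle `|f| ≤ b`
with `‖g_k(f) - g_k(fhat)‖_{H_k(f)⁻¹} ≤ β_k(δ)`. -/
def confSet (m : Model S A M H) (b : Feat S A M H) (lam L δ : ℝ) (D : ℕ → Traj S A M H) (k : ℕ)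
    (fhat : Feat S A M H) : Set (Feat S A M H) :=
  {f | (∀ p, |f p| ≤ b p) ∧
    Real.sqrt ((m.gVec lam D k f - m.gVec lam D k fhat) ⬝ᵥ
      ((m.hessMat lam D k f)⁻¹).mulVec (m.gVec lam D k f - m.gVec lam D k fhat)) ≤
        radius S A M H lam L δ k}

/-- The truncated optimistic value `V̄_h^{k,f}(s, τ)` of the planner (with `h = τ.length + 1`):
`V̄_{H+1} = 0` and
`V̄_h(s,τ) = min {H, max_a ∑_x z_x(σ(τ;f)) (r̄_{x,h}(s,a) + ∑_{s'} P̂_{x,h}(s'|s,a) V̄_{h+1}(s', τ·(s,a,x)))}`. -/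
def optimisticV (m : Model S A M H) (D : ℕ → Traj S A M H) (R : ℕ → Fin H → ℝ) (K : ℕ) (δ : ℝ)
    (k : ℕ) (f : Feat S A M H) (τ : Hist S A M) (s : S) : ℝ :=
  if hτ : τ.length < H then
    min (H : ℝ) (⨆ a : A, ∑ x, m.ctxProb f τ x *
      (rewBar D R K δ k ⟨τ.length, hτ⟩ s a x +
        ∑ s', transHat D k ⟨τ.length, hτ⟩ s a x s' *
          optimisticV m D R K δ k f (τ ++ [(s, a, x)]) s'))
  else 0
termination_by H - τ.length
decreasing_by
  simp only [List.length_append, List.length_cons, List.length_nil]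
  omega

/-- The action value that is maximised in `optimisticV`, at a history shorter than `H`. -/
def optimisticQ (m : Model S A M H) (D : ℕ → Traj S A M H) (R : ℕ → Fin H → ℝ) (K : ℕ) (δ : ℝ)
    (k : ℕ) (f : Feat S A M H) (τ : Hist S A M) (hτ : τ.length < H) (s : S) (a : A) : ℝ :=
  ∑ x, m.ctxProb f τ x *
    (rewBar D R K δ k ⟨τ.length, hτ⟩ s a x +
      ∑ s', transHat D k ⟨τ.length, hτ⟩ s a x s' *
        m.optimisticV D R K δ k f (τ ++ [(s, a, x)]) s')

/-- The planning step of LDC-UCB in episode `k`, from the initial state `s₁`.  `fhat` is a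
(global) maximiser of the regularised log-likelihood of the data.  If the confidence set is
nonempty, then `fbar` is an element of it with the greatest optimistic value at `s₁`, and the
policy `p` is greedy for the optimistic action values under `fbar`.  (If the confidence set is
empty, the output is arbitrary.) -/
def IsPlan (m : Model S A M H) (b : Feat S A M H) (lam L δ : ℝ) (K : ℕ) (D : ℕ → Traj S A M H)
    (R : ℕ → Fin H → ℝ) (k : ℕ) (s₁ : S) (fbar : Feat S A M H) (p : Hist S A M → S → A) : Prop :=
  ∃ fhat : Feat S A M H, IsMaxOn (m.logLik lam D k) Set.univ fhat ∧
    ((m.confSet b lam L (δ / 4) D k fhat).Nonempty →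
      fbar ∈ m.confSet b lam L (δ / 4) D k fhat ∧
      (∀ f ∈ m.confSet b lam L (δ / 4) D k fhat,
        m.optimisticV D R K δ k f [] s₁ ≤ m.optimisticV D R K δ k fbar [] s₁) ∧
      ∀ (τ : Hist S A M) (hτ : τ.length < H) (s : S) (a : A),
        m.optimisticQ D R K δ k fbar τ hτ s a ≤ m.optimisticQ D R K δ k fbar τ hτ s (p τ s))

open MeasureTheory in
/-- `K` episodes of interaction of LDC-UCB with the model `m`, on a probability space.  `ℱ (k - 1)`
is the information available at the beginning of episode `k`: the previous episodes and the initial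
state `init k`, which may be random and may depend on the past. -/
structure IsRun (m : Model S A M H) (b : Feat S A M H) (lam L δ : ℝ) (K : ℕ)
    {Ω : Type*} [mΩ : MeasurableSpace Ω] (μ : Measure Ω) (ℱ : Filtration ℕ mΩ)
    (init : ℕ → Ω → S) (fbar : ℕ → Ω → Feat S A M H) (pol : ℕ → Ω → Hist S A M → S → A)
    (D : ℕ → Ω → Traj S A M H) (R : ℕ → Fin H → Ω → ℝ) : Prop where
  init_adapted : ∀ k ∈ Finset.Icc 1 K, ∀ s, MeasurableSet[ℱ (k - 1)] {ω | init k ω = s}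
  fbar_adapted : ∀ k ∈ Finset.Icc 1 K, Measurable[ℱ (k - 1)] (fbar k)
  pol_adapted : ∀ k ∈ Finset.Icc 1 K, ∀ τ s a, MeasurableSet[ℱ (k - 1)] {ω | pol k ω τ s = a}
  traj_adapted : ∀ k ∈ Finset.Icc 1 K, ∀ e, MeasurableSet[ℱ k] {ω | D k ω = e}
  rew_adapted : ∀ k ∈ Finset.Icc 1 K, ∀ h, Measurable[ℱ k] (R k h)
  /-- the policy played in episode `k` is computed by the planner from the past data -/
  plan : ∀ k ∈ Finset.Icc 1 K, ∀ ω, m.IsPlan b lam L δ K (fun k' => D k' ω)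
    (fun k' h => R k' h ω) k (init k ω) (fbar k ω) (pol k ω)
  /-- given the past, episode `k` is generated by the model under this policy -/
  traj_law : ∀ k ∈ Finset.Icc 1 K, ∀ e : Traj S A M H,
    μ[Set.indicator {ω | D k ω = e} (fun _ => (1 : ℝ)) | ℱ (k - 1)] =ᵐ[μ]
      fun ω => m.trajProb (detPolicy (pol k ω)) (init k ω) e
  /-- the received rewards lie in `[0,1]` (they may be deterministic or noisy) -/
  rew_mem : ∀ k ∈ Finset.Icc 1 K, ∀ h ω, R k h ω ∈ Set.Icc (0 : ℝ) 1
  /-- given the past and the episode up to the context of step `h`, the mean reward is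
  `r_{x,h}(s,a)` -/
  rew_mean : ∀ k ∈ Finset.Icc 1 K, ∀ h : Fin H,
    μ[R k h | ℱ (k - 1) ⊔
        MeasurableSpace.comap (fun ω => (Traj.steps (D k ω)).take (h + 1)) ⊤] =ᵐ[μ]
      fun ω => m.rew h ((D k ω).1 h.castSucc) ((D k ω).2.1 h) ((D k ω).2.2 h)

/-- The regret `∑_{k=1}^K (V₁*(s₁^k) - V₁^{π^k}(s₁^k))`. -/
def regret (m : Model S A M H) (K : ℕ) (init : ℕ → S) (pol : ℕ → Hist S A M → S → A) : ℝ :=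
  ∑ k ∈ Finset.Icc 1 K, (m.optValue (init k) - m.value (detPolicy (pol k)) (init k))

end Model

end LogisticDCMDP

end

noncomputable section

set_option linter.unusedSectionVars false

namespace LogisticDCMDP

/-! ### Gibbs distributions on a finite set -/

section Gibbs

variable {X : Type*} [Fintype X]

/-! The argument is optimism plus a convexity analysis of the logistic likelihood. Four events, each
failing with probability at most `δ / 4`, give: valid reward and transition estimates, two
self-normalised bounds for the context noise, and a comparison of expected with realised model
errors. When the true features lie in the confidence set (`feat_mem_confSet`) and the estimates are
valid, the planner's value at the chosen features dominates its value at the true ones, hence the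
optimal value (`value_le_optimisticV`). The greedy policy then loses at most the expected sum of
one-step model errors (`optimisticV_le_value_add`): order `H` times the ℓ¹ distance of the two
context laws, plus bonuses. A supermartingale replaces these expectations by twice the realised sums
(`measureReal_lt_sum_mean_le`). The bonuses are summed by pigeonhole and are dominated by the final
bound, so everything rests on the context predictions.

The softmax is a Gibbs law, and the mean of a direction `g` under it increases along `g` at a rate
equal to the variance of `g`. Let `g` be the difference between a member of the confidence set and
the truth. The quantity to control is `X = lam ‖g‖² + ∑ meanGap`, which is the pairing of `g` with
the difference of the two values of `gVec`. Inserting the maximum likelihood estimate splits it into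
a term controlled by the definition of the confidence set, a noise term and a ridge bias
(`sum_meanGap_le`). Each norm involved is a sum of variances at one end of the segment and must be
compared with the increments of means. At the true end the loss is a factor linear in the
displacement (`gvar_le_of_range`). At the far end it depends only on the size of the true logits and
on `log (M + 1)`, not on the displacement (`gvar_add_le_of_abs_le`); the rectangle `b` may be large,
so this uniformity is essential.

The noise bound comes from the method of mixtures: the exponentials of the noise, compensated by 3/4
of the variance, are supermartingales for all directions in a small ball, and their average over the
ball obeys Ville's inequality (`dotProduct_le_of_mixture`, `measureReal_not_noiseBound_le`). It is
used with two ridges. With ridge `lam` it puts the true features into the confidence set. With ridge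
equal to the dimension `d` of the features its radius is of order `√d` up to logarithms, and this
sharper version is needed inside `sum_meanGap_le`, where the fourth power of the radius is divided
by `lam`. Since `d` is at most of order `lam L`, the outcome is `X ≲ lam L³` up to logarithms.

The constant `κ` converts variances at the truth into Euclidean prediction errors; after truncation
at 1, past squared errors sum to at most a multiple of `κ lam L³` (`min_one_le_kappa_mul`). A
counting argument with determinants of Gram matrices (`card_filter_lt_le`, `sum_min_sqrt_le`) bounds
the sum of the current errors at one step by the square root of `K`, this budget and the dimension
`(M + 1)SAH` of a single block, up to logarithms. Summing over steps with the weight `H` gives `H²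
√(K κ lam L³ MSAH)`, and `lam L ≍ H M^{5/2} S A` turns the square into `H⁶ M^{7/2} S² A² L² κ K`,
which is within the claim. -/

/-- The Gibbs distribution with log-weights `u`. -/
def gibbs (u : X → ℝ) (x : X) : ℝ := Real.exp (u x) / ∑ y, Real.exp (u y)

/-- The mean of `v` under the Gibbs distribution. -/
def gmean (u v : X → ℝ) : ℝ := ∑ x, gibbs u x * v x

/-- The variance of `v` under the Gibbs distribution. -/
def gvar (u v : X → ℝ) : ℝ := ∑ x, gibbs u x * (v x - gmean u v) ^ 2

lemma sum_exp_pos [Nonempty X] (u : X → ℝ) : 0 < ∑ y, Real.exp (u y) :=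
  Finset.sum_pos (fun _ _ => Real.exp_pos _) Finset.univ_nonempty

lemma gibbs_pos [Nonempty X] (u : X → ℝ) (x : X) : 0 < gibbs u x :=
  div_pos (Real.exp_pos _) (sum_exp_pos u)

lemma sum_gibbs [Nonempty X] (u : X → ℝ) : ∑ x, gibbs u x = 1 := by
  simp only [gibbs]
  rw [← Finset.sum_div, div_self (sum_exp_pos u).ne']

lemma gvar_nonneg [Nonempty X] (u v : X → ℝ) : 0 ≤ gvar u v :=
  Finset.sum_nonneg fun x _ => mul_nonneg (gibbs_pos u x).le (sq_nonneg _)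

lemma sum_gibbs_mul_sub_sq [Nonempty X] (u v : X → ℝ) (c : ℝ) :
    ∑ x, gibbs u x * (v x - c) ^ 2 = gvar u v + (gmean u v - c) ^ 2 := by
  have h : ∀ x, gibbs u x * (v x - c) ^ 2 = gibbs u x * (v x - gmean u v) ^ 2 +
      (2 * (gmean u v - c) * (gibbs u x * v x) +
        gibbs u x * ((gmean u v - c) ^ 2 - 2 * (gmean u v - c) * gmean u v)) := fun x => by ring
  simp_rw [h]
  rw [Finset.sum_add_distrib, Finset.sum_add_distrib, ← Finset.mul_sum, ← Finset.sum_mul,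
    sum_gibbs]
  change gvar u v + (2 * (gmean u v - c) * gmean u v + _) = _
  ring

lemma gvar_le [Nonempty X] (u v : X → ℝ) (c : ℝ) :
    gvar u v ≤ ∑ x, gibbs u x * (v x - c) ^ 2 := by
  rw [sum_gibbs_mul_sub_sq]
  nlinarith [sq_nonneg (gmean u v - c)]

lemma gvar_eq [Nonempty X] (u v : X → ℝ) :
    gvar u v = ∑ x, gibbs u x * v x ^ 2 - gmean u v ^ 2 := by
  have := sum_gibbs_mul_sub_sq u v 0
  simp only [sub_zero] at this
  linarith

/-- Pointwise domination of distributions passes to variances. -/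
lemma gvar_mono [Nonempty X] {u u' : X → ℝ} (v : X → ℝ) {c : ℝ} (hc : 0 ≤ c)
    (h : ∀ x, c * gibbs u x ≤ gibbs u' x) : c * gvar u v ≤ gvar u' v := by
  calc c * gvar u v ≤ c * ∑ x, gibbs u x * (v x - gmean u' v) ^ 2 :=
        mul_le_mul_of_nonneg_left (gvar_le u v _) hc
    _ = ∑ x, (c * gibbs u x) * (v x - gmean u' v) ^ 2 := by
        rw [Finset.mul_sum]; exact Finset.sum_congr rfl fun x _ => by ring
    _ ≤ gvar u' v := Finset.sum_le_sum fun x _ => mul_le_mul_of_nonneg_right (h x) (sq_nonneg _)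

lemma hasDerivAt_gibbs [Nonempty X] (u v : X → ℝ) (t : ℝ) (x : X) :
    HasDerivAt (fun t : ℝ => gibbs (u + t • v) x)
      (gibbs (u + t • v) x * (v x - gmean (u + t • v) v)) t := by
  have h1 : ∀ y, HasDerivAt (fun t : ℝ => Real.exp ((u + t • v) y))
      (Real.exp ((u + t • v) y) * v y) t := fun y => by
    have : HasDerivAt (fun t : ℝ => (u + t • v) y) (v y) t := by
      simpa using ((hasDerivAt_id t).mul_const (v y)).const_add (u y)
    exact this.exp
  have h2 : HasDerivAt (fun t : ℝ => ∑ y, Real.exp ((u + t • v) y))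
      (∑ y, Real.exp ((u + t • v) y) * v y) t := HasDerivAt.fun_sum fun y _ => h1 y
  have hZ := sum_exp_pos (u + t • v)
  refine ((h1 x).div h2 hZ.ne').congr_deriv ?_
  simp only [gmean, gibbs]
  have : ∀ y, Real.exp ((u + t • v) y) / (∑ z, Real.exp ((u + t • v) z)) * v y =
      Real.exp ((u + t • v) y) * v y / ∑ z, Real.exp ((u + t • v) z) := fun y => by ring
  simp_rw [this]
  rw [← Finset.sum_div]
  field_simp

lemma hasDerivAt_sum_gibbs [Nonempty X] (u v w : X → ℝ) (t : ℝ) :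
    HasDerivAt (fun t : ℝ => gmean (u + t • v) w)
      (∑ x, gibbs (u + t • v) x * (v x - gmean (u + t • v) v) * w x) t :=
  HasDerivAt.fun_sum fun x _ => (hasDerivAt_gibbs u v t x).mul_const _

/-- The mean is the first derivative of the log-partition function along `v`, so its own derivative
is the second cumulant. -/
lemma hasDerivAt_gmean [Nonempty X] (u v : X → ℝ) (t : ℝ) :
    HasDerivAt (fun t : ℝ => gmean (u + t • v) v) (gvar (u + t • v) v) t := by
  convert hasDerivAt_sum_gibbs u v v t using 1
  have : ∀ x, gibbs (u + t • v) x * (v x - gmean (u + t • v) v) * v x =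
      gibbs (u + t • v) x * v x ^ 2 - gmean (u + t • v) v * (gibbs (u + t • v) x * v x) :=
    fun x => by ring
  simp_rw [this]
  rw [Finset.sum_sub_distrib, ← Finset.mul_sum, gvar_eq]
  change _ = _ - gmean (u + t • v) v * gmean (u + t • v) v
  ring

lemma gmean_line_mono [Nonempty X] (u v : X → ℝ) :
    Monotone (fun t : ℝ => gmean (u + t • v) v) :=
  monotone_of_deriv_nonneg (fun t => (hasDerivAt_gmean u v t).differentiableAt)
    fun t => by rw [(hasDerivAt_gmean u v t).deriv]; exact gvar_nonneg _ _

lemma gmean_sub_nonneg [Nonempty X] (u v : X → ℝ) : 0 ≤ gmean (u + v) v - gmean u v := by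
  have : gmean (u + (0 : ℝ) • v) v ≤ gmean (u + (1 : ℝ) • v) v :=
    gmean_line_mono u v zero_le_one
  rw [zero_smul, add_zero, one_smul] at this
  linarith

/-- The increment of the mean is the integral of the variances along the segment. All of them are
nonnegative, so it suffices to look at a subinterval on which the moving law dominates a multiple of
the reference law. Both self-concordance bounds are instances, with the subinterval at the start or
at the end. -/
lemma mul_gvar_le_gmean_sub [Nonempty X] {u v u' : X → ℝ} {a b c : ℝ} (ha : 0 ≤ a) (hab : a ≤ b)
    (hb : b ≤ 1) (hc : 0 ≤ c)
    (h : ∀ s ∈ Set.Icc a b, ∀ x, c * gibbs u' x ≤ gibbs (u + s • v) x) :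
    c * (b - a) * gvar u' v ≤ gmean (u + v) v - gmean u v := by
  have h0 := gmean_line_mono u v ha
  have h1 := gmean_line_mono u v hb
  simp only [zero_smul, add_zero, one_smul] at h0 h1
  have h2 := (convex_Icc a b).mul_sub_le_image_sub_of_le_deriv
    (f := fun t : ℝ => gmean (u + t • v) v) (C := c * gvar u' v)
    (fun t _ => (hasDerivAt_gmean u v t).continuousAt.continuousWithinAt)
    (fun t _ => (hasDerivAt_gmean u v t).differentiableAt.differentiableWithinAt)
    (fun t ht => by
      rw [(hasDerivAt_gmean u v t).deriv]
      exact gvar_mono v hc (h t (interior_subset ht)))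
    a (Set.left_mem_Icc.2 hab) b (Set.right_mem_Icc.2 hab) hab
  nlinarith [h2]

/-- Self-concordance at the initial point of a segment. -/
lemma gvar_le_of_range [Nonempty X] (u v : X → ℝ) {r : ℝ} (hr : 0 ≤ r)
    (hv : ∀ x y, v x - v y ≤ r) :
    gvar u v ≤ Real.exp 1 * (1 + r) * (gmean (u + v) v - gmean u v) := by
  have h1r : (0 : ℝ) < 1 + r := by linarith
  -- On the initial piece of length `1 / (1 + r)` log-weights move relative to each other by at most
  -- 1, so no probability drops by more than a factor `e`.
  have key := mul_gvar_le_gmean_sub (u := u) (v := v) (u' := u) (a := 0) (b := (1 + r)⁻¹)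
    (c := Real.exp (-1)) le_rfl (inv_nonneg.2 h1r.le)
    (inv_le_one_of_one_le₀ (by linarith)) (Real.exp_pos _).le (by
      intro s hs x
      have hs0 : 0 ≤ s := hs.1
      have hsr : s * r ≤ 1 := by
        calc s * r ≤ (1 + r)⁻¹ * (1 + r) :=
              mul_le_mul hs.2 (by linarith) hr (inv_nonneg.2 h1r.le)
          _ = 1 := inv_mul_cancel₀ h1r.ne'
      have hZ := sum_exp_pos u
      have hZ' := sum_exp_pos (u + s • v)
      have hle : ∑ y, Real.exp ((u + s • v) y) ≤
          Real.exp (s * v x + 1) * ∑ y, Real.exp (u y) := by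
        rw [Finset.mul_sum]
        refine Finset.sum_le_sum fun y _ => ?_
        rw [← Real.exp_add]
        refine Real.exp_le_exp.2 ?_
        have := mul_le_mul_of_nonneg_left (hv y x) hs0
        simp only [Pi.add_apply, Pi.smul_apply, smul_eq_mul]
        nlinarith
      simp only [gibbs]
      rw [le_div_iff₀ hZ']
      calc Real.exp (-1) * (Real.exp (u x) / ∑ y, Real.exp (u y)) *
            ∑ y, Real.exp ((u + s • v) y)
          ≤ Real.exp (-1) * (Real.exp (u x) / ∑ y, Real.exp (u y)) *
            (Real.exp (s * v x + 1) * ∑ y, Real.exp (u y)) := by gcongr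
        _ = Real.exp (-1) * Real.exp (u x) * Real.exp (s * v x + 1) := by field_simp
        _ = Real.exp ((u + s • v) x) := by
            rw [← Real.exp_add, ← Real.exp_add]; congr 1
            simp only [Pi.add_apply, Pi.smul_apply, smul_eq_mul]; ring)
  rw [sub_zero, Real.exp_neg] at key
  have he := Real.exp_pos 1
  calc gvar u v = Real.exp 1 * (1 + r) * ((Real.exp 1)⁻¹ * (1 + r)⁻¹ * gvar u v) := by
        field_simp
    _ ≤ _ := by gcongr

/-- Self-concordance at the end point of a segment that starts at a bounded vector: the constant
does not depend on the length of the segment. -/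
lemma gvar_add_le_of_abs_le [Nonempty X] (u v : X → ℝ) {B : ℝ} (hu : ∀ x, |u x| ≤ B) :
    gvar (u + v) v ≤ 4 * (4 * (B + 1) + 2 * Real.log (Fintype.card X)) *
      (gmean (u + v) v - gmean u v) := by
  obtain ⟨x₀, hx₀⟩ := Finite.exists_max v
  have hB : 0 ≤ B := (abs_nonneg _).trans (hu x₀)
  have hn : (1 : ℝ) ≤ Fintype.card X := by exact_mod_cast Fintype.card_pos
  have hlog := Real.log_nonneg hn
  -- Chosen so that `3/4 * G ≥ 2 * B + log (card X)`: a point whose `v` is more than `G` below the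
  -- maximum stays negligible on the last piece `[1 - 1/G, 1]`, where `s ≥ 3/4`.
  set G := 4 * (B + 1) + 2 * Real.log (Fintype.card X) with hG
  have hG4 : 4 ≤ G := by rw [hG]; linarith
  have hGi : G⁻¹ ≤ 1 / 4 := by
    rw [inv_eq_one_div]; exact one_div_le_one_div_of_le (by norm_num) hG4
  have key := mul_gvar_le_gmean_sub (u := u) (v := v) (u' := u + v) (a := 1 - G⁻¹) (b := 1)
    (c := 1 / 4) (by linarith) (by simp; linarith) le_rfl (by norm_num) (by
      intro s hs x
      have hZ := sum_exp_pos (u + v)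
      have hZ' := sum_exp_pos (u + s • v)
      have hs1 : 1 - s ≤ G⁻¹ := by linarith [hs.1]
      have hs0 : 0 ≤ 1 - s := by linarith [hs.2]
      -- After normalising by the maximum of `v`, points within `G` of it change weight by a factor
      -- at most `e ≤ 3`. Each of the others weighs at most a `card X`-th part of the weight at the
      -- maximiser, because `u` is bounded. Summing, the partition function grows at most fourfold.
      have hterm : ∀ y, Real.exp ((u + s • v) y) * Real.exp ((1 - s) * v x₀) ≤
          3 * Real.exp ((u + v) y) + Real.exp ((u + v) x₀) / Fintype.card X := by
        intro y
        rw [← Real.exp_add]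
        simp only [Pi.add_apply, Pi.smul_apply, smul_eq_mul]
        rcases le_or_gt (v x₀ - v y) G with hg | hg
        · have h1 : (1 - s) * (v x₀ - v y) ≤ 1 := by
            calc (1 - s) * (v x₀ - v y) ≤ G⁻¹ * G :=
                  mul_le_mul hs1 hg (by linarith [hx₀ y]) (by positivity)
              _ = 1 := inv_mul_cancel₀ (by positivity)
          have h2 : Real.exp (u y + s * v y + (1 - s) * v x₀) ≤ Real.exp 1 * Real.exp (u y + v y) := by
            rw [← Real.exp_add]; exact Real.exp_le_exp.2 (by linarith)
          have h3 : Real.exp 1 ≤ 3 := Real.exp_one_lt_d9.le.trans (by norm_num)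
          have h4 : (0:ℝ) ≤ Real.exp (u x₀ + v x₀) / Fintype.card X := by positivity
          nlinarith [Real.exp_pos (u y + v y)]
        · have h1 : Real.exp (u y + s * v y + (1 - s) * v x₀) ≤
              Real.exp (u x₀ + v x₀ - Real.log (Fintype.card X)) := by
            refine Real.exp_le_exp.2 ?_
            have hy := (abs_le.1 (hu y)).2
            have hx := (abs_le.1 (hu x₀)).1
            have hs34 : 3 / 4 ≤ s := by linarith
            have : 3 / 4 * G ≤ s * (v x₀ - v y) := mul_le_mul hs34 hg.le (by linarith) (by linarith)
            rw [hG] at this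
            linarith
          rw [Real.exp_sub, Real.exp_log (by linarith)] at h1
          linarith [Real.exp_pos (u y + v y)]
      have hsum : (∑ y, Real.exp ((u + s • v) y)) * Real.exp ((1 - s) * v x₀) ≤
          4 * ∑ y, Real.exp ((u + v) y) := by
        rw [Finset.sum_mul]
        refine (Finset.sum_le_sum fun y _ => hterm y).trans ?_
        rw [Finset.sum_add_distrib, ← Finset.mul_sum, Finset.sum_const, Finset.card_univ,
          nsmul_eq_mul, mul_div_cancel₀ _ (by linarith)]
        have := Finset.single_le_sum (f := fun y => Real.exp ((u + v) y))
          (fun y _ => (Real.exp_pos _).le) (Finset.mem_univ x₀)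
        linarith
      simp only [gibbs]
      rw [le_div_iff₀ hZ']
      have hx : Real.exp ((u + v) x) ≤ Real.exp ((u + s • v) x) * Real.exp ((1 - s) * v x₀) := by
        rw [← Real.exp_add]
        refine Real.exp_le_exp.2 ?_
        have := mul_le_mul_of_nonneg_left (hx₀ x) hs0
        simp only [Pi.add_apply, Pi.smul_apply, smul_eq_mul]
        linarith
      calc 1 / 4 * (Real.exp ((u + v) x) / ∑ y, Real.exp ((u + v) y)) *
            ∑ y, Real.exp ((u + s • v) y)
          ≤ 1 / 4 * (Real.exp ((u + s • v) x) * Real.exp ((1 - s) * v x₀) /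
              ∑ y, Real.exp ((u + v) y)) * ∑ y, Real.exp ((u + s • v) y) := by gcongr
        _ = Real.exp ((u + s • v) x) * (1 / 4 / (∑ y, Real.exp ((u + v) y)) *
            ((∑ y, Real.exp ((u + s • v) y)) * Real.exp ((1 - s) * v x₀))) := by ring
        _ ≤ Real.exp ((u + s • v) x) * (1 / 4 / (∑ y, Real.exp ((u + v) y)) *
            (4 * ∑ y, Real.exp ((u + v) y))) := by gcongr
        _ = Real.exp ((u + s • v) x) := by field_simp)
  have hGpos : 0 < G := by linarith
  calc gvar (u + v) v = 4 * G * (1 / 4 * (1 - (1 - G⁻¹)) * gvar (u + v) v) := by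
        field_simp; ring
    _ ≤ _ := by gcongr

lemma abs_sub_gmean_le [Nonempty X] (u v : X → ℝ) {r : ℝ} (hv : ∀ x y, v x - v y ≤ r) (x : X) :
    |v x - gmean u v| ≤ r := by
  have h : v x - gmean u v = ∑ y, gibbs u y * (v x - v y) := by
    simp_rw [mul_sub]
    rw [Finset.sum_sub_distrib, ← Finset.sum_mul, sum_gibbs, one_mul, gmean]
  rw [h]
  calc |∑ y, gibbs u y * (v x - v y)| ≤ ∑ y, |gibbs u y * (v x - v y)| :=
        Finset.abs_sum_le_sum_abs _ _
    _ ≤ ∑ y, gibbs u y * r := by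
        refine Finset.sum_le_sum fun y _ => ?_
        rw [abs_mul, abs_of_pos (gibbs_pos u y)]
        refine mul_le_mul_of_nonneg_left (abs_le.2 ⟨?_, hv x y⟩) (gibbs_pos u y).le
        linarith [hv y x]
    _ = r := by rw [← Finset.sum_mul, sum_gibbs, one_mul]

/-- Gibbs distributions are Lipschitz in the log-weights, in total variation. -/
lemma sum_abs_gibbs_sub_le [Nonempty X] (u v : X → ℝ) {r : ℝ} (hv : ∀ x y, v x - v y ≤ r) :
    ∑ x, |gibbs (u + v) x - gibbs u x| ≤ r := by
  -- Testing with the sign of the difference turns the ℓ¹ distance into the increment of one mean,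
  -- whose derivative is a covariance of `v` with a function bounded by 1.
  set w : X → ℝ := fun x => if 0 ≤ gibbs (u + v) x - gibbs u x then 1 else -1 with hw
  have hwabs : ∀ x, |w x| ≤ 1 := fun x => by simp only [hw]; split_ifs <;> simp
  have h := convex_univ.image_sub_le_mul_sub_of_deriv_le
    (f := fun t : ℝ => gmean (u + t • v) w) (C := r)
    (fun t _ => (hasDerivAt_sum_gibbs u v w t).continuousAt.continuousWithinAt)
    (fun t _ => (hasDerivAt_sum_gibbs u v w t).differentiableAt.differentiableWithinAt)
    (fun t _ => by
      rw [(hasDerivAt_sum_gibbs u v w t).deriv]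
      calc ∑ x, gibbs (u + t • v) x * (v x - gmean (u + t • v) v) * w x
          ≤ ∑ x, gibbs (u + t • v) x * r := by
            refine Finset.sum_le_sum fun x _ => ?_
            rw [mul_assoc]
            refine mul_le_mul_of_nonneg_left ?_ (gibbs_pos _ x).le
            calc _ ≤ |(v x - gmean (u + t • v) v) * w x| := le_abs_self _
              _ = |v x - gmean (u + t • v) v| * |w x| := abs_mul _ _
              _ ≤ |v x - gmean (u + t • v) v| * 1 :=
                  mul_le_mul_of_nonneg_left (hwabs x) (abs_nonneg _)
              _ ≤ r := by rw [mul_one]; exact abs_sub_gmean_le _ _ hv x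
        _ = r := by rw [← Finset.sum_mul, sum_gibbs, one_mul])
    0 (Set.mem_univ _) 1 (Set.mem_univ _) zero_le_one
  simp only [zero_smul, add_zero, one_smul, sub_zero, mul_one] at h
  refine le_of_eq_of_le ?_ h
  rw [gmean, gmean, ← Finset.sum_sub_distrib]
  refine Finset.sum_congr rfl fun x _ => ?_
  rw [← sub_mul]
  simp only [hw]
  split_ifs with h0
  · rw [abs_of_nonneg h0, mul_one]
  · rw [abs_of_neg (not_le.1 h0)]; ring

lemma sum_abs_gibbs_sub_le_two [Nonempty X] (u u' : X → ℝ) :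
    ∑ x, |gibbs u x - gibbs u' x| ≤ 2 := by
  calc ∑ x, |gibbs u x - gibbs u' x| ≤ ∑ x, (gibbs u x + gibbs u' x) :=
        Finset.sum_le_sum fun x _ => abs_le.2
          ⟨by linarith [gibbs_pos u x, gibbs_pos u' x], by linarith [gibbs_pos u x, gibbs_pos u' x]⟩
    _ = 2 := by rw [Finset.sum_add_distrib, sum_gibbs, sum_gibbs]; norm_num

/-- The cubic Taylor polynomial with its remainder leaves the coefficient `1/2 + 1/6 + 5/96 < 3/4`.
This 3/4 is the variance compensator in all noise weights below. -/
lemma exp_le_quadratic {y : ℝ} (hy : |y| ≤ 1) : Real.exp y ≤ 1 + y + 3 / 4 * y ^ 2 := by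
  have h := Real.exp_bound hy (n := 4) (by norm_num)
  simp only [Finset.sum_range_succ, Finset.sum_range_zero, Nat.factorial] at h
  norm_num at h
  have h1 := (abs_le.1 h).2
  obtain ⟨ha, hb⟩ := abs_le.1 hy
  have h2 : |y| ^ 4 = y ^ 4 := by rw [← abs_pow]; exact abs_of_nonneg (by positivity)
  rw [h2] at h1
  have hy2 : y ^ 2 ≤ 1 := by nlinarith
  have h4 : y ^ 4 ≤ y ^ 2 := by nlinarith [sq_nonneg y]
  have h3 : y ^ 3 ≤ y ^ 2 := by nlinarith [sq_nonneg y]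
  nlinarith [sq_nonneg y]

/-- A Bernstein-type bound: the linear term of the exponential averages to zero, so the cumulant
generating function is at most 3/4 of the variance. It is the one-step supermartingale property of
the context noise. -/
lemma sum_gibbs_mul_exp_le [Nonempty X] (u w : X → ℝ) (hw : ∀ x y, w x - w y ≤ 1) :
    ∑ x, gibbs u x * Real.exp (w x - gmean u w - 3 / 4 * gvar u w) ≤ 1 := by
  have h1 : ∑ x, gibbs u x * Real.exp (w x - gmean u w) ≤ Real.exp (3 / 4 * gvar u w) := by
    calc ∑ x, gibbs u x * Real.exp (w x - gmean u w)
        ≤ ∑ x, gibbs u x * (1 + (w x - gmean u w) + 3 / 4 * (w x - gmean u w) ^ 2) :=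
          Finset.sum_le_sum fun x _ => mul_le_mul_of_nonneg_left
            (exp_le_quadratic (abs_sub_gmean_le u w hw x)) (gibbs_pos u x).le
      _ = 3 / 4 * gvar u w + 1 := by
          have : ∀ x, gibbs u x * (1 + (w x - gmean u w) + 3 / 4 * (w x - gmean u w) ^ 2) =
              (1 - gmean u w) * gibbs u x + gibbs u x * w x +
                3 / 4 * (gibbs u x * (w x - gmean u w) ^ 2) := fun x => by ring
          simp_rw [this]
          rw [Finset.sum_add_distrib, Finset.sum_add_distrib, ← Finset.mul_sum, ← Finset.mul_sum,
            sum_gibbs]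
          change (1 - gmean u w) * 1 + gmean u w + 3 / 4 * gvar u w = _
          ring
      _ ≤ _ := Real.add_one_le_exp _
  simp_rw [Real.exp_sub _ (3 / 4 * gvar u w), mul_div_assoc']
  rw [← Finset.sum_div, div_le_one (Real.exp_pos _)]
  exact h1

end Gibbs

/-! ### Sums over trajectories -/

section Paths

variable {S A : Type*} [Fintype S] [Fintype A] [DecidableEq S] [DecidableEq A] {M H : ℕ}

/-- Extend a trajectory by one step. -/
def Traj.snoc {n : ℕ} (e : Traj S A M n) (a : A) (x : Fin (M + 1)) (s : S) : Traj S A M (n + 1) :=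
  (Fin.snoc (α := fun _ => S) e.1 s, Fin.snoc (α := fun _ => A) e.2.1 a,
    Fin.snoc (α := fun _ => Fin (M + 1)) e.2.2 x)

/-- A trajectory of length `n + 1` is one of length `n` with one more step. -/
def Traj.snocEquiv (S A : Type*) (M n : ℕ) :
    Traj S A M n × A × Fin (M + 1) × S ≃ Traj S A M (n + 1) where
  toFun y := y.1.snoc y.2.1 y.2.2.1 y.2.2.2
  invFun e := ((Fin.init (α := fun _ => S) e.1, Fin.init (α := fun _ => A) e.2.1,
    Fin.init (α := fun _ => Fin (M + 1)) e.2.2), e.2.1 (Fin.last n), e.2.2 (Fin.last n),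
    e.1 (Fin.last (n + 1)))
  left_inv y := by simp [Traj.snoc]
  right_inv e := by simp [Traj.snoc]

lemma Traj.length_steps {n : ℕ} (e : Traj S A M n) : (Traj.steps e).length = n := by
  simp [Traj.steps]

lemma Traj.length_hist {n : ℕ} (e : Traj S A M n) (h : Fin n) : (Traj.hist e h).length = h := by
  simp [Traj.hist, Traj.length_steps]

lemma Traj.steps_snoc {n : ℕ} (e : Traj S A M n) (a : A) (x : Fin (M + 1)) (s : S) :
    Traj.steps (e.snoc a x s) = Traj.steps e ++ [(e.1 (Fin.last n), a, x)] := by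
  unfold Traj.steps
  rw [List.ofFn_succ']
  simp only [List.concat_eq_append]
  congr 1
  · congr 1
    funext h
    simp [Traj.snoc]
  · simp [Traj.snoc]

lemma Traj.hist_snoc_castSucc {n : ℕ} (e : Traj S A M n) (a : A) (x : Fin (M + 1)) (s : S)
    (h : Fin n) : Traj.hist (e.snoc a x s) h.castSucc = Traj.hist e h := by
  unfold Traj.hist
  rw [Traj.steps_snoc, List.take_append_of_le_length]
  · rfl
  · rw [Traj.length_steps]; exact h.2.le

lemma Traj.hist_snoc_last {n : ℕ} (e : Traj S A M n) (a : A) (x : Fin (M + 1)) (s : S) :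
    Traj.hist (e.snoc a x s) (Fin.last n) = Traj.steps e := by
  unfold Traj.hist
  rw [Traj.steps_snoc, List.take_append_of_le_length] <;> simp [Traj.length_steps]

lemma Traj.snoc_state_castSucc {n : ℕ} (e : Traj S A M n) (a : A) (x : Fin (M + 1)) (s : S)
    (h : Fin (n + 1)) : (e.snoc a x s).1 h.castSucc = e.1 h := by
  simp [Traj.snoc]

lemma Traj.snoc_state_last {n : ℕ} (e : Traj S A M n) (a : A) (x : Fin (M + 1)) (s : S) :
    (e.snoc a x s).1 (Fin.last (n + 1)) = s := by
  simp [Traj.snoc]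

/-- The weight of a trajectory under the step weights `p`. -/
def pathProb (p : Hist S A M → S → A → Fin (M + 1) → S → ℝ) (s₁ : S) {n : ℕ}
    (e : Traj S A M n) : ℝ :=
  (if e.1 0 = s₁ then 1 else 0) *
    ∏ h : Fin n, p (Traj.hist e h) (e.1 h.castSucc) (e.2.1 h) (e.2.2 h) (e.1 h.succ)

lemma pathProb_snoc (p : Hist S A M → S → A → Fin (M + 1) → S → ℝ) (s₁ : S) {n : ℕ}
    (e : Traj S A M n) (a : A) (x : Fin (M + 1)) (s : S) :
    pathProb p s₁ (e.snoc a x s) =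
      pathProb p s₁ e * p (Traj.steps e) (e.1 (Fin.last n)) a x s := by
  unfold pathProb
  rw [Fin.prod_univ_castSucc]
  have h0 : (e.snoc a x s).1 0 = e.1 0 := Traj.snoc_state_castSucc e a x s 0
  have h1 : ∀ h : Fin n, (e.snoc a x s).1 h.castSucc.succ = e.1 h.succ := fun h => by
    rw [Fin.succ_castSucc, Traj.snoc_state_castSucc]
  have h2 : ∀ h : Fin n, (e.snoc a x s).2.1 h.castSucc = e.2.1 h := fun h => by simp [Traj.snoc]
  have h3 : ∀ h : Fin n, (e.snoc a x s).2.2 h.castSucc = e.2.2 h := fun h => by simp [Traj.snoc]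
  have h4 : (e.snoc a x s).2.1 (Fin.last n) = a := by simp [Traj.snoc]
  have h5 : (e.snoc a x s).2.2 (Fin.last n) = x := by simp [Traj.snoc]
  simp only [Traj.hist_snoc_castSucc, Traj.hist_snoc_last, Fin.succ_last, h0, h1, h2, h3, h4, h5,
    Traj.snoc_state_castSucc, Traj.snoc_state_last, mul_assoc]

lemma pathProb_nonneg {p : Hist S A M → S → A → Fin (M + 1) → S → ℝ}
    (hp : ∀ τ s a x s', 0 ≤ p τ s a x s') (s₁ : S) {n : ℕ} (e : Traj S A M n) :
    0 ≤ pathProb p s₁ e :=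
  mul_nonneg (by split_ifs <;> simp) (Finset.prod_nonneg fun _ _ => hp _ _ _ _ _)

lemma sum_traj_succ {n : ℕ} (F : Traj S A M (n + 1) → ℝ) :
    ∑ e, F e = ∑ e : Traj S A M n, ∑ a, ∑ x, ∑ s, F (e.snoc a x s) := by
  rw [← (Traj.snocEquiv S A M n).sum_comp]
  simp only [Fintype.sum_prod_type]
  rfl

lemma sum_traj_zero (F : Traj S A M 0 → ℝ) :
    ∑ e, F e = ∑ s, F (fun _ => s, Fin.elim0, Fin.elim0) := by
  refine (Fintype.sum_equiv (⟨fun s => (fun _ => s, Fin.elim0, Fin.elim0), fun e => e.1 0,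
    fun _ => rfl, fun e => ?_⟩ : S ≃ Traj S A M 0) _ _ fun _ => rfl).symm
  refine Prod.ext (funext fun i => ?_) (Prod.ext (funext fun i => i.elim0)
    (funext fun i => i.elim0))
  change e.1 0 = e.1 i
  exact congrArg e.1 (Subsingleton.elim (α := Fin 1) _ _)

/-- Accumulated payoffs, under a Bellman inequality. -/
lemma sum_pathProb_add_le {p : Hist S A M → S → A → Fin (M + 1) → S → ℝ}
    (hp : ∀ τ s a x s', 0 ≤ p τ s a x s') (c : Hist S A M → S → A → Fin (M + 1) → ℝ)
    (V : Hist S A M → S → ℝ) (s₁ : S) (n : ℕ)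
    (hp1 : ∀ τ s, τ.length < n → ∑ a, ∑ x, ∑ s', p τ s a x s' = 1)
    (hV : ∀ τ s, τ.length < n →
      ∑ a, ∑ x, ∑ s', p τ s a x s' * (c τ s a x + V (τ ++ [(s, a, x)]) s') ≤ V τ s) :
    ∑ e : Traj S A M n, pathProb p s₁ e *
      ((∑ h : Fin n, c (Traj.hist e h) (e.1 h.castSucc) (e.2.1 h) (e.2.2 h)) +
        V (Traj.steps e) (e.1 (Fin.last n))) ≤ V [] s₁ := by
  induction n with
  | zero =>
    rw [sum_traj_zero]
    simp [pathProb, Traj.steps]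
  | succ n ih =>
    -- Sum out the last step: the Bellman inequality absorbs its payoff and the continuation into
    -- the value at the shorter history, and the payoff already collected only needs total mass one.
    refine le_trans ?_ (ih (fun τ s h => hp1 τ s (h.trans n.lt_succ_self))
      (fun τ s h => hV τ s (h.trans n.lt_succ_self)))
    rw [sum_traj_succ]
    refine Finset.sum_le_sum fun e _ => ?_
    set C := ∑ h : Fin n, c (Traj.hist e h) (e.1 h.castSucc) (e.2.1 h) (e.2.2 h) with hC
    have key : ∀ a x s, pathProb p s₁ (e.snoc a x s) *
        ((∑ h : Fin (n + 1), c (Traj.hist (e.snoc a x s) h) ((e.snoc a x s).1 h.castSucc)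
          ((e.snoc a x s).2.1 h) ((e.snoc a x s).2.2 h)) +
        V (Traj.steps (e.snoc a x s)) ((e.snoc a x s).1 (Fin.last (n + 1)))) =
        pathProb p s₁ e * (p (Traj.steps e) (e.1 (Fin.last n)) a x s * C +
          p (Traj.steps e) (e.1 (Fin.last n)) a x s * (c (Traj.steps e) (e.1 (Fin.last n)) a x +
            V (Traj.steps e ++ [(e.1 (Fin.last n), a, x)]) s)) := by
      intro a x s
      rw [pathProb_snoc, Fin.sum_univ_castSucc, Traj.steps_snoc, Traj.snoc_state_last]
      simp only [Traj.hist_snoc_castSucc, Traj.hist_snoc_last, Traj.snoc_state_castSucc]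
      have h1 : ∀ h : Fin n, (e.snoc a x s).2.1 h.castSucc = e.2.1 h := fun h => by simp [Traj.snoc]
      have h2 : ∀ h : Fin n, (e.snoc a x s).2.2 h.castSucc = e.2.2 h := fun h => by simp [Traj.snoc]
      have h3 : (e.snoc a x s).2.1 (Fin.last n) = a := by simp [Traj.snoc]
      have h4 : (e.snoc a x s).2.2 (Fin.last n) = x := by simp [Traj.snoc]
      simp only [h1, h2, h3, h4, ← hC]
      ring
    simp_rw [key, ← Finset.mul_sum, Finset.sum_add_distrib]
    refine mul_le_mul_of_nonneg_left ?_ (pathProb_nonneg hp _ _)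
    have hlen : (Traj.steps e).length < n + 1 := by rw [Traj.length_steps]; exact n.lt_succ_self
    refine add_le_add (le_of_eq ?_) (hV _ _ hlen)
    simp_rw [← Finset.sum_mul]
    rw [hp1 _ _ hlen, one_mul]

/-- The mirror image of the previous bound, by changing the signs of payoffs and values. The upper
bound serves optimism, this one the loss of the greedy policy. -/
lemma le_sum_pathProb_add {p : Hist S A M → S → A → Fin (M + 1) → S → ℝ}
    (hp : ∀ τ s a x s', 0 ≤ p τ s a x s') (c : Hist S A M → S → A → Fin (M + 1) → ℝ)
    (V : Hist S A M → S → ℝ) (s₁ : S) (n : ℕ)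
    (hp1 : ∀ τ s, τ.length < n → ∑ a, ∑ x, ∑ s', p τ s a x s' = 1)
    (hV : ∀ τ s, τ.length < n →
      V τ s ≤ ∑ a, ∑ x, ∑ s', p τ s a x s' * (c τ s a x + V (τ ++ [(s, a, x)]) s')) :
    V [] s₁ ≤ ∑ e : Traj S A M n, pathProb p s₁ e *
      ((∑ h : Fin n, c (Traj.hist e h) (e.1 h.castSucc) (e.2.1 h) (e.2.2 h)) +
        V (Traj.steps e) (e.1 (Fin.last n))) := by
  have := sum_pathProb_add_le hp (fun τ s a x => - c τ s a x) (fun τ s => - V τ s) s₁ n hp1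
    (fun τ s h => by
      simp only [← neg_add, mul_neg, Finset.sum_neg_distrib]
      exact neg_le_neg (hV τ s h))
  simp only [← neg_add, mul_neg, Finset.sum_neg_distrib] at this
  exact neg_le_neg_iff.1 this

lemma sum_pathProb {p : Hist S A M → S → A → Fin (M + 1) → S → ℝ}
    (hp : ∀ τ s a x s', 0 ≤ p τ s a x s') (s₁ : S) (n : ℕ)
    (hp1 : ∀ τ s, τ.length < n → ∑ a, ∑ x, ∑ s', p τ s a x s' = 1) :
    ∑ e : Traj S A M n, pathProb p s₁ e = 1 := by
  refine le_antisymm ?_ ?_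
  · simpa using sum_pathProb_add_le hp (fun _ _ _ _ => 0) (fun _ _ => 1) s₁ n hp1
      (fun τ s h => by simp [hp1 τ s h])
  · simpa using le_sum_pathProb_add hp (fun _ _ _ _ => 0) (fun _ _ => 1) s₁ n hp1
      (fun τ s h => by simp [hp1 τ s h])

/-- Products of step weights, each of mean at most one, have mean at most one. -/
lemma sum_pathProb_mul_prod_le {p : Hist S A M → S → A → Fin (M + 1) → S → ℝ}
    (hp : ∀ τ s a x s', 0 ≤ p τ s a x s') (w : Hist S A M → S → A → Fin (M + 1) → S → ℝ)
    (hw0 : ∀ τ s a x s', 0 ≤ w τ s a x s') (s₁ : S) (n : ℕ)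
    (hw : ∀ τ s, τ.length < n → ∑ a, ∑ x, ∑ s', p τ s a x s' * w τ s a x s' ≤ 1) :
    ∑ e : Traj S A M n, pathProb p s₁ e *
      ∏ h : Fin n, w (Traj.hist e h) (e.1 h.castSucc) (e.2.1 h) (e.2.2 h) (e.1 h.succ) ≤ 1 := by
  -- Absorbing the weights into the step probabilities leaves a substochastic kernel, and its paths
  -- have total mass at most one.
  set q : Hist S A M → S → A → Fin (M + 1) → S → ℝ := fun τ s a x s' => p τ s a x s' * w τ s a x s'
  have hq : ∀ τ s a x s', 0 ≤ q τ s a x s' := fun τ s a x s' => mul_nonneg (hp ..) (hw0 ..)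
  have h1 : ∀ e : Traj S A M n, pathProb p s₁ e *
      ∏ h : Fin n, w (Traj.hist e h) (e.1 h.castSucc) (e.2.1 h) (e.2.2 h) (e.1 h.succ) =
      pathProb q s₁ e := fun e => by
    simp only [pathProb, q, Finset.prod_mul_distrib, mul_assoc]
  simp_rw [h1]
  clear h1
  induction n with
  | zero =>
    rw [sum_traj_zero]
    simp [pathProb]
  | succ n ih =>
    refine le_trans ?_ (ih (fun τ s h => hw τ s (h.trans n.lt_succ_self)))
    rw [sum_traj_succ]
    refine Finset.sum_le_sum fun e _ => ?_
    simp_rw [pathProb_snoc, ← Finset.mul_sum]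
    refine mul_le_of_le_one_right (pathProb_nonneg hq _ _) (hw _ _ ?_)
    rw [Traj.length_steps]; exact n.lt_succ_self

end Paths

/-! ### The softmax as a Gibbs distribution -/

section Softmax

variable {M : ℕ}

/-- Extend a vector by the value `0` at the reference class. -/
def extZero (w : Fin M → ℝ) : Fin (M + 1) → ℝ := Fin.snoc (α := fun _ => ℝ) w 0

@[simp] lemma extZero_castSucc (w : Fin M → ℝ) (i : Fin M) : extZero w i.castSucc = w i := by
  simp [extZero]

@[simp] lemma extZero_last (w : Fin M → ℝ) : extZero w (Fin.last M) = 0 := by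
  simp [extZero]

lemma extZero_add (v w : Fin M → ℝ) : extZero (v + w) = extZero v + extZero w := by
  funext x
  refine Fin.lastCases ?_ (fun i => ?_) x <;> simp

lemma extZero_smul (c : ℝ) (w : Fin M → ℝ) : extZero (c • w) = c • extZero w := by
  funext x
  refine Fin.lastCases ?_ (fun i => ?_) x <;> simp

lemma softmax_eq_gibbs (η : ℝ) (u : Fin M → ℝ) :
    softmax η u = gibbs (extZero (η • u)) := by
  have hsum : ∑ y, Real.exp (extZero (η • u) y) = 1 + ∑ m, Real.exp (η * u m) := by
    rw [Fin.sum_univ_castSucc]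
    simp [add_comm]
  have hpos : 0 < 1 + ∑ m, Real.exp (η * u m) := by
    rw [← hsum]; exact sum_exp_pos _
  funext x
  refine Fin.lastCases ?_ (fun i => ?_) x
  · simp only [softmax, Fin.snoc_last, gibbs, hsum, extZero_last, Real.exp_zero]
    rw [← Finset.sum_div]
    field_simp
    ring
  · simp [softmax, gibbs, hsum]

/-- The matrix is the covariance of the one-hot context with the reference class deleted, so its
quadratic form is the variance of `w` extended by 0 at that class. -/
lemma dotProduct_softmaxGrad (η : ℝ) (u w : Fin M → ℝ) :
    w ⬝ᵥ (softmaxGrad η u).mulVec w = gvar (extZero (η • u)) (extZero w) := by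
  rw [gvar_eq]
  simp only [gmean, ← softmax_eq_gibbs]
  rw [Fin.sum_univ_castSucc, Fin.sum_univ_castSucc]
  simp only [extZero_castSucc, extZero_last, mul_zero, ne_eq, OfNat.ofNat_ne_zero,
    not_false_eq_true, zero_pow, add_zero]
  rw [softmaxGrad, Matrix.sub_mulVec, dotProduct_sub, Matrix.vecMulVec_mulVec]
  congr 1
  · simp only [dotProduct, Matrix.mulVec_diagonal]
    exact Finset.sum_congr rfl fun i _ => by ring
  · simp only [dotProduct, Pi.smul_apply, MulOpposite.smul_eq_mul_unop, MulOpposite.unop_op]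
    rw [sq, Finset.sum_mul_sum, Finset.sum_comm]
    simp_rw [Finset.mul_sum]
    exact Finset.sum_congr rfl fun i _ => Finset.sum_congr rfl fun j _ => by ring

lemma softmaxGrad_isHermitian (η : ℝ) (u : Fin M → ℝ) : (softmaxGrad η u).IsHermitian := by
  refine Matrix.IsHermitian.sub (Matrix.isHermitian_diagonal _) ?_
  ext i j
  simp [Matrix.vecMulVec_apply, mul_comm]

lemma extZero_sub_le (w : Fin M → ℝ) (x y : Fin (M + 1)) :
    extZero w x - extZero w y ≤ Real.sqrt (2 * ∑ i, w i ^ 2) := by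
  refine Real.le_sqrt_of_sq_le ?_
  have hext : ∑ z, extZero w z ^ 2 = ∑ i, w i ^ 2 := by
    rw [Fin.sum_univ_castSucc]; simp
  rcases eq_or_ne x y with h | h
  · rw [h, sub_self]
    have : 0 ≤ ∑ i, w i ^ 2 := Finset.sum_nonneg fun i _ => sq_nonneg _
    linarith
  · have h2 : extZero w x ^ 2 + extZero w y ^ 2 ≤ ∑ z, extZero w z ^ 2 := by
      rw [← Finset.sum_pair h (f := fun z => extZero w z ^ 2)]
      exact Finset.sum_le_sum_of_subset_of_nonneg (Finset.subset_univ _)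
        fun _ _ _ => sq_nonneg _
    nlinarith [sq_nonneg (extZero w x + extZero w y)]

lemma abs_extZero_le (w : Fin M → ℝ) (x : Fin (M + 1)) :
    |extZero w x| ≤ Real.sqrt (∑ i, w i ^ 2) := by
  refine Real.abs_le_sqrt ?_
  have hext : ∑ z, extZero w z ^ 2 = ∑ i, w i ^ 2 := by
    rw [Fin.sum_univ_castSucc]; simp
  rw [← hext]
  exact Finset.single_le_sum (f := fun z => extZero w z ^ 2) (fun _ _ => sq_nonneg _)
    (Finset.mem_univ x)

/-- Zero variance under a law of full support forces a constant, and the reference class pins that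
constant to 0. -/
lemma gvar_extZero_pos (u : Fin (M + 1) → ℝ) {w : Fin M → ℝ} (hw : w ≠ 0) :
    0 < gvar u (extZero w) := by
  refine lt_of_le_of_ne (gvar_nonneg _ _) fun h => hw ?_
  have h0 := (Finset.sum_eq_zero_iff_of_nonneg
    (fun x _ => mul_nonneg (gibbs_pos u x).le (sq_nonneg _))).1 h.symm
  have h1 : ∀ x, extZero w x = gmean u (extZero w) := fun x => by
    have := (mul_eq_zero.1 (h0 x (Finset.mem_univ x))).resolve_left (gibbs_pos u x).ne'
    exact sub_eq_zero.1 (pow_eq_zero_iff (two_ne_zero) |>.1 this)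
  funext i
  rw [← extZero_castSucc w i, h1, ← h1 (Fin.last M), extZero_last]
  rfl

lemma gvar_extZero_le (u : Fin (M + 1) → ℝ) (w : Fin M → ℝ) :
    gvar u (extZero w) ≤ ∑ i, w i ^ 2 := by
  refine (gvar_le u _ 0).trans ?_
  rw [Fin.sum_univ_castSucc]
  simp only [extZero_castSucc, extZero_last, sub_zero, ne_eq, OfNat.ofNat_ne_zero,
    not_false_eq_true, zero_pow, mul_zero, add_zero]
  refine Finset.sum_le_sum fun i _ => mul_le_of_le_one_left (sq_nonneg _) ?_
  rw [← sum_gibbs u]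
  exact Finset.single_le_sum (fun x _ => (gibbs_pos u x).le) (Finset.mem_univ _)

lemma softmaxGrad_posDef (η : ℝ) (u : Fin M → ℝ) : (softmaxGrad η u).PosDef := by
  refine Matrix.PosDef.of_dotProduct_mulVec_pos (softmaxGrad_isHermitian η u) fun w hw => ?_
  rw [star_trivial, dotProduct_softmaxGrad]
  exact gvar_extZero_pos _ hw

/-- The least eigenvalue bounds the quadratic form from below. -/
lemma sInf_spectrum_mul_le {n : Type*} [Fintype n] [DecidableEq n] {B : Matrix n n ℝ}
    (hB : B.IsHermitian) (w : n → ℝ) :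
    sInf (spectrum ℝ B) * ∑ i, w i ^ 2 ≤ w ⬝ᵥ B.mulVec w := by
  set c := sInf (spectrum ℝ B)
  have hfin : (spectrum ℝ B).Finite := by
    rw [hB.spectrum_real_eq_range_eigenvalues]; exact Set.finite_range _
  have hpsd : (B - c • (1 : Matrix n n ℝ)).PosSemidef := by
    rw [Matrix.posSemidef_iff_isHermitian_and_spectrum_nonneg]
    refine ⟨hB.sub (by ext i j; simp [Matrix.one_apply, eq_comm]), fun t ht => ?_⟩
    have h1 : B - c • (1 : Matrix n n ℝ) = B - algebraMap ℝ _ c := by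
      rw [Algebra.algebraMap_eq_smul_one]
    rw [h1] at ht
    have h2 : t + c ∈ spectrum ℝ B := by
      have := spectrum.add_mem_add_iff (r := t) (s := c) (a := B - algebraMap ℝ _ c)
      rw [add_sub_cancel] at this
      exact this.2 ht
    have := csInf_le hfin.bddBelow h2
    change (0 : ℝ) ≤ t
    linarith
  have := hpsd.dotProduct_mulVec_nonneg w
  rw [star_trivial, Matrix.sub_mulVec, dotProduct_sub, Matrix.smul_mulVec, Matrix.one_mulVec,
    dotProduct_smul, smul_eq_mul] at this
  have h2 : w ⬝ᵥ w = ∑ i, w i ^ 2 := Finset.sum_congr rfl fun i _ => (sq _).symm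
  rw [h2] at this
  linarith

end Softmax

/-! ### The model in terms of Gibbs distributions -/

section ModelGibbs

variable {S A : Type*} [Fintype S] [Fintype A] [DecidableEq S] [DecidableEq A] {M H : ℕ}

/-- The linear image `(⟨f_i, d⟩)_i` of a feature vector. -/
def blockDot {I : Type*} [Fintype I] (f : Fin M × I → ℝ) (d : I → ℝ) : Fin M → ℝ :=
  fun i => ∑ p, f (i, p) * d p

lemma blockDot_add {I : Type*} [Fintype I] (f g : Fin M × I → ℝ) (d : I → ℝ) :
    blockDot (f + g) d = blockDot f d + blockDot g d := by
  funext i; simp [blockDot, add_mul, Finset.sum_add_distrib]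

lemma blockDot_smul {I : Type*} [Fintype I] (c : ℝ) (f : Fin M × I → ℝ) (d : I → ℝ) :
    blockDot (c • f) d = c • blockDot f d := by
  funext i; simp [blockDot, Finset.mul_sum, mul_assoc]

lemma sum_blockDot_sq_le {I : Type*} [Fintype I] (f : Fin M × I → ℝ) (d : I → ℝ) :
    ∑ i, blockDot f d i ^ 2 ≤ (∑ p, f p ^ 2) * ∑ p, d p ^ 2 := by
  rw [Fintype.sum_prod_type, Finset.sum_mul]
  exact Finset.sum_le_sum fun i _ => Finset.sum_mul_sq_le_sq_mul_sq _ _ _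

lemma dotProduct_kronecker_mulVec {I : Type*} [Fintype I] (B : Matrix (Fin M) (Fin M) ℝ)
    (f : Fin M × I → ℝ) (d : I → ℝ) :
    f ⬝ᵥ (B ⊗ₖ Matrix.vecMulVec d d).mulVec f = blockDot f d ⬝ᵥ B.mulVec (blockDot f d) := by
  simp only [dotProduct, Matrix.mulVec, Matrix.kroneckerMap_apply, Matrix.vecMulVec_apply,
    blockDot, Fintype.sum_prod_type, Finset.mul_sum, Finset.sum_mul]
  refine Finset.sum_congr rfl fun i _ => ?_
  rw [Finset.sum_comm]
  refine Finset.sum_congr rfl fun j _ => ?_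
  rw [Finset.sum_comm]
  exact Finset.sum_congr rfl fun p _ => Finset.sum_congr rfl fun q _ => by ring

namespace Model

/-- The log-weights of the contexts after the history `τ` under the features `f`. -/
def logits (m : Model S A M H) (f : Feat S A M H) (τ : Hist S A M) : Fin (M + 1) → ℝ :=
  extZero (blockDot f (m.visit τ))

lemma logits_add (m : Model S A M H) (f g : Feat S A M H) (τ : Hist S A M) :
    m.logits (f + g) τ = m.logits f τ + m.logits g τ := by
  rw [logits, blockDot_add, extZero_add]; rfl

lemma logits_smul (m : Model S A M H) (c : ℝ) (f : Feat S A M H) (τ : Hist S A M) :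
    m.logits (c • f) τ = c • m.logits f τ := by
  rw [logits, blockDot_smul, extZero_smul]; rfl

lemma eta_smul_suff (m : Model S A M H) (f : Feat S A M H) (τ : Hist S A M) :
    m.η • m.suff f τ = blockDot f (m.visit τ) := by
  funext i
  simp only [Pi.smul_apply, smul_eq_mul, suff, blockDot, Finset.mul_sum]
  rw [Fintype.sum_prod_type]
  refine Finset.sum_congr rfl fun t _ => ?_
  simp only [visit]
  rcases h : (m.start :: τ)[t.val]? with _ | y
  · simp
  · rw [Finset.sum_eq_single y]
    · simp; ring
    · intro z _ hz
      rw [if_neg (fun h => hz (Option.some.inj h).symm), mul_zero]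
    · simp

lemma ctxProb_eq (m : Model S A M H) (f : Feat S A M H) (τ : Hist S A M) :
    m.ctxProb f τ = gibbs (m.logits f τ) := by
  rw [ctxProb, softmax_eq_gibbs, eta_smul_suff, logits]

/-- This is what the temperature condition is for. Different times occupy different coordinates, so
the squared norm is `η²` times a sum of squared powers of `α`, which is at most `η²` times the
effective horizon. -/
lemma sum_visit_sq_le (m : Model S A M H) (hη : m.η ≤ 1 / Real.sqrt (effHorizon m.α H))
    (τ : Hist S A M) (hτ : τ.length < H) : ∑ p, m.visit τ p ^ 2 ≤ 1 := by
  obtain ⟨hα0, hα1⟩ := m.α_mem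
  have heff : 1 ≤ effHorizon m.α H := by
    unfold effHorizon
    have := Finset.single_le_sum (f := fun t => m.α ^ t) (fun t _ => pow_nonneg hα0 t)
      (Finset.mem_range.2 (show 0 < 2 * H by omega))
    simpa using this
  have hη2 : m.η ^ 2 * effHorizon m.α H ≤ 1 := by
    have h1 : m.η ^ 2 ≤ (1 / Real.sqrt (effHorizon m.α H)) ^ 2 :=
      pow_le_pow_left₀ m.η_pos.le hη 2
    rw [div_pow, Real.sq_sqrt (by linarith), one_pow] at h1
    calc m.η ^ 2 * effHorizon m.α H ≤ 1 / effHorizon m.α H * effHorizon m.α H := by gcongr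
      _ = 1 := by field_simp
  refine le_trans ?_ hη2
  rw [Fintype.sum_prod_type]
  have hin : ∀ t : Fin H, ∑ y, m.visit τ (t, y) ^ 2 ≤
      if t.val ∈ Finset.range (τ.length + 1) then m.η ^ 2 * m.α ^ (τ.length - t.val) else 0 := by
    intro t
    simp only [visit]
    split_ifs with ht
    · rw [Finset.mem_range] at ht
      have hlt : t.val < (m.start :: τ).length := by simpa using ht
      rw [List.getElem?_eq_getElem hlt, Finset.sum_eq_single (m.start :: τ)[t.val]]
      · rw [if_pos rfl, mul_pow]
        gcongr
        rw [← pow_mul]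
        exact pow_le_pow_of_le_one hα0 hα1 (by omega)
      · intro z _ hz
        rw [if_neg (fun h => hz (Option.some.inj h).symm)]; norm_num
      · simp
    · rw [Finset.mem_range, not_lt] at ht
      rw [List.getElem?_eq_none (by simpa using ht)]
      simp
  refine (Finset.sum_le_sum fun t _ => hin t).trans ?_
  rw [Fin.sum_univ_eq_sum_range (fun t => if t ∈ Finset.range (τ.length + 1) then
    m.η ^ 2 * m.α ^ (τ.length - t) else 0) H, Finset.sum_ite_mem,
    Finset.inter_eq_right.2 (Finset.range_mono (by omega)), ← Finset.mul_sum]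
  gcongr
  have hrefl := Finset.sum_range_reflect (fun j => m.α ^ j) (τ.length + 1)
  simp only [Nat.add_sub_cancel] at hrefl
  have h2 : ∑ t ∈ Finset.range (τ.length + 1), m.α ^ (τ.length - t) =
      ∑ t ∈ Finset.range (τ.length + 1), m.α ^ t := by
    rw [← hrefl]
  rw [h2]
  exact Finset.sum_le_sum_of_subset_of_nonneg (Finset.range_mono (by omega))
    fun _ _ _ => pow_nonneg hα0 _

/-- Score and Hessian enter the analysis through pairings with a direction, which are sums of Gibbs
means here and of Gibbs variances in `dotProduct_hessMat`. The Kronecker structure disappears at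
this point. -/
lemma dotProduct_gVec (m : Model S A M H) (lam : ℝ) (D : ℕ → Traj S A M H) (k : ℕ)
    (f g : Feat S A M H) :
    g ⬝ᵥ m.gVec lam D k f = lam * ∑ p, g p * f p +
      ∑ k' ∈ Finset.Ico 1 k, ∑ h : Fin H,
        gmean (m.logits f (Traj.hist (D k') h)) (m.logits g (Traj.hist (D k') h)) := by
  simp only [dotProduct, gVec, mul_add, Finset.sum_add_distrib, Finset.mul_sum]
  congr 1
  · exact Finset.sum_congr rfl fun p _ => by ring
  · rw [Finset.sum_comm]
    refine Finset.sum_congr rfl fun k' _ => ?_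
    rw [Finset.sum_comm]
    refine Finset.sum_congr rfl fun h _ => ?_
    rw [gmean, Fin.sum_univ_castSucc, Fintype.sum_prod_type]
    simp only [ctxProb_eq, logits, extZero_castSucc, extZero_last, mul_zero, add_zero, blockDot,
      Finset.mul_sum]
    exact Finset.sum_congr rfl fun i _ => Finset.sum_congr rfl fun p _ => by ring

lemma dotProduct_hessMat (m : Model S A M H) (lam : ℝ) (D : ℕ → Traj S A M H) (k : ℕ)
    (f g : Feat S A M H) :
    g ⬝ᵥ (m.hessMat lam D k f).mulVec g = lam * ∑ p, g p ^ 2 +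
      ∑ k' ∈ Finset.Ico 1 k, ∑ h : Fin H,
        gvar (m.logits f (Traj.hist (D k') h)) (m.logits g (Traj.hist (D k') h)) := by
  rw [hessMat, Matrix.add_mulVec, dotProduct_add, Matrix.smul_mulVec, Matrix.one_mulVec,
    dotProduct_smul, smul_eq_mul, Matrix.sum_mulVec, dotProduct_sum]
  congr 1
  · congr 1; exact Finset.sum_congr rfl fun i _ => (sq _).symm
  · refine Finset.sum_congr rfl fun k' _ => ?_
    rw [Matrix.sum_mulVec, dotProduct_sum]
    refine Finset.sum_congr rfl fun h _ => ?_
    rw [logits, logits, ← eta_smul_suff m f, ← dotProduct_softmaxGrad]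
    exact dotProduct_kronecker_mulVec _ _ _

lemma hessMat_isHermitian (m : Model S A M H) (lam : ℝ) (D : ℕ → Traj S A M H) (k : ℕ)
    (f : Feat S A M H) : (m.hessMat lam D k f).IsHermitian := by
  have hsymm : ∀ (u : Fin M → ℝ) (i j : Fin M), softmaxGrad m.η u i j = softmaxGrad m.η u j i :=
    fun u i j => by simpa using ((softmaxGrad_isHermitian m.η u).apply i j).symm
  ext p q
  simp only [hessMat, Matrix.conjTranspose_apply, Matrix.add_apply, Matrix.smul_apply,
    Matrix.sum_apply, Matrix.kroneckerMap_apply, Matrix.vecMulVec_apply, star_trivial]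
  congr 1
  · simp [Matrix.one_apply, eq_comm]
  · refine Finset.sum_congr rfl fun k' _ => Finset.sum_congr rfl fun h _ => ?_
    rw [hsymm]; ring

lemma hessMat_posDef (m : Model S A M H) {lam : ℝ} (hlam : 0 < lam) (D : ℕ → Traj S A M H) (k : ℕ)
    (f : Feat S A M H) : (m.hessMat lam D k f).PosDef := by
  refine Matrix.PosDef.of_dotProduct_mulVec_pos (hessMat_isHermitian m lam D k f) fun w hw => ?_
  rw [star_trivial, dotProduct_hessMat]
  refine add_pos_of_pos_of_nonneg (mul_pos hlam ?_)
    (Finset.sum_nonneg fun _ _ => Finset.sum_nonneg fun _ _ => gvar_nonneg _ _)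
  obtain ⟨p, hp⟩ := Function.ne_iff.1 hw
  exact Finset.sum_pos' (fun _ _ => sq_nonneg _) ⟨p, Finset.mem_univ _, by
    have : w p ≠ 0 := hp
    positivity⟩

/-- The first-order condition at a maximiser of the regularised log-likelihood. -/
lemma dotProduct_gVec_of_isMaxOn (m : Model S A M H) {lam : ℝ} {D : ℕ → Traj S A M H} {k : ℕ}
    {f : Feat S A M H} (hf : IsMaxOn (m.logLik lam D k) Set.univ f) (g : Feat S A M H) :
    g ⬝ᵥ m.gVec lam D k f = ∑ k' ∈ Finset.Ico 1 k, ∑ h : Fin H,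
      m.logits g (Traj.hist (D k') h) ((D k').2.2 h) := by
  have hlog : ∀ (τ : Hist S A M) (x : Fin (M + 1)),
      HasDerivAt (fun t : ℝ => Real.log (m.ctxProb (f + t • g) τ x))
        (m.logits g τ x - gmean (m.logits f τ) (m.logits g τ)) 0 := by
    intro τ x
    have h1 := hasDerivAt_gibbs (m.logits f τ) (m.logits g τ) 0 x
    have h2 := h1.log (gibbs_pos _ x).ne'
    simp only [ctxProb_eq, logits_add, logits_smul]
    refine h2.congr_deriv ?_
    rw [mul_div_cancel_left₀ _ (gibbs_pos _ x).ne', zero_smul, add_zero]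
  have hsq : HasDerivAt (fun t : ℝ => lam / 2 * ∑ p, (f + t • g) p ^ 2)
      (lam * ∑ p, g p * f p) 0 := by
    have : ∀ p, HasDerivAt (fun t : ℝ => (f + t • g) p ^ 2) (2 * (g p * f p)) 0 := fun p => by
      have h1 : HasDerivAt (fun t : ℝ => (f + t • g) p) (g p) 0 := by
        simpa using ((hasDerivAt_id (0 : ℝ)).mul_const (g p)).const_add (f p)
      refine (h1.pow 2).congr_deriv ?_
      simp; ring
    refine ((HasDerivAt.fun_sum fun p _ => this p).const_mul (lam / 2)).congr_deriv ?_
    rw [← Finset.mul_sum]; ring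
  have hd : HasDerivAt (fun t : ℝ => m.logLik lam D k (f + t • g))
      ((∑ k' ∈ Finset.Ico 1 k, ∑ h : Fin H, (m.logits g (Traj.hist (D k') h) ((D k').2.2 h) -
        gmean (m.logits f (Traj.hist (D k') h)) (m.logits g (Traj.hist (D k') h)))) -
          lam * ∑ p, g p * f p) 0 :=
    (HasDerivAt.fun_sum fun k' _ => HasDerivAt.fun_sum fun h _ => hlog _ _).sub hsq
  have hmax : IsLocalMax (fun t : ℝ => m.logLik lam D k (f + t • g)) 0 := by
    refine Filter.Eventually.of_forall fun t => ?_
    simpa using hf (Set.mem_univ (f + t • g))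
  have h0 := hmax.hasDerivAt_eq_zero hd
  rw [dotProduct_gVec]
  simp only [Finset.sum_sub_distrib] at h0
  linarith

/-- Only finitely many histories are shorter than `H` and each matrix is positive definite, so the
infimum is attained and positive and the inverse is not the junk value. Testing with the all-ones
vector, whose variance is at most its squared norm, gives `κ ≥ 1`. -/
lemma exists_kappa_inv (m : Model S A M H) (hH : 1 ≤ H) (hM : 1 ≤ M) :
    1 ≤ m.kappa ∧ ∀ τ : Hist S A M, τ.length < H → ∀ w : Fin M → ℝ,
      ∑ i, w i ^ 2 ≤ m.kappa * gvar (m.logits m.feat τ) (extZero w) := by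
  have : Nonempty (Fin M) := ⟨⟨0, hM⟩⟩
  have hfin : Finite {τ : Hist S A M // τ.length < H} :=
    (List.finite_length_lt (S × A × Fin (M + 1)) H).to_subtype
  have hne : Nonempty {τ : Hist S A M // τ.length < H} := ⟨⟨[], hH⟩⟩
  have hpos : ∀ u : Fin M → ℝ, 0 < sInf (spectrum ℝ (softmaxGrad m.η u)) := fun u => by
    have hP := softmaxGrad_posDef m.η u
    rw [hP.1.spectrum_real_eq_range_eigenvalues]
    have := (Set.finite_range hP.1.eigenvalues)
    obtain ⟨i, hi⟩ := (Set.range_nonempty hP.1.eigenvalues).csInf_mem this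
    rw [← hi]
    exact hP.eigenvalues_pos i
  set c := ⨅ τ : {τ : Hist S A M // τ.length < H},
    sInf (spectrum ℝ (softmaxGrad m.η (m.suff m.feat τ.1))) with hc
  have hκ : m.kappa = c⁻¹ := rfl
  have hcle : ∀ τ : {τ : Hist S A M // τ.length < H},
      c ≤ sInf (spectrum ℝ (softmaxGrad m.η (m.suff m.feat τ.1))) := fun τ =>
    ciInf_le (Set.finite_range _).bddBelow τ
  obtain ⟨τ₀, hτ₀⟩ := exists_eq_ciInf_of_finite (f := fun τ : {τ : Hist S A M // τ.length < H} =>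
    sInf (spectrum ℝ (softmaxGrad m.η (m.suff m.feat τ.1))))
  have hcpos : 0 < c := by rw [hc, ← hτ₀]; exact hpos _
  have hquad : ∀ τ : Hist S A M, τ.length < H → ∀ w : Fin M → ℝ,
      c * ∑ i, w i ^ 2 ≤ gvar (m.logits m.feat τ) (extZero w) := by
    intro τ hτ w
    have h1 := sInf_spectrum_mul_le (softmaxGrad_isHermitian m.η (m.suff m.feat τ)) w
    rw [dotProduct_softmaxGrad, eta_smul_suff] at h1
    exact (mul_le_mul_of_nonneg_right (hcle ⟨τ, hτ⟩)
      (Finset.sum_nonneg fun _ _ => sq_nonneg _)).trans h1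
  refine ⟨?_, fun τ hτ w => ?_⟩
  · rw [hκ]
    refine (one_le_inv₀ hcpos).2 ?_
    have h1 := (hquad [] hH (fun _ => 1)).trans (gvar_extZero_le _ _)
    simp only [one_pow, Finset.sum_const, Finset.card_univ, Fintype.card_fin, nsmul_eq_mul,
      mul_one] at h1
    have hM' : (0 : ℝ) < M := by exact_mod_cast hM
    exact (mul_le_iff_le_one_left hM').1 h1
  · rw [hκ, ← div_eq_inv_mul, le_div_iff₀ hcpos, mul_comm]
    exact hquad τ hτ w

end Model

end ModelGibbs

/-! ### Optimism and the regret decomposition -/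

section Planning

variable {S A : Type*} [Fintype S] [Fintype A] [DecidableEq S] [DecidableEq A] {M H : ℕ}

/-- Evaluate a function of the step at the length of a history. -/
def atLen (F : Fin H → ℝ) (n : ℕ) : ℝ := if h : n < H then F ⟨n, h⟩ else 0

lemma atLen_of_lt (F : Fin H → ℝ) {n : ℕ} (h : n < H) : atLen F n = F ⟨n, h⟩ := dif_pos h

lemma atLen_hist (F : Fin H → ℝ) (e : Traj S A M H) (h : Fin H) :
    atLen F (Traj.hist e h).length = F h := by
  rw [Traj.length_hist, atLen_of_lt F h.2]

lemma detPolicy_apply (p : Hist S A M → S → A) (τ : Hist S A M) (s : S) (a : A) :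
    (detPolicy p τ s).1 a = if a = p τ s then 1 else 0 := by
  simp [detPolicy, Pi.single_apply]

namespace Model

/-- The probability of one step of the model under a policy. -/
def stepProb (m : Model S A M H) (π : Policy S A M) (τ : Hist S A M) (s : S) (a : A)
    (x : Fin (M + 1)) (s' : S) : ℝ :=
  (π τ s).1 a * m.ctxProb m.feat τ x * atLen (fun h => (m.trans h s a x).1 s') τ.length

lemma ctxProb_pos (m : Model S A M H) (f : Feat S A M H) (τ : Hist S A M) (x : Fin (M + 1)) :
    0 < m.ctxProb f τ x := by
  rw [ctxProb_eq]; exact gibbs_pos _ _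

lemma sum_ctxProb (m : Model S A M H) (f : Feat S A M H) (τ : Hist S A M) :
    ∑ x, m.ctxProb f τ x = 1 := by
  rw [ctxProb_eq]; exact sum_gibbs _

lemma trajProb_eq (m : Model S A M H) (π : Policy S A M) (s₁ : S) (e : Traj S A M H) :
    m.trajProb π s₁ e = pathProb (m.stepProb π) s₁ e := by
  simp only [trajProb, pathProb, stepProb]
  congr 1
  refine Finset.prod_congr rfl fun h _ => ?_
  rw [atLen_hist]

lemma stepProb_nonneg (m : Model S A M H) (π : Policy S A M) (τ : Hist S A M) (s : S) (a : A)
    (x : Fin (M + 1)) (s' : S) : 0 ≤ m.stepProb π τ s a x s' := by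
  refine mul_nonneg (mul_nonneg ((π τ s).2.1 a) (m.ctxProb_pos _ _ _).le) ?_
  unfold atLen
  split_ifs with h
  · exact (m.trans ⟨_, h⟩ s a x).2.1 s'
  · exact le_rfl

lemma sum_stepProb_mul (m : Model S A M H) (π : Policy S A M) {τ : Hist S A M}
    (hτ : τ.length < H) (s : S) (F : A → Fin (M + 1) → S → ℝ) :
    ∑ a, ∑ x, ∑ s', m.stepProb π τ s a x s' * F a x s' =
      ∑ a, (π τ s).1 a * ∑ x, m.ctxProb m.feat τ x *
        ∑ s', (m.trans ⟨τ.length, hτ⟩ s a x).1 s' * F a x s' := by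
  simp only [stepProb, atLen_of_lt _ hτ, Finset.mul_sum, mul_assoc]

lemma sum_stepProb (m : Model S A M H) (π : Policy S A M) {τ : Hist S A M}
    (hτ : τ.length < H) (s : S) : ∑ a, ∑ x, ∑ s', m.stepProb π τ s a x s' = 1 := by
  have h := m.sum_stepProb_mul π hτ s (fun _ _ _ => 1)
  simp only [mul_one] at h
  rw [h]
  have h1 : ∀ a x, ∑ s', (m.trans ⟨τ.length, hτ⟩ s a x).1 s' = 1 := fun a x =>
    (m.trans ⟨τ.length, hτ⟩ s a x).2.2
  simp only [h1, mul_one, sum_ctxProb]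
  exact (π τ s).2.2

lemma trajProb_nonneg (m : Model S A M H) (π : Policy S A M) (s₁ : S) (e : Traj S A M H) :
    0 ≤ m.trajProb π s₁ e := by
  rw [trajProb_eq]; exact pathProb_nonneg (m.stepProb_nonneg π) _ _

lemma sum_trajProb (m : Model S A M H) (π : Policy S A M) (s₁ : S) :
    ∑ e, m.trajProb π s₁ e = 1 := by
  simp_rw [trajProb_eq]
  exact sum_pathProb (m.stepProb_nonneg π) s₁ H fun τ s h => m.sum_stepProb π h s

/-- The estimates of rewards and transitions are within their bonuses. -/
def EstimatesValid (m : Model S A M H) (D : ℕ → Traj S A M H) (R : ℕ → Fin H → ℝ) (K : ℕ) (δ : ℝ)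
    (k : ℕ) : Prop :=
  ∀ h s a x, |rewHat D R k h s a x - m.rew h s a x| ≤
      bonusRew S A M H K δ (visits D k h s a x) ∧
    H * ∑ s', |transHat D k h s a x s' - (m.trans h s a x).1 s'| ≤
      bonusTrans S A M H K δ (visits D k h s a x)

section

variable (m : Model S A M H) {D : ℕ → Traj S A M H} {R : ℕ → Fin H → ℝ} {K : ℕ} {δ : ℝ} {k : ℕ}

lemma transHat_nonneg (h : Fin H) (s : S) (a : A) (x : Fin (M + 1)) (s' : S) :
    0 ≤ transHat D k h s a x s' := by
  unfold transHat; positivity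

lemma bonusTrans_nonneg (n : ℕ) : 0 ≤ bonusTrans S A M H K δ n := by
  unfold bonusTrans; positivity

lemma bonusRew_nonneg (n : ℕ) : 0 ≤ bonusRew S A M H K δ n := by
  unfold bonusRew; positivity

/-- The reward bonus pays for the reward error alone; the transition bonus is left over to pay for
replacing the true transitions by the empirical ones. -/
lemma rew_le_rewBar (hE : m.EstimatesValid D R K δ k) (h : Fin H) (s : S) (a : A)
    (x : Fin (M + 1)) :
    m.rew h s a x + bonusTrans S A M H K δ (visits D k h s a x) ≤ rewBar D R K δ k h s a x := by
  have := (abs_le.1 (hE h s a x).1).1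
  unfold rewBar
  linarith

lemma rewBar_le (hE : m.EstimatesValid D R K δ k) (h : Fin H) (s : S) (a : A)
    (x : Fin (M + 1)) :
    rewBar D R K δ k h s a x ≤ m.rew h s a x + 2 * bonusRew S A M H K δ (visits D k h s a x) +
      bonusTrans S A M H K δ (visits D k h s a x) := by
  have := (abs_le.1 (hE h s a x).1).2
  unfold rewBar
  linarith

lemma abs_sum_transHat_sub_le (hE : m.EstimatesValid D R K δ k) (h : Fin H) (s : S) (a : A)
    (x : Fin (M + 1)) {v : S → ℝ} (hv : ∀ s', |v s'| ≤ H) :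
    |∑ s', transHat D k h s a x s' * v s' - ∑ s', (m.trans h s a x).1 s' * v s'| ≤
      bonusTrans S A M H K δ (visits D k h s a x) := by
  refine le_trans ?_ (hE h s a x).2
  rw [← Finset.sum_sub_distrib, Finset.mul_sum]
  refine (Finset.abs_sum_le_sum_abs _ _).trans (Finset.sum_le_sum fun s' _ => ?_)
  rw [← sub_mul, abs_mul, mul_comm]
  exact mul_le_mul_of_nonneg_right (hv s') (abs_nonneg _)

lemma optimisticV_of_lt (f : Feat S A M H) {τ : Hist S A M} (hτ : τ.length < H) (s : S) :
    m.optimisticV D R K δ k f τ s = min (H : ℝ) (⨆ a : A, m.optimisticQ D R K δ k f τ hτ s a) := by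
  rw [optimisticV, dif_pos hτ]
  rfl

lemma optimisticV_of_not_lt (f : Feat S A M H) {τ : Hist S A M} (hτ : ¬ τ.length < H) (s : S) :
    m.optimisticV D R K δ k f τ s = 0 := by
  rw [optimisticV, dif_neg hτ]

lemma optimisticV_le (f : Feat S A M H) (τ : Hist S A M) (s : S) :
    m.optimisticV D R K δ k f τ s ≤ H := by
  by_cases hτ : τ.length < H
  · rw [optimisticV_of_lt m f hτ]; exact min_le_left _ _
  · rw [optimisticV_of_not_lt m f hτ]; positivity

lemma optimisticV_nonneg (hE : m.EstimatesValid D R K δ k) (f : Feat S A M H) (n : ℕ) :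
    ∀ (τ : Hist S A M), H ≤ τ.length + n → ∀ s, 0 ≤ m.optimisticV D R K δ k f τ s := by
  induction n with
  | zero => intro τ hτ s; rw [optimisticV_of_not_lt m f (by omega)]
  | succ n ih =>
    intro τ hn s
    by_cases hτ : τ.length < H
    · rw [optimisticV_of_lt m f hτ]
      refine le_min (by positivity) (Real.iSup_nonneg fun a => ?_)
      refine Finset.sum_nonneg fun x _ => mul_nonneg (m.ctxProb_pos _ _ _).le (add_nonneg ?_ ?_)
      · exact (add_nonneg (m.rew_mem _ _ _ _).1 (bonusTrans_nonneg _)).trans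
          (m.rew_le_rewBar hE _ _ _ _)
      · exact Finset.sum_nonneg fun s' _ => mul_nonneg (transHat_nonneg _ _ _ _ _)
          (ih _ (by simp; omega) _)
    · rw [optimisticV_of_not_lt m f hτ]

lemma optimisticV_nonneg' (hE : m.EstimatesValid D R K δ k) (f : Feat S A M H) (τ : Hist S A M)
    (s : S) : 0 ≤ m.optimisticV D R K δ k f τ s :=
  m.optimisticV_nonneg hE f H τ (by omega) s


/-- Under the true features, the planner is optimistic. -/
lemma value_le_optimisticV (hE : m.EstimatesValid D R K δ k) (π : Policy S A M) (s₁ : S) :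
    m.value π s₁ ≤ m.optimisticV D R K δ k m.feat [] s₁ := by
  -- The planner truncates at `H` at every step. Taking the minimum with the number of remaining
  -- steps keeps the backed-up value below `H`, so the truncation is never active when `V` is
  -- propagated.
  set V : Hist S A M → S → ℝ := fun τ s =>
    min (m.optimisticV D R K δ k m.feat τ s) ((H : ℝ) - τ.length) with hV
  have key := sum_pathProb_add_le (m.stepProb_nonneg π)
    (fun τ s a x => atLen (fun h => m.rew h s a x) τ.length) V s₁ H
    (fun τ s h => m.sum_stepProb π h s) (by
      intro τ s hτ
      rw [m.sum_stepProb_mul π hτ]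
      have hlen : (τ.length : ℝ) + 1 ≤ H := by exact_mod_cast hτ
      have hV0 : ∀ a x s', 0 ≤ V (τ ++ [(s, a, x)]) s' := fun a x s' =>
        le_min (m.optimisticV_nonneg' hE _ _ _) (by simp; linarith)
      have hV1 : ∀ a x s', V (τ ++ [(s, a, x)]) s' ≤ (H : ℝ) - τ.length - 1 := fun a x s' =>
        (min_le_right _ _).trans (le_of_eq (by simp; ring))
      have hP1 : ∀ a x, ∑ s', (m.trans ⟨τ.length, hτ⟩ s a x).1 s' = 1 := fun a x =>
        (m.trans ⟨τ.length, hτ⟩ s a x).2.2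
      have hP0 : ∀ a x s', 0 ≤ (m.trans ⟨τ.length, hτ⟩ s a x).1 s' := fun a x s' =>
        (m.trans ⟨τ.length, hτ⟩ s a x).2.1 s'
      simp only [atLen_of_lt _ hτ, mul_add, Finset.sum_add_distrib, ← Finset.sum_mul, hP1, one_mul]
      simp only [← mul_add, ← Finset.sum_add_distrib]
      have hbd : ∀ a, ∑ x, m.ctxProb m.feat τ x * (m.rew ⟨τ.length, hτ⟩ s a x +
          ∑ s', (m.trans ⟨τ.length, hτ⟩ s a x).1 s' * V (τ ++ [(s, a, x)]) s') ≤ V τ s := by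
        intro a
        have h1 : ∑ x, m.ctxProb m.feat τ x * (m.rew ⟨τ.length, hτ⟩ s a x +
            ∑ s', (m.trans ⟨τ.length, hτ⟩ s a x).1 s' * V (τ ++ [(s, a, x)]) s') ≤
            (H : ℝ) - τ.length := by
          calc _ ≤ ∑ x, m.ctxProb m.feat τ x * (1 + ∑ s', (m.trans ⟨τ.length, hτ⟩ s a x).1 s' *
                ((H : ℝ) - τ.length - 1)) := by
                refine Finset.sum_le_sum fun x _ => mul_le_mul_of_nonneg_left ?_
                  (m.ctxProb_pos _ _ _).le
                exact add_le_add (m.rew_mem _ _ _ _).2 (Finset.sum_le_sum fun s' _ =>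
                  mul_le_mul_of_nonneg_left (hV1 _ _ _) (hP0 _ _ _))
            _ = _ := by
                simp only [← Finset.sum_mul, hP1, one_mul, sum_ctxProb]
                ring
        refine le_min ?_ h1
        rw [optimisticV_of_lt m _ hτ]
        refine le_min (h1.trans (by linarith [(Nat.cast_nonneg τ.length : (0:ℝ) ≤ _)])) ?_
        refine le_trans ?_ (le_ciSup (Set.finite_range _).bddAbove a)
        refine Finset.sum_le_sum fun x _ => mul_le_mul_of_nonneg_left ?_ (m.ctxProb_pos _ _ _).le
        have h2 := m.rew_le_rewBar hE ⟨τ.length, hτ⟩ s a x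
        have h3 := (abs_le.1 (m.abs_sum_transHat_sub_le hE ⟨τ.length, hτ⟩ s a x
          (v := fun s' => V (τ ++ [(s, a, x)]) s') (fun s' => by
            rw [abs_of_nonneg (hV0 _ _ _)]
            exact (hV1 _ _ _).trans (by linarith [(Nat.cast_nonneg τ.length : (0:ℝ) ≤ _)])))).1
        have h4 : ∑ s', transHat D k ⟨τ.length, hτ⟩ s a x s' * V (τ ++ [(s, a, x)]) s' ≤
            ∑ s', transHat D k ⟨τ.length, hτ⟩ s a x s' *
              m.optimisticV D R K δ k m.feat (τ ++ [(s, a, x)]) s' :=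
          Finset.sum_le_sum fun s' _ => mul_le_mul_of_nonneg_left (min_le_left _ _)
            (transHat_nonneg _ _ _ _ _)
        linarith
      calc _ ≤ ∑ a, (π τ s).1 a * V τ s :=
            Finset.sum_le_sum fun a _ => mul_le_mul_of_nonneg_left (hbd a) ((π τ s).2.1 a)
        _ = V τ s := by
            rw [← Finset.sum_mul]
            have : ∑ a, (π τ s).1 a = 1 := (π τ s).2.2
            rw [this, one_mul])
  refine le_trans (le_of_eq ?_) (key.trans (min_le_left _ _))
  simp only [value, trajProb_eq, atLen_hist]
  refine Finset.sum_congr rfl fun e _ => ?_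
  congr 1
  simp only [hV, Traj.length_steps, sub_self]
  rw [optimisticV_of_not_lt m _ (by simp [Traj.length_steps])]
  simp

/-- The optimal value is at most the planner's value under the true features. -/
lemma optValue_le_optimisticV (hE : m.EstimatesValid D R K δ k) (s₁ : S) :
    m.optValue s₁ ≤ m.optimisticV D R K δ k m.feat [] s₁ := by
  classical
  have : Nonempty (Policy S A M) := ⟨detPolicy fun _ _ => m.start.2.1⟩
  exact ciSup_le fun π => m.value_le_optimisticV hE π s₁

/-- The one-step error of the planner's model. -/
def stepErr (D : ℕ → Traj S A M H) (K : ℕ) (δ : ℝ) (k : ℕ) (f : Feat S A M H) (τ : Hist S A M)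
    (h : Fin H) (s : S) (a : A) (x : Fin (M + 1)) : ℝ :=
  8 * H * (∑ y, |m.ctxProb f τ y - m.ctxProb m.feat τ y|) +
    2 * bonusRew S A M H K δ (visits D k h s a x) +
    2 * bonusTrans S A M H K δ (visits D k h s a x)

/-- The total error along an episode. -/
def trajErr (D : ℕ → Traj S A M H) (K : ℕ) (δ : ℝ) (k : ℕ) (f : Feat S A M H)
    (e : Traj S A M H) : ℝ :=
  ∑ h : Fin H, m.stepErr D K δ k f (Traj.hist e h) h (e.1 h.castSucc) (e.2.1 h) (e.2.2 h)

/-- A greedy policy loses at most the expected model error. -/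
lemma optimisticV_le_value_add (hE : m.EstimatesValid D R K δ k) (f : Feat S A M H)
    {p : Hist S A M → S → A} (hp : ∀ (τ : Hist S A M) (hτ : τ.length < H) (s : S) (a : A),
      m.optimisticQ D R K δ k f τ hτ s a ≤ m.optimisticQ D R K δ k f τ hτ s (p τ s)) (s₁ : S) :
    m.optimisticV D R K δ k f [] s₁ ≤ m.value (detPolicy p) s₁ +
      ∑ e, m.trajProb (detPolicy p) s₁ e * m.trajErr D K δ k f e := by
  have hAne : Nonempty A := ⟨m.start.2.1⟩
  have key := le_sum_pathProb_add (m.stepProb_nonneg (detPolicy p))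
    (fun τ s a x => atLen (fun h => m.rew h s a x + m.stepErr D K δ k f τ h s a x) τ.length)
    (m.optimisticV D R K δ k f) s₁ H
    (fun τ s h => m.sum_stepProb _ h s) (by
      intro τ s hτ
      rw [m.sum_stepProb_mul _ hτ]
      simp only [detPolicy_apply, ite_mul, one_mul, zero_mul, Finset.sum_ite_eq', Finset.mem_univ,
        if_true]
      set a := p τ s with ha
      set h : Fin H := ⟨τ.length, hτ⟩ with hh
      have hP1 : ∀ x, ∑ s', (m.trans h s a x).1 s' = 1 := fun x => (m.trans h s a x).2.2
      have hP0 : ∀ x s', 0 ≤ (m.trans h s a x).1 s' := fun x s' => (m.trans h s a x).2.1 s'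
      simp only [atLen_of_lt _ hτ]
      have hV0 : ∀ x s', |m.optimisticV D R K δ k f (τ ++ [(s, a, x)]) s'| ≤ H := fun x s' => by
        rw [abs_of_nonneg (m.optimisticV_nonneg' hE _ _ _)]
        exact m.optimisticV_le _ _ _
      have hle : m.optimisticV D R K δ k f τ s ≤ m.optimisticQ D R K δ k f τ hτ s a := by
        rw [optimisticV_of_lt m _ hτ]
        exact (min_le_right _ _).trans (ciSup_le fun a' => hp τ hτ s a')
      refine hle.trans ?_
      unfold optimisticQ
      set Y : Fin (M + 1) → ℝ := fun x => rewBar D R K δ k h s a x + ∑ s', transHat D k h s a x s' *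
        m.optimisticV D R K δ k f (τ ++ [(s, a, x)]) s' with hY
      have hH1 : (1 : ℝ) ≤ H := by
        have : 1 ≤ H := by omega
        exact_mod_cast this
      have hY0 : ∀ x, 0 ≤ Y x := fun x => add_nonneg
        ((add_nonneg (m.rew_mem _ _ _ _).1 (bonusTrans_nonneg _)).trans
          (m.rew_le_rewBar hE _ _ _ _))
        (Finset.sum_nonneg fun s' _ => mul_nonneg (transHat_nonneg _ _ _ _ _)
          (m.optimisticV_nonneg' hE _ _ _))
      have hY1 : ∀ x, Y x ≤ m.rew h s a x + (∑ s', (m.trans h s a x).1 s' *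
          m.optimisticV D R K δ k f (τ ++ [(s, a, x)]) s') +
          (2 * bonusRew S A M H K δ (visits D k h s a x) +
            2 * bonusTrans S A M H K δ (visits D k h s a x)) := fun x => by
        have h1 := m.rewBar_le hE h s a x
        have h2 := (abs_le.1 (m.abs_sum_transHat_sub_le hE h s a x (hV0 x))).2
        simp only [hY]
        linarith
      -- Reward 1, continuation `H`, bonus caps `2 · 1` and `2 · 2H`: the total `5H + 3` is at most
      -- `8H`. This is the weight of the context error in `stepErr`.
      have hY2 : ∀ x, Y x ≤ 8 * H := fun x => by
        have h1 := hY1 x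
        have h2 : ∑ s', (m.trans h s a x).1 s' *
            m.optimisticV D R K δ k f (τ ++ [(s, a, x)]) s' ≤ H := by
          calc _ ≤ ∑ s', (m.trans h s a x).1 s' * (H : ℝ) :=
                Finset.sum_le_sum fun s' _ => mul_le_mul_of_nonneg_left
                  (m.optimisticV_le _ _ _) (hP0 x s')
            _ = H := by rw [← Finset.sum_mul, hP1, one_mul]
        have h3 : bonusRew S A M H K δ (visits D k h s a x) ≤ 1 := min_le_right _ _
        have h4 : bonusTrans S A M H K δ (visits D k h s a x) ≤ 2 * H := min_le_right _ _
        have h5 := (m.rew_mem h s a x).2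
        linarith
      -- Change the context law first, at the price of the ℓ¹ distance times `8H`, and the rewards
      -- and transitions afterwards under the true law. Thus the model errors are averaged under the
      -- law that generates the episode.
      calc ∑ x, m.ctxProb f τ x * Y x
          ≤ ∑ x, (m.ctxProb m.feat τ x * Y x +
              |m.ctxProb f τ x - m.ctxProb m.feat τ x| * (8 * H)) := by
            refine Finset.sum_le_sum fun x _ => ?_
            have h1 : (m.ctxProb f τ x - m.ctxProb m.feat τ x) * Y x ≤
                |m.ctxProb f τ x - m.ctxProb m.feat τ x| * (8 * H) :=
              (mul_le_mul_of_nonneg_right (le_abs_self _) (hY0 x)).trans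
                (mul_le_mul_of_nonneg_left (hY2 x) (abs_nonneg _))
            linarith
        _ ≤ ∑ x, (m.ctxProb m.feat τ x * (m.rew h s a x + (∑ s', (m.trans h s a x).1 s' *
              m.optimisticV D R K δ k f (τ ++ [(s, a, x)]) s') +
              (2 * bonusRew S A M H K δ (visits D k h s a x) +
                2 * bonusTrans S A M H K δ (visits D k h s a x))) +
              |m.ctxProb f τ x - m.ctxProb m.feat τ x| * (8 * H)) := by
            refine Finset.sum_le_sum fun x _ => ?_
            have := mul_le_mul_of_nonneg_left (hY1 x) (m.ctxProb_pos m.feat τ x).le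
            linarith
        _ = _ := by
            have hs : ∀ x, ∑ s', (m.trans h s a x).1 s' * (m.rew h s a x +
                m.stepErr D K δ k f τ h s a x +
                m.optimisticV D R K δ k f (τ ++ [(s, a, x)]) s') = (m.rew h s a x +
                m.stepErr D K δ k f τ h s a x) + ∑ s', (m.trans h s a x).1 s' *
                m.optimisticV D R K δ k f (τ ++ [(s, a, x)]) s' := fun x => by
              rw [Finset.sum_congr rfl fun s' _ => mul_add _ _ _, Finset.sum_add_distrib,
                ← Finset.sum_mul, hP1, one_mul]
            simp only [← hh, hs]
            have ht : ∀ x, m.ctxProb m.feat τ x * ((m.rew h s a x +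
                m.stepErr D K δ k f τ h s a x) + ∑ s', (m.trans h s a x).1 s' *
                m.optimisticV D R K δ k f (τ ++ [(s, a, x)]) s') =
                m.ctxProb m.feat τ x * (m.rew h s a x + (∑ s', (m.trans h s a x).1 s' *
              m.optimisticV D R K δ k f (τ ++ [(s, a, x)]) s') +
              (2 * bonusRew S A M H K δ (visits D k h s a x) +
                2 * bonusTrans S A M H K δ (visits D k h s a x))) + m.ctxProb m.feat τ x *
                (8 * H * ∑ y, |m.ctxProb f τ y - m.ctxProb m.feat τ y|) := fun x => by
              simp only [stepErr]; ring
            simp_rw [ht]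
            rw [Finset.sum_add_distrib, Finset.sum_add_distrib]
            congr 1
            rw [← Finset.sum_mul, ← Finset.sum_mul, sum_ctxProb]
            ring)
  refine key.trans (le_of_eq ?_)
  simp only [value, trajProb_eq, atLen_hist, trajErr]
  rw [← Finset.sum_add_distrib]
  refine Finset.sum_congr rfl fun e _ => ?_
  rw [optimisticV_of_not_lt m _ (by simp [Traj.length_steps]), add_zero, Finset.sum_add_distrib,
    mul_add]

end

end Model

end Planning

/-! ### Positive definite quadratic forms -/

section QuadForms

variable {ι : Type*} [Fintype ι] [DecidableEq ι]

lemma dotProduct_mulVec_comm {B : Matrix ι ι ℝ} (hB : B.IsHermitian) (x y : ι → ℝ) :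
    x ⬝ᵥ B.mulVec y = y ⬝ᵥ B.mulVec x := by
  have hT : B.transpose = B := by rw [← Matrix.conjTranspose_eq_transpose_of_trivial]; exact hB
  rw [Matrix.dotProduct_mulVec, dotProduct_comm, ← Matrix.mulVec_transpose, hT]

/-- Cauchy–Schwarz between a norm and its dual, from the discriminant of the squared `B`-norm of `x
- t B⁻¹ y` as a polynomial in `t`. -/
lemma dotProduct_sq_le {B : Matrix ι ι ℝ} (hB : B.PosDef) (x y : ι → ℝ) :
    (x ⬝ᵥ y) ^ 2 ≤ (x ⬝ᵥ B.mulVec x) * (y ⬝ᵥ (B⁻¹).mulVec y) := by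
  have hdet : IsUnit B.det := hB.det_pos.ne'.isUnit
  set z := (B⁻¹).mulVec y with hz
  have hBz : B.mulVec z = y := by
    rw [hz, Matrix.mulVec_mulVec, Matrix.mul_nonsing_inv _ hdet, Matrix.one_mulVec]
  have hq : ∀ t : ℝ, 0 ≤ (y ⬝ᵥ z) * (t * t) + (-2 * (x ⬝ᵥ y)) * t + x ⬝ᵥ B.mulVec x := by
    intro t
    have h := hB.posSemidef.dotProduct_mulVec_nonneg (x - t • z)
    rw [star_trivial, Matrix.mulVec_sub, Matrix.mulVec_smul, hBz, sub_dotProduct, dotProduct_sub,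
      dotProduct_sub, smul_dotProduct, smul_dotProduct, dotProduct_smul, dotProduct_smul,
      dotProduct_mulVec_comm hB.1 z x, hBz, dotProduct_comm z y] at h
    simp only [smul_eq_mul] at h
    linarith
  have := discrim_le_zero hq
  rw [discrim] at this
  nlinarith

lemma dotProduct_le_sqrt_mul {B : Matrix ι ι ℝ} (hB : B.PosDef) (x y : ι → ℝ) {β : ℝ}
    (hy : Real.sqrt (y ⬝ᵥ (B⁻¹).mulVec y) ≤ β) :
    x ⬝ᵥ y ≤ β * Real.sqrt (x ⬝ᵥ B.mulVec x) := by
  have h0 : 0 ≤ x ⬝ᵥ B.mulVec x := by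
    simpa using hB.posSemidef.dotProduct_mulVec_nonneg x
  calc x ⬝ᵥ y ≤ Real.sqrt ((x ⬝ᵥ B.mulVec x) * (y ⬝ᵥ (B⁻¹).mulVec y)) :=
        Real.le_sqrt_of_sq_le (dotProduct_sq_le hB x y)
    _ = Real.sqrt (x ⬝ᵥ B.mulVec x) * Real.sqrt (y ⬝ᵥ (B⁻¹).mulVec y) := Real.sqrt_mul h0 _
    _ ≤ β * Real.sqrt (x ⬝ᵥ B.mulVec x) := by
        rw [mul_comm]; exact mul_le_mul_of_nonneg_right hy (Real.sqrt_nonneg _)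

/-- The dual norm is attained at `x = B⁻¹ y`, so a bound on all pairings bounds it. -/
lemma sqrt_inv_form_le {B : Matrix ι ι ℝ} (hB : B.PosDef) (y : ι → ℝ) {β : ℝ}
    (h : ∀ x, x ⬝ᵥ y ≤ β * Real.sqrt (x ⬝ᵥ B.mulVec x)) (hβ : 0 ≤ β) :
    Real.sqrt (y ⬝ᵥ (B⁻¹).mulVec y) ≤ β := by
  have hdet : IsUnit B.det := hB.det_pos.ne'.isUnit
  have h1 := h ((B⁻¹).mulVec y)
  rw [Matrix.mulVec_mulVec, Matrix.mul_nonsing_inv _ hdet, Matrix.one_mulVec,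
    dotProduct_comm _ y] at h1
  set q := y ⬝ᵥ (B⁻¹).mulVec y
  rcases le_or_gt q 0 with hq | hq
  · rw [Real.sqrt_eq_zero_of_nonpos hq]; exact hβ
  · have h2 : Real.sqrt q * Real.sqrt q ≤ β * Real.sqrt q := by
      rw [Real.mul_self_sqrt hq.le]; exact h1
    exact le_of_mul_le_mul_right h2 (Real.sqrt_pos.2 hq)

/-- The arithmetic–geometric mean inequality for the eigenvalues, in the form `log t ≤ t - 1` at `t`
an eigenvalue divided by `a`. -/
lemma log_det_le [Nonempty ι] {B : Matrix ι ι ℝ} (hB : B.PosDef) {a : ℝ} (ha : 0 < a)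
    (htr : B.trace ≤ Fintype.card ι * a) :
    Real.log B.det ≤ Fintype.card ι * Real.log a := by
  have h1 : B.det = ∏ i, hB.1.eigenvalues i := by
    simpa using hB.1.det_eq_prod_eigenvalues
  have h2 : B.trace = ∑ i, hB.1.eigenvalues i := by
    simpa using hB.1.trace_eq_sum_eigenvalues
  have hpos := fun i => hB.eigenvalues_pos i
  rw [h1, Real.log_prod fun i _ => (hpos i).ne']
  have h3 : ∀ i, Real.log (hB.1.eigenvalues i) ≤ hB.1.eigenvalues i / a - 1 + Real.log a := by
    intro i
    have := Real.log_le_sub_one_of_pos (div_pos (hpos i) ha)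
    rw [Real.log_div (hpos i).ne' ha.ne'] at this
    linarith
  calc ∑ i, Real.log (hB.1.eigenvalues i)
      ≤ ∑ i, (hB.1.eigenvalues i / a - 1 + Real.log a) := Finset.sum_le_sum fun i _ => h3 i
    _ = B.trace / a - Fintype.card ι + Fintype.card ι * Real.log a := by
        rw [Finset.sum_add_distrib, Finset.sum_sub_distrib, ← Finset.sum_div, ← h2]
        simp
    _ ≤ _ := by
        have : B.trace / a ≤ Fintype.card ι := by rw [div_le_iff₀ ha]; exact htr
        linarith

open MeasureTheory

lemma exists_transpose_mul_self {B : Matrix ι ι ℝ} (hB : B.PosSemidef) :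
    ∃ C : Matrix ι ι ℝ, B = C.transpose * C := by
  open scoped MatrixOrder in
  obtain ⟨C, hC⟩ := CStarAlgebra.nonneg_iff_eq_star_mul_self.mp hB.nonneg
  exact ⟨C, by rw [hC]; rfl⟩

/-- The volume of an ellipsoid. -/
lemma volume_real_ellipsoid {B : Matrix ι ι ℝ} (hB : B.PosDef) {q : ℝ} (hq : 0 < q) :
    volume.real {y : ι → ℝ | y ⬝ᵥ B.mulVec y ≤ q ^ 2} =
      q ^ Fintype.card ι / Real.sqrt B.det * volume.real {y : ι → ℝ | y ⬝ᵥ y ≤ 1} := by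
  obtain ⟨C, rfl⟩ := exists_transpose_mul_self hB.posSemidef
  have hdet : (C.transpose * C).det = C.det ^ 2 := by
    rw [Matrix.det_mul, Matrix.det_transpose, sq]
  have hC0 : C.det ≠ 0 := fun h => by
    have := hB.det_pos
    rw [hdet, h] at this
    norm_num at this
  have hpre : {y : ι → ℝ | y ⬝ᵥ (C.transpose * C).mulVec y ≤ q ^ 2} =
      Matrix.toLin' (q⁻¹ • C) ⁻¹' {y : ι → ℝ | y ⬝ᵥ y ≤ 1} := by
    ext y
    simp only [Set.mem_ofPred_eq, Set.mem_preimage, Matrix.toLin'_apply, Matrix.smul_mulVec,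
      smul_dotProduct, dotProduct_smul, smul_eq_mul]
    have : y ⬝ᵥ (C.transpose * C).mulVec y = C.mulVec y ⬝ᵥ C.mulVec y := by
      rw [← Matrix.mulVec_mulVec, Matrix.dotProduct_mulVec, Matrix.vecMul_transpose]
    rw [this, ← mul_assoc, ← mul_inv, ← sq, ← div_eq_inv_mul, div_le_one (by positivity)]
  have hdet2 : LinearMap.det (Matrix.toLin' (q⁻¹ • C)) ≠ 0 := by
    rw [LinearMap.det_toLin', Matrix.det_smul]
    exact mul_ne_zero (pow_ne_zero _ (inv_ne_zero hq.ne')) hC0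
  rw [hpre, Measure.real, Measure.addHaar_preimage_linearMap _ hdet2, ENNReal.toReal_mul,
    ENNReal.toReal_ofReal (abs_nonneg _), LinearMap.det_toLin', Matrix.det_smul, hdet,
    Real.sqrt_sq_eq_abs, mul_inv, ← inv_pow, inv_inv, abs_mul, abs_inv,
    abs_of_pos (pow_pos hq _), div_eq_mul_inv]
  rfl

lemma isCompact_dotProduct_self_le (r : ℝ) : IsCompact {y : ι → ℝ | y ⬝ᵥ y ≤ r} := by
  refine Metric.isCompact_of_isClosed_isBounded ?_ ?_
  · exact isClosed_le (by unfold dotProduct; fun_prop) continuous_const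
  · refine (Metric.isBounded_closedBall (x := (0 : ι → ℝ)) (r := Real.sqrt r)).subset fun y hy => ?_
    rw [mem_closedBall_zero_iff, pi_norm_le_iff_of_nonneg (Real.sqrt_nonneg _)]
    intro i
    rw [Real.norm_eq_abs]
    refine Real.abs_le_sqrt (le_trans ?_ hy)
    rw [sq]
    exact Finset.single_le_sum (f := fun i => y i * y i) (fun i _ => mul_self_nonneg _)
      (Finset.mem_univ i)

lemma volume_real_ball_pos : 0 < volume.real {y : ι → ℝ | y ⬝ᵥ y ≤ 1} := by
  refine ENNReal.toReal_pos ?_ (isCompact_dotProduct_self_le 1).measure_lt_top.ne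
  have hopen : IsOpen {y : ι → ℝ | y ⬝ᵥ y < 1} :=
    isOpen_lt (by unfold dotProduct; fun_prop) continuous_const
  have := hopen.measure_pos volume ⟨0, by simp⟩
  exact (this.trans_le (measure_mono fun y (hy : y ⬝ᵥ y < 1) => hy.le)).ne'

lemma volume_real_ball {r : ℝ} (hr : 0 < r) :
    volume.real {y : ι → ℝ | y ⬝ᵥ y ≤ r ^ 2} =
      r ^ Fintype.card ι * volume.real {y : ι → ℝ | y ⬝ᵥ y ≤ 1} := by
  have := volume_real_ellipsoid (B := (1 : Matrix ι ι ℝ)) Matrix.PosDef.one hr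
  simpa using this

/-- The method of mixtures, with a uniform mixture over a ball: the mixture of the exponentials
`exp (⟨ξ, s⟩ - (3/4) Q₀(ξ))` controls `s` in the dual norm of `Q₀ + l`. -/
lemma dotProduct_le_of_mixture [Nonempty ι] {B₀ : Matrix ι ι ℝ} (hB₀ : B₀.PosSemidef) {l r : ℝ}
    (hl : 0 < l) (hr : 0 < r) (s : ι → ℝ) {W : ℝ} (hW : 0 < W)
    (hint : ∫ ξ in {y : ι → ℝ | y ⬝ᵥ y ≤ r ^ 2},
      Real.exp (ξ ⬝ᵥ s - 3 / 4 * (ξ ⬝ᵥ B₀.mulVec ξ)) ≤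
        W * volume.real {y : ι → ℝ | y ⬝ᵥ y ≤ r ^ 2}) (x : ι → ℝ) :
    x ⬝ᵥ s ≤ (5 / 8 * (Real.sqrt l * r) + 4 / (3 * (Real.sqrt l * r)) * (Real.log W +
      Fintype.card ι * Real.log 4 +
        1 / 2 * (Real.log (l • (1 : Matrix ι ι ℝ) + B₀).det - Fintype.card ι * Real.log l))) *
      Real.sqrt (x ⬝ᵥ (l • (1 : Matrix ι ι ℝ) + B₀).mulVec x) := by
  set B := l • (1 : Matrix ι ι ℝ) + B₀ with hBdef
  have hB : B.PosDef := (Matrix.PosDef.one.smul hl).add_posSemidef hB₀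
  have hQ : ∀ y, y ⬝ᵥ B.mulVec y = l * (y ⬝ᵥ y) + y ⬝ᵥ B₀.mulVec y := fun y => by
    rw [hBdef, Matrix.add_mulVec, dotProduct_add, Matrix.smul_mulVec, Matrix.one_mulVec,
      dotProduct_smul, smul_eq_mul]
  have hQ0 : ∀ y, 0 ≤ y ⬝ᵥ B₀.mulVec y := fun y => by
    simpa using hB₀.dotProduct_mulVec_nonneg y
  have hdd : ∀ y : ι → ℝ, 0 ≤ y ⬝ᵥ y := fun y =>
    Finset.sum_nonneg fun i _ => mul_self_nonneg _
  rcases eq_or_ne x 0 with rfl | hx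
  · simp
  set N := Real.sqrt (x ⬝ᵥ B.mulVec x) with hN
  have hxpos : 0 < x ⬝ᵥ B.mulVec x := by simpa using hB.dotProduct_mulVec_pos hx
  have hNpos : 0 < N := Real.sqrt_pos.2 hxpos
  have hNsq : N ^ 2 = x ⬝ᵥ B.mulVec x := Real.sq_sqrt hxpos.le
  set q := Real.sqrt l * r with hq
  have hqpos : 0 < q := mul_pos (Real.sqrt_pos.2 hl) hr
  have hqsq : q ^ 2 = l * r ^ 2 := by rw [hq, mul_pow, Real.sq_sqrt hl.le]
  -- The mixture is localised in an ellipsoid of `B`-radius `q / 4` around a multiple of `x` of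
  -- `B`-norm `3q / 4`, so the radii add up to `q = √l r`.
  set ξ₀ : ι → ℝ := (3 / 4 * q / N) • x with hξ₀
  have hQξ : ξ₀ ⬝ᵥ B.mulVec ξ₀ = 9 / 16 * q ^ 2 := by
    rw [hξ₀, Matrix.mulVec_smul, smul_dotProduct, dotProduct_smul, ← hNsq]
    simp only [smul_eq_mul]
    field_simp
    norm_num
  set Ball : Set (ι → ℝ) := {y : ι → ℝ | y ⬝ᵥ y ≤ r ^ 2} with hBall
  set E : Set (ι → ℝ) := {y : ι → ℝ | y ⬝ᵥ B.mulVec y ≤ (q / 4) ^ 2} with hE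
  have hcB : Continuous fun y : ι → ℝ => y ⬝ᵥ B.mulVec y := by
    unfold dotProduct Matrix.mulVec dotProduct; fun_prop
  have hEm : MeasurableSet E := (isClosed_le hcB continuous_const).measurableSet
  have hBm : MeasurableSet Ball := (isCompact_dotProduct_self_le _).measurableSet
  set g : (ι → ℝ) → ℝ := fun ξ => Real.exp (ξ ⬝ᵥ s - 3 / 4 * (ξ ⬝ᵥ B₀.mulVec ξ)) with hg
  have hgc : Continuous g := by
    simp only [hg]; unfold dotProduct Matrix.mulVec dotProduct; fun_prop
  have hgi : Integrable (Ball.indicator g) :=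
    (integrable_indicator_iff hBm).2 (hgc.continuousOn.integrableOn_compact
      (isCompact_dotProduct_self_le _))
  have hexp : ∀ a y : ι → ℝ, (a + y) ⬝ᵥ B.mulVec (a + y) =
      a ⬝ᵥ B.mulVec a + 2 * (a ⬝ᵥ B.mulVec y) + y ⬝ᵥ B.mulVec y := fun a y => by
    rw [Matrix.mulVec_add, add_dotProduct, dotProduct_add, dotProduct_add,
      dotProduct_mulVec_comm hB.1 y a]
    ring
  have hexp0 : ∀ a y : ι → ℝ, (a + y) ⬝ᵥ B₀.mulVec (a + y) =
      a ⬝ᵥ B₀.mulVec a + 2 * (a ⬝ᵥ B₀.mulVec y) + y ⬝ᵥ B₀.mulVec y := fun a y => by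
    rw [Matrix.mulVec_add, add_dotProduct, dotProduct_add, dotProduct_add,
      dotProduct_mulVec_comm hB₀.1 y a]
    ring
  have hCS : ∀ y, y ∈ E → (ξ₀ ⬝ᵥ B.mulVec y) ^ 2 ≤ (3 / 16 * q ^ 2) ^ 2 := by
    intro y hy
    have h := dotProduct_sq_le hB ξ₀ (B.mulVec y)
    rw [Matrix.mulVec_mulVec, Matrix.nonsing_inv_mul _ hB.det_pos.ne'.isUnit, Matrix.one_mulVec,
      dotProduct_comm _ y, hQξ] at h
    refine h.trans ?_
    have : y ⬝ᵥ B.mulVec y ≤ (q / 4) ^ 2 := hy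
    calc 9 / 16 * q ^ 2 * (y ⬝ᵥ B.mulVec y) ≤ 9 / 16 * q ^ 2 * (q / 4) ^ 2 := by gcongr
      _ = _ := by ring
  -- `9/16 + 2 · 3/16 + 1/16 = 1`, and `B` dominates `l` times the identity, so `B`-norm at most `√l
  -- r` means Euclidean norm at most `r`.
  have hmem : ∀ y, y ∈ E → ξ₀ + y ∈ Ball := by
    intro y hy
    have h1 : y ⬝ᵥ B.mulVec y ≤ (q / 4) ^ 2 := hy
    have h2 : ξ₀ ⬝ᵥ B.mulVec y ≤ 3 / 16 * q ^ 2 := abs_le_of_sq_le_sq' (hCS y hy) (by positivity) |>.2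
    have h3 : l * ((ξ₀ + y) ⬝ᵥ (ξ₀ + y)) ≤ l * r ^ 2 := by
      have := hQ (ξ₀ + y)
      rw [hexp, hQξ] at this
      rw [← hqsq]
      nlinarith [hQ0 (ξ₀ + y)]
    exact le_of_mul_le_mul_left h3 hl
  have hnegE : ∀ y, y ∈ E → -y ∈ E := fun y hy => by
    change (-y) ⬝ᵥ B.mulVec (-y) ≤ _
    rw [Matrix.mulVec_neg, neg_dotProduct_neg]
    exact hy
  set c₀ := Real.exp (ξ₀ ⬝ᵥ s - 15 / 32 * q ^ 2) with hc₀
  -- Pairing `y` with `-y` cancels the linear and cross terms, by the arithmetic–geometric mean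
  -- inequality. The remaining quadratic loss is `3/4 (9/16 + 1/16) q² = 15/32 q²`.
  have hpt : ∀ y, y ∈ E → 2 * c₀ ≤ g (ξ₀ + y) + g (ξ₀ - y) := by
    intro y hy
    have h1 : y ⬝ᵥ B.mulVec y ≤ (q / 4) ^ 2 := hy
    have h2 := hexp0 ξ₀ y
    have h3 := hexp0 ξ₀ (-y)
    rw [Matrix.mulVec_neg, neg_dotProduct_neg, dotProduct_neg] at h3
    have h4 := hQ ξ₀
    have h5 := hQ y
    have h6 := mul_nonneg hl.le (hdd ξ₀)
    have h7 := mul_nonneg hl.le (hdd y)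
    have ham : ∀ a b : ℝ, 2 * Real.exp ((a + b) / 2) ≤ Real.exp a + Real.exp b := fun a b => by
      have e1 : Real.exp a = Real.exp (a / 2) ^ 2 := by
        rw [← Real.exp_nat_mul]; congr 1; push_cast; ring
      have e2 : Real.exp b = Real.exp (b / 2) ^ 2 := by
        rw [← Real.exp_nat_mul]; congr 1; push_cast; ring
      have e3 : Real.exp ((a + b) / 2) = Real.exp (a / 2) * Real.exp (b / 2) := by
        rw [← Real.exp_add]; congr 1; ring
      rw [e1, e2, e3]
      nlinarith [sq_nonneg (Real.exp (a / 2) - Real.exp (b / 2))]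
    refine le_trans ?_ (ham _ _)
    rw [hc₀]
    refine mul_le_mul_of_nonneg_left (Real.exp_le_exp.2 ?_) (by norm_num)
    rw [sub_eq_add_neg ξ₀ y, h2, h3, add_dotProduct, add_dotProduct, neg_dotProduct]
    nlinarith
  have hI1 : ∫ y, Ball.indicator g (ξ₀ + y) = ∫ y, Ball.indicator g y :=
    integral_add_left_eq_self _ _
  have hI2 : ∫ y, Ball.indicator g (ξ₀ - y) = ∫ y, Ball.indicator g y :=
    integral_sub_left_eq_self _ volume ξ₀
  have hEfin : volume E ≠ ⊤ := by
    refine ((measure_mono (μ := volume) (t := {y : ι → ℝ | y ⬝ᵥ y ≤ (q / 4) ^ 2 / l}) ?_).trans_lt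
      (isCompact_dotProduct_self_le _).measure_lt_top).ne
    intro y hy
    have h1 : y ⬝ᵥ B.mulVec y ≤ (q / 4) ^ 2 := hy
    change y ⬝ᵥ y ≤ _
    rw [le_div_iff₀ hl]
    linarith [hQ y, hQ0 y]
  -- Integrate the symmetrised bound over `E`. Lebesgue measure is invariant under translation and
  -- reflection, so both halves are at most the full integral over the ball.
  have hmain : 2 * c₀ * volume.real E ≤ 2 * ∫ y, Ball.indicator g y := by
    have hEi : Integrable (E.indicator fun _ : ι → ℝ => 2 * c₀) :=
      (integrable_indicator_iff hEm).2 (integrableOn_const hEfin)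
    calc 2 * c₀ * volume.real E = ∫ y, E.indicator (fun _ => 2 * c₀) y := by
          rw [integral_indicator hEm, setIntegral_const, smul_eq_mul, mul_comm]
      _ ≤ ∫ y, (Ball.indicator g (ξ₀ + y) + Ball.indicator g (ξ₀ - y)) := by
          refine integral_mono hEi ((hgi.comp_add_left ξ₀).add (hgi.comp_sub_left ξ₀)) fun y => ?_
          by_cases hy : y ∈ E
          · have hm : ξ₀ - y ∈ Ball := by
              rw [sub_eq_add_neg]; exact hmem _ (hnegE y hy)
            simp only [Set.indicator_of_mem hy, Set.indicator_of_mem (hmem y hy),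
              Set.indicator_of_mem hm]
            exact hpt y hy
          · simp only [Set.indicator_of_notMem hy]
            exact add_nonneg (Set.indicator_nonneg (fun _ _ => (Real.exp_pos _).le) _)
              (Set.indicator_nonneg (fun _ _ => (Real.exp_pos _).le) _)
      _ = _ := by
          rw [integral_add (hgi.comp_add_left ξ₀) (hgi.comp_sub_left ξ₀), hI1, hI2]; ring
  rw [integral_indicator hBm] at hmain
  have hvolB := volume_real_ball (ι := ι) hr
  have hvolE := volume_real_ellipsoid hB (div_pos hqpos (by norm_num : (0:ℝ) < 4))
  rw [← hE] at hvolE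
  have hu := volume_real_ball_pos (ι := ι)
  set u := volume.real {y : ι → ℝ | y ⬝ᵥ y ≤ 1}
  set n := Fintype.card ι
  have hdetpos := hB.det_pos
  -- The volume ratio of ellipsoid and ball produces the terms `n log 4` and half the logarithm of
  -- `det B / l ^ n`.
  have hfin : c₀ * ((q / 4) ^ n / Real.sqrt B.det) ≤ W * r ^ n := by
    have h1 : c₀ * volume.real E ≤ W * volume.real Ball := by linarith
    rw [hvolE, hvolB] at h1
    refine le_of_mul_le_mul_right ?_ hu
    linarith
  have hlog := Real.log_le_log (by positivity) hfin
  rw [Real.log_mul (by positivity) (by positivity), Real.log_div (by positivity) (by positivity),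
    Real.log_mul hW.ne' (by positivity), Real.log_pow, Real.log_pow, Real.log_sqrt hdetpos.le,
    Real.log_div hqpos.ne' (by norm_num), hq, Real.log_mul (Real.sqrt_pos.2 hl).ne' hr.ne',
    Real.log_sqrt hl.le, hc₀, Real.log_exp, hξ₀, smul_dotProduct, smul_eq_mul] at hlog
  have hfinal : 3 / 4 * q / N * (x ⬝ᵥ s) ≤ 15 / 32 * q ^ 2 + (Real.log W + n * Real.log 4 +
      1 / 2 * (Real.log B.det - n * Real.log l)) := by linarith
  have h43 : x ⬝ᵥ s = (4 / (3 * q) * (3 / 4 * q / N * (x ⬝ᵥ s))) * N := by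
    field_simp
  rw [h43]
  refine mul_le_mul_of_nonneg_right ?_ hNpos.le
  calc 4 / (3 * q) * (3 / 4 * q / N * (x ⬝ᵥ s)) ≤ 4 / (3 * q) * (15 / 32 * q ^ 2 +
        (Real.log W + n * Real.log 4 + 1 / 2 * (Real.log B.det - n * Real.log l))) := by gcongr
    _ = _ := by field_simp; ring

end QuadForms

/-! ### Counting and summation lemmas -/

section Eluder

variable {I : Type*} [Fintype I] [DecidableEq I] {M : ℕ}

/-- The regularised Gram matrix of the vectors `d k`, `k ∈ T`. -/
def gram (ρ : ℝ) (d : ℕ → I → ℝ) (T : Finset ℕ) : Matrix I I ℝ :=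
  ρ • (1 : Matrix I I ℝ) + ∑ k ∈ T, Matrix.vecMulVec (d k) (d k)

lemma dotProduct_gram (ρ : ℝ) (d : ℕ → I → ℝ) (T : Finset ℕ) (x : I → ℝ) :
    x ⬝ᵥ (gram ρ d T).mulVec x = ρ * ∑ i, x i ^ 2 + ∑ k ∈ T, (x ⬝ᵥ d k) ^ 2 := by
  rw [gram, Matrix.add_mulVec, dotProduct_add, Matrix.smul_mulVec, Matrix.one_mulVec,
    dotProduct_smul, smul_eq_mul, Matrix.sum_mulVec, dotProduct_sum]
  congr 1
  · congr 1; exact Finset.sum_congr rfl fun i _ => (sq _).symm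
  · refine Finset.sum_congr rfl fun k _ => ?_
    rw [Matrix.vecMulVec_mulVec]
    simp only [dotProduct_smul, MulOpposite.smul_eq_mul_unop, MulOpposite.unop_op]
    rw [dotProduct_comm (d k) x, sq]

lemma gram_posDef {ρ : ℝ} (hρ : 0 < ρ) (d : ℕ → I → ℝ) (T : Finset ℕ) : (gram ρ d T).PosDef := by
  refine (Matrix.PosDef.one.smul hρ).add_posSemidef (Matrix.posSemidef_sum _ fun k _ => ?_)
  simpa using Matrix.posSemidef_vecMulVec_self_star (d k)

lemma det_gram_insert {ρ : ℝ} (hρ : 0 < ρ) (d : ℕ → I → ℝ) {T : Finset ℕ} {k : ℕ} (hk : k ∉ T) :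
    (gram ρ d (insert k T)).det =
      (gram ρ d T).det * (1 + d k ⬝ᵥ ((gram ρ d T)⁻¹).mulVec (d k)) := by
  have h : gram ρ d (insert k T) =
      gram ρ d T + Matrix.replicateCol Unit (d k) * Matrix.replicateRow Unit (d k) := by
    rw [gram, Finset.sum_insert hk, gram, Matrix.vecMulVec_eq Unit]
    abel
  rw [h, Matrix.det_add_replicateCol_mul_replicateRow (gram_posDef hρ d T).det_pos.ne'.isUnit,
    Matrix.det_unique (n := Unit)]
  congr 1
  rw [Matrix.add_apply, Matrix.one_apply_eq, Matrix.mul_assoc]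
  congr 1

lemma log_det_gram_le [Nonempty I] {ρ : ℝ} (hρ : 0 < ρ) {d : ℕ → I → ℝ} {T : Finset ℕ} {K : ℕ}
    (hd : ∀ k ∈ T, ∑ i, d k i ^ 2 ≤ 1) (hT : T.card ≤ K) :
    Real.log (gram ρ d T).det ≤ Fintype.card I * Real.log (ρ + K) := by
  refine log_det_le (gram_posDef hρ d T) (by positivity) ?_
  have hn : (1 : ℝ) ≤ Fintype.card I := by exact_mod_cast Fintype.card_pos
  rw [gram, Matrix.trace_add, Matrix.trace_smul, Matrix.trace_one, Matrix.trace_sum]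
  have h1 : ∑ k ∈ T, (Matrix.vecMulVec (d k) (d k)).trace ≤ K := by
    calc ∑ k ∈ T, (Matrix.vecMulVec (d k) (d k)).trace ≤ ∑ k ∈ T, (1 : ℝ) := by
          refine Finset.sum_le_sum fun k hk => le_trans (le_of_eq ?_) (hd k hk)
          rw [Matrix.trace]
          exact Finset.sum_congr rfl fun i _ => by simp [Matrix.vecMulVec_apply, sq]
      _ ≤ K := by simpa using hT
  have h2 : (0 : ℝ) ≤ K := by positivity
  rw [smul_eq_mul]
  nlinarith

/-- Vectors that are not well explained by the past, in a truncated sense, are few. -/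
lemma card_filter_lt_le [Nonempty I] {d : ℕ → I → ℝ} {Δ : ℕ → Fin M × I → ℝ} {K : ℕ}
    {B R ε : ℝ} (hR : 0 < R) (hε : 0 < ε) (hε1 : ε ≤ 1)
    (hd : ∀ k ∈ Finset.Icc 1 K, ∑ i, d k i ^ 2 ≤ 1)
    (hΔ : ∀ k ∈ Finset.Icc 1 K, ∑ p, Δ k p ^ 2 ≤ R)
    (hB : ∀ k ∈ Finset.Icc 1 K,
      ∑ k' ∈ Finset.Ico 1 k, min 1 (∑ i, blockDot (Δ k) (d k') i ^ 2) ≤ B) :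
    (((Finset.Icc 1 K).filter fun k => ε < ∑ i, blockDot (Δ k) (d k) i ^ 2).card : ℝ) ≤
      (B / ε + 1) * (3 * Fintype.card I * Real.log (1 + K * R / ε)) := by
  rcases Nat.eq_zero_or_pos K with rfl | hKpos
  · simp
  have hB0 : 0 ≤ B := le_trans (Finset.sum_nonneg fun k' _ =>
    le_min zero_le_one (Finset.sum_nonneg fun _ _ => sq_nonneg _)) (hB 1 (by simp; omega))
  -- The ridge is small enough that it contributes at most `ε` to the Gram form of any admissible
  -- difference.
  set ρ := ε / R with hρdef
  have hρ : 0 < ρ := div_pos hε hR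
  -- More buckets than the error budget can fill: if every bucket held past error `ε`, the total
  -- would exceed `B`.
  set n := ⌊B / ε⌋₊ + 1 with hn
  have hnB : B < n * ε := by
    rw [← div_lt_iff₀ hε, hn]; push_cast; exact Nat.lt_floor_add_one _
  set Bad : ℕ → Prop := fun k => ε < ∑ i, blockDot (Δ k) (d k) i ^ 2 with hBad
  -- Bad times are placed greedily into disjoint buckets, each time into one where the new vector
  -- has inverse-Gram norm squared at least 1/2, so that its determinant grows by a factor at least
  -- 3/2. If no bucket qualified, Cauchy–Schwarz would force past error at least `ε` in every
  -- bucket, contradicting the choice of `n`.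
  have key : ∀ j ≤ K, ∃ T : Fin n → Finset ℕ, (∀ b, T b ⊆ Finset.Icc 1 j) ∧
      (∀ b b', b ≠ b' → Disjoint (T b) (T b')) ∧
      (∀ k ∈ Finset.Icc 1 j, Bad k → ∃ b, k ∈ T b) ∧
      ∀ b, Fintype.card I * Real.log ρ + (T b).card * Real.log (3 / 2) ≤
        Real.log (gram ρ d (T b)).det := by
    intro j
    induction j with
    | zero =>
      intro _
      refine ⟨fun _ => ∅, by simp, by simp, by simp, fun b => ?_⟩
      simp [gram]
    | succ j ih =>
      intro hj
      obtain ⟨T, hT1, hT2, hT3, hT4⟩ := ih (by omega)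
      have hmono : Finset.Icc 1 j ⊆ Finset.Icc 1 (j + 1) :=
        Finset.Icc_subset_Icc_right j.le_succ
      by_cases hbad : Bad (j + 1)
      · have hmem : j + 1 ∈ Finset.Icc 1 K := by simp; omega
        obtain ⟨b, hb⟩ : ∃ b, 1 / 2 ≤ d (j + 1) ⬝ᵥ ((gram ρ d (T b))⁻¹).mulVec (d (j + 1)) := by
          by_contra! hcon
          have hlow : ∀ b, ε ≤ ∑ k' ∈ T b, min 1 (∑ i, blockDot (Δ (j + 1)) (d k') i ^ 2) := by
            intro b
            have h1 : ∑ i, blockDot (Δ (j + 1)) (d (j + 1)) i ^ 2 ≤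
                (ρ * ∑ p, Δ (j + 1) p ^ 2 +
                  ∑ k' ∈ T b, ∑ i, blockDot (Δ (j + 1)) (d k') i ^ 2) * (1 / 2) := by
              calc ∑ i, blockDot (Δ (j + 1)) (d (j + 1)) i ^ 2
                  ≤ ∑ i, ((fun p => Δ (j + 1) (i, p)) ⬝ᵥ
                      (gram ρ d (T b)).mulVec (fun p => Δ (j + 1) (i, p))) * (1 / 2) := by
                    refine Finset.sum_le_sum fun i _ => ?_
                    refine (dotProduct_sq_le (gram_posDef hρ d (T b)) (fun p => Δ (j + 1) (i, p))
                      (d (j + 1))).trans ?_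
                    refine mul_le_mul_of_nonneg_left (hcon b).le ?_
                    simpa using (gram_posDef hρ d (T b)).posSemidef.dotProduct_mulVec_nonneg
                      (fun p => Δ (j + 1) (i, p))
                _ = _ := by
                    rw [← Finset.sum_mul]
                    congr 1
                    simp_rw [dotProduct_gram]
                    rw [Finset.sum_add_distrib, ← Finset.mul_sum, Fintype.sum_prod_type,
                      Finset.sum_comm (t := T b)]
                    rfl
            have h2 : ρ * ∑ p, Δ (j + 1) p ^ 2 ≤ ε := by
              calc ρ * ∑ p, Δ (j + 1) p ^ 2 ≤ ρ * R := by gcongr; exact hΔ _ hmem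
                _ = ε := by rw [hρdef]; field_simp
            have h3 : ε < ∑ i, blockDot (Δ (j + 1)) (d (j + 1)) i ^ 2 := hbad
            have h4 : ε ≤ ∑ k' ∈ T b, ∑ i, blockDot (Δ (j + 1)) (d k') i ^ 2 := by linarith
            -- Truncation is harmless: a single term above 1 already contributes `1 ≥ ε` to the
            -- truncated sum.
            by_cases hall : ∀ k' ∈ T b, ∑ i, blockDot (Δ (j + 1)) (d k') i ^ 2 ≤ 1
            · refine h4.trans (le_of_eq (Finset.sum_congr rfl fun k' hk' => ?_))
              rw [min_eq_right (hall k' hk')]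
            · push Not at hall
              obtain ⟨k', hk', h5⟩ := hall
              refine hε1.trans ?_
              refine (min_eq_left h5.le).symm.le.trans ?_
              exact Finset.single_le_sum (f := fun k' =>
                min 1 (∑ i, blockDot (Δ (j + 1)) (d k') i ^ 2)) (fun k' _ =>
                le_min zero_le_one (Finset.sum_nonneg fun _ _ => sq_nonneg _)) hk'
          have hsum : n * ε ≤ B := by
            calc (n : ℝ) * ε = ∑ _b : Fin n, ε := by simp
              _ ≤ ∑ b, ∑ k' ∈ T b, min 1 (∑ i, blockDot (Δ (j + 1)) (d k') i ^ 2) :=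
                  Finset.sum_le_sum fun b _ => hlow b
              _ = ∑ k' ∈ Finset.univ.biUnion T,
                    min 1 (∑ i, blockDot (Δ (j + 1)) (d k') i ^ 2) :=
                  (Finset.sum_biUnion fun b _ b' _ hbb => hT2 b b' hbb).symm
              _ ≤ ∑ k' ∈ Finset.Ico 1 (j + 1),
                    min 1 (∑ i, blockDot (Δ (j + 1)) (d k') i ^ 2) := by
                  refine Finset.sum_le_sum_of_subset_of_nonneg ?_ fun k' _ _ =>
                    le_min zero_le_one (Finset.sum_nonneg fun _ _ => sq_nonneg _)
                  intro k' hk'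
                  obtain ⟨b, _, hb⟩ := Finset.mem_biUnion.1 hk'
                  have := Finset.mem_Icc.1 (hT1 b hb)
                  exact Finset.mem_Ico.2 ⟨this.1, by omega⟩
              _ ≤ B := hB _ hmem
          linarith
        have hnot : ∀ b, j + 1 ∉ T b := fun b hb => by
          have := Finset.mem_Icc.1 (hT1 b hb); omega
        refine ⟨Function.update T b (insert (j + 1) (T b)), fun b' => ?_, fun b₁ b₂ h12 => ?_,
          fun k hk hkb => ?_, fun b' => ?_⟩
        · rcases eq_or_ne b' b with rfl | h
          · rw [Function.update_self]
            exact Finset.insert_subset (by simp) ((hT1 _).trans hmono)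
          · rw [Function.update_of_ne h]; exact (hT1 _).trans hmono
        · rcases eq_or_ne b₁ b with rfl | h1
          · rw [Function.update_self, Function.update_of_ne h12.symm, Finset.disjoint_insert_left]
            exact ⟨hnot _, hT2 _ _ h12⟩
          · rw [Function.update_of_ne h1]
            rcases eq_or_ne b₂ b with rfl | h2
            · rw [Function.update_self, Finset.disjoint_insert_right]
              exact ⟨hnot _, hT2 _ _ h12⟩
            · rw [Function.update_of_ne h2]; exact hT2 _ _ h12
        · rcases eq_or_ne k (j + 1) with rfl | hne
          · exact ⟨b, by rw [Function.update_self]; exact Finset.mem_insert_self _ _⟩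
          · have hk' : k ∈ Finset.Icc 1 j := by
              have := Finset.mem_Icc.1 hk
              exact Finset.mem_Icc.2 ⟨this.1, by omega⟩
            obtain ⟨b', hb'⟩ := hT3 k hk' hkb
            refine ⟨b', ?_⟩
            rcases eq_or_ne b' b with rfl | h
            · rw [Function.update_self]; exact Finset.mem_insert_of_mem hb'
            · rw [Function.update_of_ne h]; exact hb'
        · rcases eq_or_ne b' b with rfl | h
          · have hdet := (gram_posDef hρ d (T b')).det_pos
            rw [Function.update_self, det_gram_insert hρ d (hnot b'),
              Real.log_mul hdet.ne' (by linarith), Finset.card_insert_of_notMem (hnot b')]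
            have := Real.log_le_log (by norm_num : (0:ℝ) < 3 / 2)
              (show (3:ℝ) / 2 ≤ 1 + d (j + 1) ⬝ᵥ ((gram ρ d (T b'))⁻¹).mulVec (d (j + 1)) by
                linarith)
            push_cast
            linarith [hT4 b']
          · rw [Function.update_of_ne h]; exact hT4 b'
      · refine ⟨T, fun b => (hT1 b).trans hmono, hT2, fun k hk hkb => ?_, hT4⟩
        rcases eq_or_ne k (j + 1) with rfl | hne
        · exact absurd hkb hbad
        · have := Finset.mem_Icc.1 hk
          exact hT3 k (Finset.mem_Icc.2 ⟨this.1, by omega⟩) hkb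
  obtain ⟨T, hT1, -, hT3, hT4⟩ := key K le_rfl
  -- Each element multiplies the determinant by at least 3/2, while the trace limits its total
  -- growth; the 3 comes from `log (3/2) ≥ 1/3`.
  have hcard : ∀ b, ((T b).card : ℝ) ≤ 3 * Fintype.card I * Real.log (1 + K * R / ε) := by
    intro b
    have h1 := log_det_gram_le hρ (fun k hk => hd k (hT1 b hk))
      (show (T b).card ≤ K by simpa using Finset.card_le_card (hT1 b))
    have h2 := (hT4 b).trans h1
    have h3 : (1 : ℝ) / 3 ≤ Real.log (3 / 2) := by
      have := Real.one_sub_inv_le_log_of_pos (by norm_num : (0:ℝ) < 3 / 2)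
      norm_num at this ⊢
      exact this
    have h4 : Real.log (1 + K * R / ε) = Real.log (ρ + K) - Real.log ρ := by
      rw [← Real.log_div (by positivity) hρ.ne']
      congr 1
      rw [hρdef]; field_simp
    rw [h4]
    have h5 : ((T b).card : ℝ) * (1 / 3) ≤ (T b).card * Real.log (3 / 2) := by gcongr
    linarith
  have hsub : (Finset.Icc 1 K).filter Bad ⊆ Finset.univ.biUnion T := by
    intro k hk
    obtain ⟨hk1, hk2⟩ := Finset.mem_filter.1 hk
    obtain ⟨b, hb⟩ := hT3 k hk1 hk2
    exact Finset.mem_biUnion.2 ⟨b, Finset.mem_univ _, hb⟩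
  have hL : 0 ≤ Real.log (1 + K * R / ε) :=
    Real.log_nonneg (by have : 0 ≤ K * R / ε := by positivity
                        linarith)
  calc (((Finset.Icc 1 K).filter Bad).card : ℝ) ≤ ((Finset.univ.biUnion T).card : ℝ) := by
        exact_mod_cast Finset.card_le_card hsub
    _ ≤ ∑ b, ((T b).card : ℝ) := by exact_mod_cast Finset.card_biUnion_le
    _ ≤ ∑ _b : Fin n, 3 * Fintype.card I * Real.log (1 + K * R / ε) :=
        Finset.sum_le_sum fun b _ => hcard b
    _ = n * (3 * Fintype.card I * Real.log (1 + K * R / ε)) := by simp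
    _ ≤ _ := by
        refine mul_le_mul_of_nonneg_right ?_ (by positivity)
        rw [hn]; push_cast
        have := Nat.floor_le (div_nonneg hB0 hε.le)
        linarith

/-- The one level with `4^{-(j+1)} < y ≤ 4^{-j}` already contributes at least `y`. -/
lemma le_sum_dyadic {y : ℝ} (hy1 : y ≤ 1) : ∀ J : ℕ, (1 / 4 : ℝ) ^ J < y →
    y ≤ ∑ j ∈ Finset.range J, if (1 / 4 : ℝ) ^ (j + 1) < y then (1 / 4 : ℝ) ^ j else 0 := by
  intro J
  induction J with
  | zero => intro h; norm_num at h; linarith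
  | succ J ih =>
    intro h
    rw [Finset.sum_range_succ, if_pos h]
    rcases lt_or_ge ((1 / 4 : ℝ) ^ J) y with h1 | h1
    · have : (0 : ℝ) ≤ (1 / 4) ^ J := by positivity
      linarith [ih h1]
    · have : (0 : ℝ) ≤ ∑ j ∈ Finset.range J,
          if (1 / 4 : ℝ) ^ (j + 1) < y then (1 / 4 : ℝ) ^ j else 0 :=
        Finset.sum_nonneg fun j _ => by split_ifs <;> positivity
      linarith

/-- Sums of truncated prediction errors. -/
lemma sum_min_sqrt_le [Nonempty I] {d : ℕ → I → ℝ} {Δ : ℕ → Fin M × I → ℝ} {K : ℕ} (hK : 1 ≤ K)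
    {B R : ℝ} (hR : 0 < R)
    (hd : ∀ k ∈ Finset.Icc 1 K, ∑ i, d k i ^ 2 ≤ 1)
    (hΔ : ∀ k ∈ Finset.Icc 1 K, ∑ p, Δ k p ^ 2 ≤ R)
    (hB : ∀ k ∈ Finset.Icc 1 K,
      ∑ k' ∈ Finset.Ico 1 k, min 1 (∑ i, blockDot (Δ k) (d k') i ^ 2) ≤ B) :
    ∑ k ∈ Finset.Icc 1 K, min 1 (Real.sqrt (∑ i, blockDot (Δ k) (d k) i ^ 2)) ≤
      1 + Real.sqrt (K * ((4 * B + 1) * (3 * Fintype.card I *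
        Real.log (1 + 4 * K ^ 3 * R)) * (1 + 2 * Real.log K))) := by
  set v : ℕ → ℝ := fun k => ∑ i, blockDot (Δ k) (d k) i ^ 2 with hv
  have hv0 : ∀ k, 0 ≤ v k := fun k => Finset.sum_nonneg fun _ _ => sq_nonneg _
  have hKr : (1 : ℝ) ≤ K := by exact_mod_cast hK
  -- Squared errors below `4^{-J}` have square root at most `1 / K`, hence contribute at most 1 over
  -- all episodes; only logarithmically many levels remain.
  set J := Nat.log 2 K + 1 with hJ
  have hJ1 : (K : ℝ) < 2 ^ J := by exact_mod_cast Nat.lt_pow_succ_log_self (by norm_num) K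
  have hJ2 : (2 : ℝ) ^ J ≤ 2 * K := by
    rw [hJ, pow_succ, mul_comm]
    have : 2 ^ Nat.log 2 K ≤ K := Nat.pow_log_le_self 2 (by omega)
    have : (2 : ℝ) ^ Nat.log 2 K ≤ K := by exact_mod_cast this
    linarith
  have h4J : (1 / 4 : ℝ) ^ J = (1 / 2 ^ J) ^ 2 := by
    rw [div_pow, one_pow, div_pow, one_pow, ← pow_mul, mul_comm J 2, pow_mul]; norm_num
  set E := 3 * Fintype.card I * Real.log (1 + 4 * K ^ 3 * R) with hE
  have hE0 : 0 ≤ E := by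
    refine mul_nonneg (by positivity) (Real.log_nonneg ?_)
    have : 0 ≤ 4 * (K : ℝ) ^ 3 * R := by positivity
    linarith
  have hB0 : 0 ≤ B := le_trans (Finset.sum_nonneg fun k' _ =>
    le_min zero_le_one (Finset.sum_nonneg fun _ _ => sq_nonneg _)) (hB 1 (by simp; omega))
  have hJlog : (J : ℝ) ≤ 1 + 2 * Real.log K := by
    have h1 : (2 : ℝ) ^ Nat.log 2 K ≤ K := by
      exact_mod_cast Nat.pow_log_le_self 2 (by omega)
    have h2 := Real.log_le_log (by positivity) h1
    rw [Real.log_pow] at h2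
    have h3 : (1 / 2 : ℝ) ≤ Real.log 2 := by linarith [Real.log_two_gt_d9]
    have h4 : (Nat.log 2 K : ℝ) * (1 / 2) ≤ Nat.log 2 K * Real.log 2 := by gcongr
    rw [hJ]; push_cast; linarith
  -- Counting at threshold `4^{-(j+1)}` gives about `4^{j+1} B` times the dimension and a logarithm,
  -- so every level has the same weighted contribution.
  have hcount : ∀ j ∈ Finset.range J, (1 / 4 : ℝ) ^ j *
      (((Finset.Icc 1 K).filter fun k => (1 / 4 : ℝ) ^ (j + 1) < v k).card : ℝ) ≤
        (4 * B + 1) * E := by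
    intro j hj
    have hjJ : j + 1 ≤ J := Finset.mem_range.1 hj
    have hε1 : (1 / 4 : ℝ) ^ (j + 1) ≤ 1 := pow_le_one₀ (by norm_num) (by norm_num)
    have hε0 : (0 : ℝ) < (1 / 4 : ℝ) ^ (j + 1) := by positivity
    have hc := card_filter_lt_le hR hε0 hε1 hd hΔ hB
    have hlogle : Real.log (1 + K * R / (1 / 4 : ℝ) ^ (j + 1)) ≤ Real.log (1 + 4 * K ^ 3 * R) := by
      refine Real.log_le_log (by positivity) ?_
      have h1 : (1 / 4 : ℝ) ^ J ≤ (1 / 4 : ℝ) ^ (j + 1) :=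
        pow_le_pow_of_le_one (by norm_num) (by norm_num) hjJ
      have h2 : 1 / (4 * (K : ℝ) ^ 2) ≤ (1 / 4 : ℝ) ^ (j + 1) := by
        refine le_trans ?_ h1
        rw [h4J, div_pow, one_pow]
        refine one_div_le_one_div_of_le (by positivity) ?_
        calc ((2 : ℝ) ^ J) ^ 2 ≤ (2 * K) ^ 2 := by gcongr
          _ = _ := by ring
      have h3 : K * R / (1 / 4 : ℝ) ^ (j + 1) ≤ K * R / (1 / (4 * (K : ℝ) ^ 2)) := by gcongr
      have h4 : K * R / (1 / (4 * (K : ℝ) ^ 2)) = 4 * K ^ 3 * R := by field_simp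
      linarith
    calc (1 / 4 : ℝ) ^ j * (((Finset.Icc 1 K).filter fun k => (1 / 4 : ℝ) ^ (j + 1) < v k).card : ℝ)
        ≤ (1 / 4 : ℝ) ^ j * ((B / (1 / 4 : ℝ) ^ (j + 1) + 1) * E) := by
          refine mul_le_mul_of_nonneg_left (hc.trans ?_) (by positivity)
          refine mul_le_mul_of_nonneg_left ?_ (by positivity)
          rw [hE]; gcongr
      _ = (4 * B + (1 / 4 : ℝ) ^ j) * E := by rw [pow_succ]; field_simp
      _ ≤ (4 * B + 1) * E := by
          have : (1 / 4 : ℝ) ^ j ≤ 1 := pow_le_one₀ (by norm_num) (by norm_num)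
          gcongr
  set w : ℕ → ℝ := fun k => if (1 / 4 : ℝ) ^ J < v k then min 1 (v k) else 0 with hw
  have hw0 : ∀ k, 0 ≤ w k := fun k => by
    simp only [hw]; split_ifs
    · exact le_min zero_le_one (hv0 k)
    · exact le_rfl
  have hwsum : ∑ k ∈ Finset.Icc 1 K, w k ≤ (4 * B + 1) * E * (1 + 2 * Real.log K) := by
    calc ∑ k ∈ Finset.Icc 1 K, w k ≤ ∑ k ∈ Finset.Icc 1 K, ∑ j ∈ Finset.range J,
          (if (1 / 4 : ℝ) ^ (j + 1) < v k then (1 / 4 : ℝ) ^ j else 0) := by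
          refine Finset.sum_le_sum fun k _ => ?_
          simp only [hw]
          split_ifs with h
          · rcases le_or_gt (v k) 1 with h1 | h1
            · rw [min_eq_right h1]; exact le_sum_dyadic h1 J h
            · rw [min_eq_left h1.le]
              have h2 : (1 / 4 : ℝ) ^ J < 1 := by
                refine pow_lt_one₀ (by norm_num) (by norm_num) (by omega)
              refine (le_sum_dyadic le_rfl J h2).trans (Finset.sum_le_sum fun j _ => ?_)
              split_ifs with h3 h4 h4
              · exact le_rfl
              · exact absurd (h3.trans h1) h4
              · positivity
              · exact le_rfl
          · exact Finset.sum_nonneg fun j _ => by split_ifs <;> positivity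
      _ = ∑ j ∈ Finset.range J, (1 / 4 : ℝ) ^ j *
          (((Finset.Icc 1 K).filter fun k => (1 / 4 : ℝ) ^ (j + 1) < v k).card : ℝ) := by
          rw [Finset.sum_comm]
          refine Finset.sum_congr rfl fun j _ => ?_
          rw [← Finset.sum_filter, Finset.sum_const, nsmul_eq_mul, mul_comm]
      _ ≤ ∑ _j ∈ Finset.range J, (4 * B + 1) * E := Finset.sum_le_sum hcount
      _ = (4 * B + 1) * E * J := by simp [mul_comm]
      _ ≤ _ := by gcongr
  have hpt : ∀ k, min 1 (Real.sqrt (v k)) ≤ Real.sqrt (w k) + 1 / K := by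
    intro k
    have hK0 : (0 : ℝ) ≤ 1 / K := by positivity
    simp only [hw]
    split_ifs with h
    · rcases le_or_gt (v k) 1 with h1 | h1
      · rw [min_eq_right h1]
        exact (min_le_right _ _).trans (by linarith)
      · rw [min_eq_left h1.le, Real.sqrt_one]
        exact (min_le_left _ _).trans (by linarith)
    · rw [Real.sqrt_zero, zero_add]
      refine (min_le_right _ _).trans ?_
      rw [not_lt, h4J] at h
      refine (Real.sqrt_le_sqrt h).trans ?_
      rw [Real.sqrt_sq (by positivity)]
      exact one_div_le_one_div_of_le (by linarith) hJ1.le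
  -- Only the squared errors were summed; Cauchy–Schwarz over the episodes produces the `√K`.
  have hcs : ∑ k ∈ Finset.Icc 1 K, Real.sqrt (w k) ≤
      Real.sqrt (K * ∑ k ∈ Finset.Icc 1 K, w k) := by
    refine Real.le_sqrt_of_sq_le ?_
    have := sq_sum_le_card_mul_sum_sq (s := Finset.Icc 1 K) (f := fun k => Real.sqrt (w k))
    simp only [Nat.card_Icc, Nat.add_sub_cancel, Real.sq_sqrt (hw0 _)] at this
    exact this
  calc ∑ k ∈ Finset.Icc 1 K, min 1 (Real.sqrt (v k))
      ≤ ∑ k ∈ Finset.Icc 1 K, (Real.sqrt (w k) + 1 / K) := Finset.sum_le_sum fun k _ => hpt k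
    _ = (∑ k ∈ Finset.Icc 1 K, Real.sqrt (w k)) + 1 := by
        rw [Finset.sum_add_distrib]
        congr 1
        simp only [Finset.sum_const, Nat.card_Icc, Nat.add_sub_cancel, nsmul_eq_mul]
        field_simp
    _ ≤ _ := by
        rw [add_comm]
        refine add_le_add_right (hcs.trans (Real.sqrt_le_sqrt ?_)) _
        gcongr

end Eluder

/-! ### Pigeonhole bounds for visit counts. -/

section Visits

variable {C : Type*} [Fintype C] [DecidableEq C]

/-- Makes the inverse square roots telescope. The denominator holds the count before the visit,
hence the constant 3: `√(n+1) ≤ 2√n` for `n ≥ 1`, while `n = 0` is checked directly. -/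
lemma three_sqrt_succ (n : ℕ) :
    3 * Real.sqrt n + 1 / Real.sqrt (max (n : ℝ) 1) ≤ 3 * Real.sqrt ((n + 1 : ℕ) : ℝ) := by
  rcases Nat.eq_zero_or_pos n with rfl | hn
  · norm_num
  · have hn1 : (1 : ℝ) ≤ n := by exact_mod_cast hn
    rw [max_eq_left hn1]
    set a := Real.sqrt n
    set b := Real.sqrt ((n + 1 : ℕ) : ℝ) with hb
    have ha2 : a ^ 2 = n := Real.sq_sqrt (by positivity)
    have hb2 : b ^ 2 = n + 1 := by rw [hb, Real.sq_sqrt (by positivity)]; push_cast; ring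
    have ha1 : 1 ≤ a := by rw [← Real.sqrt_one]; exact Real.sqrt_le_sqrt hn1
    have hb0 : 0 ≤ b := Real.sqrt_nonneg _
    have hb2a : b ≤ 2 * a := by nlinarith
    rw [← le_sub_iff_add_le', div_le_iff₀ (by linarith)]
    have hba : a ≤ b := by nlinarith
    have hprod : (b - a) * (b + a) = 1 := by nlinarith
    nlinarith

/-- The pigeonhole bound on sums of inverse square roots of visit counts. -/
lemma sum_inv_sqrt_visits_le (c : ℕ → C) (K : ℕ) :
    ∑ k ∈ Finset.Icc 1 K,
      1 / Real.sqrt (max (((Finset.Ico 1 k).filter fun k' => c k' = c k).card : ℝ) 1) ≤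
      3 * Real.sqrt (Fintype.card C * K) := by
  set N : ℕ → C → ℕ := fun k y => ((Finset.Ico 1 k).filter fun k' => c k' = y).card with hN
  have h1 : ∑ k ∈ Finset.Icc 1 K, 1 / Real.sqrt (max (N k (c k) : ℝ) 1) ≤
      ∑ y, 3 * Real.sqrt (N (K + 1) y) := by
    induction K with
    | zero => simpa using Finset.sum_nonneg fun y _ => by positivity
    | succ K ih =>
      rw [Finset.sum_Icc_succ_top (by omega)]
      have hstep : ∀ y, N (K + 1 + 1) y = N (K + 1) y + if y = c (K + 1) then 1 else 0 := by
        intro y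
        simp only [hN]
        rw [show Finset.Ico 1 (K + 1 + 1) = insert (K + 1) (Finset.Ico 1 (K + 1)) by
          ext z; simp only [Finset.mem_Ico, Finset.mem_insert]; omega, Finset.filter_insert]
        split_ifs with h2 h3 h3
        · rw [Finset.card_insert_of_notMem (by simp)]
        · exact absurd h2.symm h3
        · exact absurd h3.symm h2
        · rfl
      have h2 : ∀ y, 3 * Real.sqrt (N (K + 1) y) + (if y = c (K + 1) then
          1 / Real.sqrt (max (N (K + 1) (c (K + 1)) : ℝ) 1) else 0) ≤
          3 * Real.sqrt (N (K + 1 + 1) y) := by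
        intro y
        rw [hstep]
        split_ifs with h
        · rw [← h]; exact three_sqrt_succ _
        · simp
      have h3 := Finset.sum_le_sum fun y (_ : y ∈ Finset.univ) => h2 y
      rw [Finset.sum_add_distrib, Finset.sum_ite_eq' Finset.univ (c (K + 1)),
        if_pos (Finset.mem_univ _)] at h3
      linarith
  have h2 : ∑ y, (N (K + 1) y : ℝ) = K := by
    have := Finset.card_eq_sum_card_fiberwise (s := Finset.Ico 1 (K + 1)) (t := Finset.univ)
      (f := c) (fun _ _ => Finset.mem_coe.2 (Finset.mem_univ _))
    rw [Nat.card_Ico, Nat.add_sub_cancel] at this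
    exact_mod_cast this.symm
  have h3 : ∑ y, Real.sqrt (N (K + 1) y) ≤ Real.sqrt (Fintype.card C * K) := by
    refine Real.le_sqrt_of_sq_le ?_
    have := sq_sum_le_card_mul_sum_sq (s := Finset.univ) (f := fun y => Real.sqrt (N (K + 1) y))
    simp only [Real.sq_sqrt (Nat.cast_nonneg _), h2, Finset.card_univ] at this
    exact this
  refine h1.trans ?_
  rw [← Finset.mul_sum]
  linarith

end Visits

/-! ### Estimation error of the features -/

section Estimation

variable {S A : Type*} [Fintype S] [Fintype A] [DecidableEq S] [DecidableEq A] {M H : ℕ}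

lemma sqrt_add_le_add_sqrt' {x y : ℝ} (hx : 0 ≤ x) (hy : 0 ≤ y) :
    Real.sqrt (x + y) ≤ Real.sqrt x + Real.sqrt y := by
  refine Real.sqrt_le_iff.2 ⟨by positivity, ?_⟩
  rw [add_sq, Real.sq_sqrt hx, Real.sq_sqrt hy]
  have : 0 ≤ 2 * Real.sqrt x * Real.sqrt y := by positivity
  linarith

namespace Model

/-- The linear functional `⟨g, ∑ (onehot - z) ⊗ d⟩` given by the noise in the observed contexts. -/
def noise (m : Model S A M H) (D : ℕ → Traj S A M H) (k : ℕ) (g : Feat S A M H) : ℝ :=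
  ∑ k' ∈ Finset.Ico 1 k, ∑ h : Fin H, (m.logits g (Traj.hist (D k') h) ((D k').2.2 h) -
    gmean (m.logits m.feat (Traj.hist (D k') h)) (m.logits g (Traj.hist (D k') h)))

/-- The noise is at most `β` in the dual norm of the Hessian at the true features, with
regularisation `l`. -/
def NoiseBound (m : Model S A M H) (D : ℕ → Traj S A M H) (k : ℕ) (l β : ℝ) : Prop :=
  ∀ g, m.noise D k g ≤ β * Real.sqrt (g ⬝ᵥ (m.hessMat l D k m.feat).mulVec g)

variable (m : Model S A M H) {D : ℕ → Traj S A M H} {k : ℕ}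

lemma logits_neg (g : Feat S A M H) (τ : Hist S A M) : m.logits (-g) τ = -m.logits g τ := by
  have := m.logits_smul (-1) g τ
  simpa using this

lemma noise_neg (g : Feat S A M H) : m.noise D k (-g) = -m.noise D k g := by
  simp only [noise, logits_neg, ← Finset.sum_neg_distrib]
  refine Finset.sum_congr rfl fun k' _ => Finset.sum_congr rfl fun h _ => ?_
  simp only [gmean, Pi.neg_apply, mul_neg, Finset.sum_neg_distrib]
  ring

/-- The first-order condition replaces the score at the estimate by the observed contexts. What
remains is ridge bias minus noise, with no trace of the estimate itself. -/
lemma dotProduct_gVec_sub {lam : ℝ} {fhat : Feat S A M H}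
    (hf : IsMaxOn (m.logLik lam D k) Set.univ fhat) (g : Feat S A M H) :
    g ⬝ᵥ (m.gVec lam D k m.feat - m.gVec lam D k fhat) =
      lam * ∑ p, g p * m.feat p - m.noise D k g := by
  rw [dotProduct_sub, dotProduct_gVec_of_isMaxOn m hf, dotProduct_gVec, noise]
  simp only [Finset.sum_sub_distrib]
  ring

lemma sum_mul_le_sqrt_mul_sqrt {ι : Type*} [Fintype ι] (f g : ι → ℝ) :
    ∑ i, f i * g i ≤ Real.sqrt (∑ i, f i ^ 2) * Real.sqrt (∑ i, g i ^ 2) := by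
  exact Real.sum_mul_le_sqrt_mul_sqrt _ _ _

/-- The true features belong to the confidence set. -/
lemma feat_mem_confSet {lam L δ β : ℝ} (hlam : 0 < lam) {b fhat : Feat S A M H}
    (hL : Real.sqrt (∑ p, m.feat p ^ 2) ≤ L) (hb : ∀ p, |m.feat p| ≤ b p)
    (hf : IsMaxOn (m.logLik lam D k) Set.univ fhat) (hβ0 : 0 ≤ β)
    (hN : m.NoiseBound D k lam β) (hβ : β + Real.sqrt lam * L ≤ radius S A M H lam L δ k) :
    m.feat ∈ m.confSet b lam L δ D k fhat := by
  have hL0 : 0 ≤ L := (Real.sqrt_nonneg _).trans hL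
  refine ⟨hb, le_trans ?_ hβ⟩
  -- By duality it suffices to test an arbitrary direction; the ridge bias is handled by the part
  -- `lam ‖g‖²` of the Hessian form.
  refine sqrt_inv_form_le (hessMat_posDef m hlam D k m.feat) _ (fun g => ?_)
    (add_nonneg hβ0 (mul_nonneg (Real.sqrt_nonneg _) hL0))
  rw [dotProduct_gVec_sub m hf]
  have h1 := hN (-g)
  rw [noise_neg, Matrix.mulVec_neg, neg_dotProduct_neg] at h1
  have h2 := sum_mul_le_sqrt_mul_sqrt g m.feat
  have h3 : Real.sqrt lam * Real.sqrt (∑ p, g p ^ 2) ≤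
      Real.sqrt (g ⬝ᵥ (m.hessMat lam D k m.feat).mulVec g) := by
    rw [← Real.sqrt_mul hlam.le]
    refine Real.sqrt_le_sqrt ?_
    rw [dotProduct_hessMat]
    have : 0 ≤ ∑ k' ∈ Finset.Ico 1 k, ∑ h : Fin H,
        gvar (m.logits m.feat (Traj.hist (D k') h)) (m.logits g (Traj.hist (D k') h)) :=
      Finset.sum_nonneg fun _ _ => Finset.sum_nonneg fun _ _ => gvar_nonneg _ _
    linarith
  have h4 : lam * ∑ p, g p * m.feat p ≤
      Real.sqrt lam * L * Real.sqrt (g ⬝ᵥ (m.hessMat lam D k m.feat).mulVec g) := by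
    calc lam * ∑ p, g p * m.feat p ≤ lam * (Real.sqrt (∑ p, g p ^ 2) * L) := by
          refine mul_le_mul_of_nonneg_left (h2.trans ?_) hlam.le
          exact mul_le_mul_of_nonneg_left hL (Real.sqrt_nonneg _)
      _ = Real.sqrt lam * L * (Real.sqrt lam * Real.sqrt (∑ p, g p ^ 2)) := by
          nth_rewrite 1 [← Real.mul_self_sqrt hlam.le]; ring
      _ ≤ _ := mul_le_mul_of_nonneg_left h3 (mul_nonneg (Real.sqrt_nonneg _) hL0)
  linarith

/-- The increment of the mean of the direction `g` when the features move from the truth by `g`. -/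
def meanGap (m : Model S A M H) (g : Feat S A M H) (τ : Hist S A M) : ℝ :=
  gmean (m.logits m.feat τ + m.logits g τ) (m.logits g τ) - gmean (m.logits m.feat τ) (m.logits g τ)

lemma meanGap_nonneg (g : Feat S A M H) (τ : Hist S A M) : 0 ≤ m.meanGap g τ :=
  gmean_sub_nonneg _ _

lemma exp_one_le_three : Real.exp 1 ≤ 3 := Real.exp_one_lt_d9.le.trans (by norm_num)

/-- Self-concordance at the true end of the segment. The range of the increment involves only two
coordinates, hence `√2` times its norm. -/
lemma gvar_feat_le (g : Feat S A M H) (τ : Hist S A M) :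
    gvar (m.logits m.feat τ) (m.logits g τ) ≤
      3 * (1 + Real.sqrt (2 * ∑ i, blockDot g (m.visit τ) i ^ 2)) * m.meanGap g τ := by
  have h0 := m.meanGap_nonneg g τ
  have h1 := gvar_le_of_range (m.logits m.feat τ) (m.logits g τ) (Real.sqrt_nonneg _)
    fun x y => extZero_sub_le (blockDot g (m.visit τ)) x y
  refine h1.trans (mul_le_mul_of_nonneg_right ?_ h0)
  gcongr
  exact exp_one_le_three

/-- The self-concordance factor grows only like the square root of the squared error `v`. For `v ≤
1` it is a constant; for `v > 1` it is at most a multiple of `v`, which cancels and leaves a lower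
bound of constant order for `κ` times the gap. Hence the truncation at 1. -/
lemma min_one_le_kappa_mul {κ : ℝ} (hκ0 : 0 ≤ κ) (g : Feat S A M H) (τ : Hist S A M)
    (hκ : ∑ i, blockDot g (m.visit τ) i ^ 2 ≤
      κ * gvar (m.logits m.feat τ) (extZero (blockDot g (m.visit τ)))) :
    min 1 (∑ i, blockDot g (m.visit τ) i ^ 2) ≤ 8 * κ * m.meanGap g τ := by
  set v := ∑ i, blockDot g (m.visit τ) i ^ 2 with hv
  have hv0 : 0 ≤ v := Finset.sum_nonneg fun _ _ => sq_nonneg _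
  have h0 := m.meanGap_nonneg g τ
  have h1 : v ≤ κ * (3 * (1 + Real.sqrt (2 * v)) * m.meanGap g τ) :=
    hκ.trans (mul_le_mul_of_nonneg_left (m.gvar_feat_le g τ) hκ0)
  have hκm : 0 ≤ κ * m.meanGap g τ := mul_nonneg hκ0 h0
  rcases le_or_gt v 1 with h | h
  · have h2 : Real.sqrt (2 * v) ≤ 3 / 2 := Real.sqrt_le_iff.2 ⟨by norm_num, by linarith⟩
    refine (min_le_right _ _).trans ?_
    nlinarith
  · have h2 : Real.sqrt (2 * v) ≤ 3 / 2 * v :=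
      Real.sqrt_le_iff.2 ⟨by linarith, by nlinarith⟩
    refine (min_le_left _ _).trans ?_
    have h3 : v * 1 ≤ v * (8 * κ * m.meanGap g τ) := by nlinarith
    exact le_of_mul_le_mul_left h3 (by linarith)

set_option maxHeartbeats 800000 in
/-- The squared error of an element of the confidence set, in the norm of the averaged Hessian. -/
lemma sum_meanGap_le {lam L δ l β₀ : ℝ} (hlam : 0 < lam) (hl : 0 ≤ l) (hβ₀ : 0 ≤ β₀)
    {b f fhat : Feat S A M H}
    (hη : m.η ≤ 1 / Real.sqrt (effHorizon m.α H))
    (hL : Real.sqrt (∑ p, m.feat p ^ 2) ≤ L)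
    (hmax : IsMaxOn (m.logLik lam D k) Set.univ fhat)
    (hf : f ∈ m.confSet b lam L δ D k fhat) (hN : m.NoiseBound D k l β₀) :
    lam * ∑ p, (f - m.feat) p ^ 2 +
      ∑ k' ∈ Finset.Ico 1 k, ∑ h : Fin H, m.meanGap (f - m.feat) (Traj.hist (D k') h) ≤
      16 * (4 * (L + 1) + 2 * Real.log (M + 1)) * radius S A M H lam L δ k ^ 2 + 12 * β₀ ^ 2 +
        4 * (6 * β₀ ^ 2 + β₀ * Real.sqrt l + lam * L) ^ 2 / lam := by
  have hL0 : 0 ≤ L := (Real.sqrt_nonneg _).trans hL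
  set g := f - m.feat with hg
  have hfg : f = m.feat + g := by rw [hg]; abel
  set R2 := ∑ p, g p ^ 2 with hR2
  have hR20 : 0 ≤ R2 := Finset.sum_nonneg fun _ _ => sq_nonneg _
  set Y := ∑ k' ∈ Finset.Ico 1 k, ∑ h : Fin H, m.meanGap g (Traj.hist (D k') h) with hY
  have hY0 : 0 ≤ Y :=
    Finset.sum_nonneg fun _ _ => Finset.sum_nonneg fun _ _ => m.meanGap_nonneg _ _
  set X := lam * R2 + Y with hX
  have hX0 : 0 ≤ X := by positivity
  set β := radius S A M H lam L δ k with hβ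
  have hβ0 : 0 ≤ β := (Real.sqrt_nonneg _).trans hf.2
  set G := 4 * (L + 1) + 2 * Real.log (M + 1) with hG
  have hG4 : 4 ≤ G := by
    have : 0 ≤ Real.log ((M : ℝ) + 1) := Real.log_nonneg (by linarith [(Nat.cast_nonneg M : (0:ℝ) ≤ M)])
    rw [hG]; linarith
  set ρ := Real.sqrt R2 with hρ
  have hρ0 : 0 ≤ ρ := Real.sqrt_nonneg _
  have hρsq : ρ ^ 2 = R2 := Real.sq_sqrt hR20
  have hvis : ∀ k' : ℕ, ∀ h : Fin H, ∑ p, m.visit (Traj.hist (D k') h) p ^ 2 ≤ 1 := fun k' h =>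
    m.sum_visit_sq_le hη _ (by rw [Traj.length_hist]; exact h.2)
  -- `X` is the pairing of `g` with the difference of `gVec` at `f` and at the truth. Inserting the
  -- estimate leaves the defining quantity of the confidence set, the noise and the ridge bias.
  have hXeq : X = g ⬝ᵥ (m.gVec lam D k f - m.gVec lam D k fhat) +
      (m.noise D k g - lam * ∑ p, g p * m.feat p) := by
    have h1 := m.dotProduct_gVec_sub hmax g
    rw [dotProduct_sub, dotProduct_gVec] at h1
    rw [dotProduct_sub, dotProduct_gVec, hX, hY, hR2]
    have h2 : lam * ∑ p, g p * f p = lam * ∑ p, g p ^ 2 + lam * ∑ p, g p * m.feat p := by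
      rw [← mul_add, ← Finset.sum_add_distrib]
      congr 1
      refine Finset.sum_congr rfl fun p _ => ?_
      rw [hfg, Pi.add_apply]; ring
    simp only [meanGap, Finset.sum_sub_distrib, ← logits_add, ← hfg]
    linarith
  -- The Hessian is taken at `f`, the far end, which may be far from the truth. The far-end bound
  -- compares it with `X` at a cost `4G` depending only on `L` and `log (M + 1)`.
  have hT1 : g ⬝ᵥ (m.gVec lam D k f - m.gVec lam D k fhat) ≤ β * Real.sqrt (4 * G * X) := by
    refine (dotProduct_le_sqrt_mul (hessMat_posDef m hlam D k f) _ _ hf.2).trans ?_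
    refine mul_le_mul_of_nonneg_left (Real.sqrt_le_sqrt ?_) hβ0
    rw [dotProduct_hessMat, hX, mul_add, hY,
      Finset.mul_sum (Finset.Ico 1 k)]
    refine add_le_add ?_ (Finset.sum_le_sum fun k' _ => ?_)
    · have : 0 ≤ lam * R2 := by positivity
      nlinarith
    · rw [Finset.mul_sum]
      refine Finset.sum_le_sum fun h _ => ?_
      rw [hfg, logits_add]
      have h1 := gvar_add_le_of_abs_le (m.logits m.feat (Traj.hist (D k') h))
        (m.logits g (Traj.hist (D k') h)) (B := L) (fun x => by
          refine (abs_extZero_le _ x).trans (le_trans (Real.sqrt_le_sqrt ?_) hL)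
          refine (sum_blockDot_sq_le _ _).trans (mul_le_of_le_one_right ?_ (hvis k' h))
          exact Finset.sum_nonneg fun _ _ => sq_nonneg _)
      rw [Fintype.card_fin] at h1
      push_cast at h1
      exact h1
  -- The noise is measured at the truth, with its own ridge `l`. Near-end self-concordance costs a
  -- factor linear in the distance `ρ`, to be absorbed below.
  have hT2 : m.noise D k g ≤ β₀ * (Real.sqrt l * ρ) + β₀ * Real.sqrt (3 * (1 + 2 * ρ) * X) := by
    refine (hN g).trans ?_
    rw [← mul_add]
    refine mul_le_mul_of_nonneg_left ?_ hβ₀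
    rw [← Real.sqrt_mul hl]
    refine le_trans (Real.sqrt_le_sqrt ?_) (sqrt_add_le_add_sqrt' (mul_nonneg hl hR20) (by positivity))
    rw [dotProduct_hessMat]
    refine add_le_add le_rfl ?_
    calc ∑ k' ∈ Finset.Ico 1 k, ∑ h : Fin H,
          gvar (m.logits m.feat (Traj.hist (D k') h)) (m.logits g (Traj.hist (D k') h))
        ≤ ∑ k' ∈ Finset.Ico 1 k, ∑ h : Fin H,
          3 * (1 + 2 * ρ) * m.meanGap g (Traj.hist (D k') h) := by
          refine Finset.sum_le_sum fun k' _ => Finset.sum_le_sum fun h _ => ?_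
          refine (m.gvar_feat_le g _).trans ?_
          have h0 := m.meanGap_nonneg g (Traj.hist (D k') h)
          have h1 : Real.sqrt (2 * ∑ i, blockDot g (m.visit (Traj.hist (D k') h)) i ^ 2) ≤ 2 * ρ := by
            refine Real.sqrt_le_iff.2 ⟨by positivity, ?_⟩
            have := (sum_blockDot_sq_le g (m.visit (Traj.hist (D k') h))).trans
              (mul_le_of_le_one_right hR20 (hvis k' h))
            nlinarith
          gcongr
      _ = 3 * (1 + 2 * ρ) * Y := by simp only [hY, Finset.mul_sum]
      _ ≤ 3 * (1 + 2 * ρ) * X := by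
          have : 0 ≤ lam * R2 := by positivity
          gcongr
          linarith
  have hT3 : -(lam * ∑ p, g p * m.feat p) ≤ lam * L * ρ := by
    have h1 := sum_mul_le_sqrt_mul_sqrt (fun p => -g p) m.feat
    simp only [neg_mul, Finset.sum_neg_distrib, neg_sq] at h1
    have h2 : ρ * Real.sqrt (∑ p, m.feat p ^ 2) ≤ ρ * L := mul_le_mul_of_nonneg_left hL hρ0
    have h3 : lam * (-∑ p, g p * m.feat p) ≤ lam * (ρ * L) :=
      mul_le_mul_of_nonneg_left (h1.trans h2) hlam.le
    linarith
  have hA1 : β * Real.sqrt (4 * G * X) ≤ X / 4 + 4 * G * β ^ 2 := by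
    have h1 : Real.sqrt (4 * G * X) ^ 2 = 4 * G * X := Real.sq_sqrt (by positivity)
    have hGp : 0 < 4 * G := by linarith
    have h2 : 0 ≤ (Real.sqrt (4 * G * X) - 2 * (4 * G) * β) ^ 2 := sq_nonneg _
    have h3 : 4 * (4 * G) * (β * Real.sqrt (4 * G * X)) ≤ 4 * (4 * G) * (X / 4 + 4 * G * β ^ 2) := by
      nlinarith
    exact le_of_mul_le_mul_left h3 (by positivity)
  have hA2 : β₀ * Real.sqrt (3 * (1 + 2 * ρ) * X) ≤ X / 4 + 3 * (1 + 2 * ρ) * β₀ ^ 2 := by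
    set c := 3 * (1 + 2 * ρ) with hc
    have hcp : 0 < c := by positivity
    have h1 : Real.sqrt (c * X) ^ 2 = c * X := Real.sq_sqrt (by positivity)
    have h2 : 0 ≤ (Real.sqrt (c * X) - 2 * c * β₀) ^ 2 := sq_nonneg _
    have h3 : 4 * c * (β₀ * Real.sqrt (c * X)) ≤ 4 * c * (X / 4 + c * β₀ ^ 2) := by nlinarith
    exact le_of_mul_le_mul_left h3 (by positivity)
  -- All terms linear in `ρ`, including the `β₀²` one created by the factor `1 + 2ρ`. They are
  -- absorbed using `lam ρ² ≤ X`, which is where `Q² / lam` comes from.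
  set Q := 6 * β₀ ^ 2 + β₀ * Real.sqrt l + lam * L with hQ
  have hA3 : Q * ρ ≤ X / 4 + Q ^ 2 / lam := by
    have h1 : Q * ρ ≤ lam * ρ ^ 2 / 4 + Q ^ 2 / lam := by
      have h2 : 0 ≤ (lam * ρ / 2 - Q) ^ 2 / lam := by positivity
      have h3 : (lam * ρ / 2 - Q) ^ 2 / lam = lam * ρ ^ 2 / 4 + Q ^ 2 / lam - Q * ρ := by
        field_simp; ring
      linarith
    have : lam * ρ ^ 2 ≤ X := by rw [hρsq, hX]; linarith
    linarith
  have hsum : X ≤ X / 4 + 4 * G * β ^ 2 + (X / 4 + 3 * β₀ ^ 2) + Q * ρ := by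
    have : X ≤ β * Real.sqrt (4 * G * X) + (β₀ * (Real.sqrt l * ρ) +
      β₀ * Real.sqrt (3 * (1 + 2 * ρ) * X)) + lam * L * ρ := by linarith
    have hQρ : Q * ρ = 6 * ρ * β₀ ^ 2 + β₀ * (Real.sqrt l * ρ) + lam * L * ρ := by rw [hQ]; ring
    linarith
  have hfin : X ≤ 16 * G * β ^ 2 + 12 * β₀ ^ 2 + 4 * (Q ^ 2 / lam) := by linarith
  rw [mul_div_assoc]
  exact hfin

/-- The sum of the context prediction errors, at one step of the episodes. -/
lemma sum_abs_ctxProb_sub_le {K : ℕ} (hK : 1 ≤ K) (hH : 1 ≤ H) (hM : 1 ≤ M)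
    (hη : m.η ≤ 1 / Real.sqrt (effHorizon m.α H)) {lam Y : ℝ} (hlam : 0 < lam) (hY : 0 < Y)
    {f : ℕ → Feat S A M H}
    (hX : ∀ k ∈ Finset.Icc 1 K, lam * ∑ p, (f k - m.feat) p ^ 2 +
      ∑ k' ∈ Finset.Ico 1 k, ∑ h : Fin H, m.meanGap (f k - m.feat) (Traj.hist (D k') h) ≤ Y)
    (h : Fin H) :
    ∑ k ∈ Finset.Icc 1 K, ∑ y, |m.ctxProb (f k) (Traj.hist (D k) h) y -
        m.ctxProb m.feat (Traj.hist (D k) h) y| ≤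
      2 * (1 + Real.sqrt (K * ((32 * m.kappa * Y + 1) * (3 * Fintype.card (Idx S A M H) *
        Real.log (1 + 4 * K ^ 3 * (Y / lam))) * (1 + 2 * Real.log K)))) := by
  have hne : Nonempty (Idx S A M H) := ⟨(h, m.start)⟩
  obtain ⟨hκ1, hκ⟩ := m.exists_kappa_inv hH hM
  have hlen : ∀ k : ℕ, ∀ h : Fin H, (Traj.hist (D k) h).length < H := fun k h => by
    rw [Traj.length_hist]; exact h.2
  set g : ℕ → Feat S A M H := fun k => f k - m.feat with hg
  have hgap0 : ∀ k k', 0 ≤ ∑ h : Fin H, m.meanGap (g k) (Traj.hist (D k') h) := fun k k' =>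
    Finset.sum_nonneg fun _ _ => m.meanGap_nonneg _ _
  -- With the step fixed, all `M` blocks share one visitation vector, so the dimension is that of
  -- `Idx` and not `M` times it.
  have hmain := sum_min_sqrt_le (d := fun k => m.visit (Traj.hist (D k) h)) (Δ := g) hK
    (B := 8 * m.kappa * Y) (R := Y / lam) (div_pos hY hlam)
    (fun k _ => m.sum_visit_sq_le hη _ (hlen k h))
    (fun k hk => by
      rw [le_div_iff₀ hlam, mul_comm]
      have h1 := hX k hk
      have h2 : 0 ≤ ∑ k' ∈ Finset.Ico 1 k, ∑ h : Fin H, m.meanGap (g k) (Traj.hist (D k') h) :=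
        Finset.sum_nonneg fun k' _ => hgap0 k k'
      linarith)
    (fun k hk => by
      calc ∑ k' ∈ Finset.Ico 1 k, min 1 (∑ i, blockDot (g k) (m.visit (Traj.hist (D k') h)) i ^ 2)
          ≤ ∑ k' ∈ Finset.Ico 1 k, 8 * m.kappa *
              ∑ h : Fin H, m.meanGap (g k) (Traj.hist (D k') h) := by
            refine Finset.sum_le_sum fun k' _ => ?_
            refine (m.min_one_le_kappa_mul (by linarith) (g k) _ (hκ _ (hlen k' h) _)).trans ?_
            refine mul_le_mul_of_nonneg_left ?_ (by linarith)
            -- The gaps at the other steps are nonnegative and are dropped.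
            exact Finset.single_le_sum (f := fun h => m.meanGap (g k) (Traj.hist (D k') h))
              (fun _ _ => m.meanGap_nonneg _ _) (Finset.mem_univ h)
        _ ≤ 8 * m.kappa * Y := by
            rw [← Finset.mul_sum]
            refine mul_le_mul_of_nonneg_left ?_ (by linarith)
            have h1 := hX k hk
            have h2 : 0 ≤ lam * ∑ p, (f k - m.feat) p ^ 2 :=
              mul_nonneg hlam.le (Finset.sum_nonneg fun _ _ => sq_nonneg _)
            linarith)
  have hpt : ∀ k, ∑ y, |m.ctxProb (f k) (Traj.hist (D k) h) y -
      m.ctxProb m.feat (Traj.hist (D k) h) y| ≤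
      2 * min 1 (Real.sqrt (∑ i, blockDot (g k) (m.visit (Traj.hist (D k) h)) i ^ 2)) := by
    intro k
    rw [ctxProb_eq, ctxProb_eq, mul_min_of_nonneg _ _ (by norm_num : (0:ℝ) ≤ 2), mul_one]
    refine le_min (sum_abs_gibbs_sub_le_two _ _) ?_
    have hfk : f k = m.feat + g k := by simp [hg]
    rw [hfk, logits_add]
    refine (sum_abs_gibbs_sub_le _ _ fun x y => extZero_sub_le _ x y).trans ?_
    rw [Real.sqrt_mul (by norm_num)]
    refine mul_le_mul_of_nonneg_right ?_ (Real.sqrt_nonneg _)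
    exact Real.sqrt_le_iff.2 ⟨by norm_num, by norm_num⟩
  calc _ ≤ ∑ k ∈ Finset.Icc 1 K,
        2 * min 1 (Real.sqrt (∑ i, blockDot (g k) (m.visit (Traj.hist (D k) h)) i ^ 2)) :=
        Finset.sum_le_sum fun k _ => hpt k
    _ ≤ _ := by
        rw [← Finset.mul_sum]
        refine mul_le_mul_of_nonneg_left (hmain.trans (le_of_eq ?_)) (by norm_num)
        rw [show 4 * (8 * m.kappa * Y) = 32 * m.kappa * Y by ring]

/-- The sum of the bonuses along the episodes. -/
lemma sum_bonus_le {K : ℕ} {δ : ℝ} (hι : 0 ≤ bonusLog S A M H K δ) (h : Fin H) :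
    ∑ k ∈ Finset.Icc 1 K,
      (bonusRew S A M H K δ (visits D k h ((D k).1 h.castSucc) ((D k).2.1 h) ((D k).2.2 h)) +
        bonusTrans S A M H K δ (visits D k h ((D k).1 h.castSucc) ((D k).2.1 h) ((D k).2.2 h))) ≤
      (Real.sqrt (bonusLog S A M H K δ) +
        H * Real.sqrt (4 * Fintype.card S * bonusLog S A M H K δ)) *
      (3 * Real.sqrt (Fintype.card (S × A × Fin (M + 1)) * K)) := by
  set c : ℕ → S × A × Fin (M + 1) := fun k => ((D k).1 h.castSucc, (D k).2.1 h, (D k).2.2 h)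
  have hvis : ∀ k, visits D k h ((D k).1 h.castSucc) ((D k).2.1 h) ((D k).2.2 h) =
      ((Finset.Ico 1 k).filter fun k' => c k' = c k).card := fun k => by
    unfold visits
    congr 1
    refine Finset.filter_congr fun k' _ => ?_
    simp [c, Prod.ext_iff]
  refine le_trans ?_ (mul_le_mul_of_nonneg_left (sum_inv_sqrt_visits_le c K) (by positivity))
  rw [Finset.mul_sum]
  refine Finset.sum_le_sum fun k _ => ?_
  rw [hvis, add_mul]
  refine add_le_add ((min_le_left _ _).trans (le_of_eq ?_)) ((min_le_left _ _).trans (le_of_eq ?_))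
  · rw [Real.sqrt_div hι]; ring
  · rw [Real.sqrt_div (by positivity)]; ring

end Model

end Estimation

/-! ### Maximal inequalities -/

section Maximal

open MeasureTheory ProbabilityTheory

variable {Ω : Type*} [mΩ : MeasurableSpace Ω] {μ : Measure Ω} [IsProbabilityMeasure μ]
  {ℱ : Filtration ℕ mΩ} {K : ℕ}

/-- Ville's inequality for nonnegative supermartingales. -/
lemma measureReal_exists_le {X : ℕ → Ω → ℝ} (h0 : ∀ k ω, 0 ≤ X k ω)
    (hm : ∀ k ≤ K, Measurable[ℱ k] (X k)) (hi : ∀ k ≤ K, Integrable (X k) μ)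
    (hstep : ∀ k < K, ∀ G, MeasurableSet[ℱ k] G →
      ∫ ω in G, X (k + 1) ω ∂μ ≤ ∫ ω in G, X k ω ∂μ)
    (hX0 : ∀ ω, X 0 ω ≤ 1) {a : ℝ} (ha : 0 < a) :
    μ.real {ω | ∃ n ≤ K, a ≤ X n ω} ≤ 1 / a := by
  set B : ℕ → Set Ω := fun n => {ω | ∃ j ≤ n, a ≤ X j ω} with hB
  have hBm : ∀ n ≤ K, MeasurableSet[ℱ n] (B n) := fun n hn => by
    have : B n = ⋃ j ∈ Finset.range (n + 1), {ω | a ≤ X j ω} := by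
      ext ω; simp [hB]
    rw [this]
    refine Finset.measurableSet_biUnion _ fun j hj => ?_
    have hj : j ≤ n := Nat.lt_succ_iff.1 (Finset.mem_range.1 hj)
    exact ℱ.mono hj _ (hm j (hj.trans hn) measurableSet_Ici)
  -- Stopping at the first crossing without a stopping time: the probability of having crossed,
  -- weighted by `a`, plus the mass on paths that have not, never exceeds one.
  have key : ∀ n ≤ K, a * μ.real (B n) + ∫ ω in (B n)ᶜ, X n ω ∂μ ≤ 1 := by
    intro n
    induction n with
    | zero =>
      intro hn
      have hmB := ℱ.le _ _ (hBm 0 hn)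
      have h1 : a * μ.real (B 0) ≤ ∫ ω in B 0, X 0 ω ∂μ :=
        setIntegral_ge_of_const_le_real hmB (measure_ne_top _ _)
          (fun ω hω => by obtain ⟨j, hj, h⟩ := hω; rwa [Nat.le_zero.1 hj] at h)
          (hi 0 hn).integrableOn
      have h2 := integral_add_compl hmB (hi 0 hn)
      have h3 : ∫ ω, X 0 ω ∂μ ≤ 1 := by
        refine (integral_mono (hi 0 hn) (integrable_const 1) hX0).trans ?_
        simp
      linarith
    | succ n ih =>
      intro hn
      have hn' : n ≤ K := Nat.le_of_succ_le hn
      have hmB := ℱ.le _ _ (hBm n hn')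
      have hmB1 := ℱ.le _ _ (hBm (n + 1) hn)
      have hsub : B n ⊆ B (n + 1) := fun ω ⟨j, hj, h⟩ => ⟨j, hj.trans n.le_succ, h⟩
      have h1 := hstep n hn (B n)ᶜ (hBm n hn').compl
      have h2 : ∫ ω in (B n)ᶜ, X (n + 1) ω ∂μ =
          ∫ ω in B (n + 1) \ B n, X (n + 1) ω ∂μ + ∫ ω in (B (n + 1))ᶜ, X (n + 1) ω ∂μ := by
        rw [← setIntegral_union _ hmB1.compl (hi _ hn).integrableOn (hi _ hn).integrableOn]
        · congr 2
          ext ω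
          have := @hsub ω
          simp only [Set.mem_compl_iff, Set.mem_union, Set.mem_sdiff]
          tauto
        · exact Set.disjoint_left.2 fun ω hω hω' => hω' hω.1
      have h3 : a * μ.real (B (n + 1) \ B n) ≤ ∫ ω in B (n + 1) \ B n, X (n + 1) ω ∂μ :=
        setIntegral_ge_of_const_le_real (hmB1.diff hmB) (measure_ne_top _ _)
          (fun ω hω => by
            obtain ⟨⟨j, hj, h⟩, h'⟩ := hω
            rcases Nat.lt_or_ge n j with hlt | hge
            · rwa [le_antisymm hj hlt] at h
            · exact absurd ⟨j, hge, h⟩ h')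
          (hi _ hn).integrableOn
      have h4 : μ.real (B (n + 1)) = μ.real (B (n + 1) \ B n) + μ.real (B n) :=
        (measureReal_sdiff_add_inter (s := B (n + 1)) hmB).symm.trans (by
          rw [Set.inter_eq_self_of_subset_right hsub])
      have := ih hn'
      rw [h4, mul_add]
      linarith
  have h1 := key K le_rfl
  have h2 : 0 ≤ ∫ ω in (B K)ᶜ, X K ω ∂μ := setIntegral_nonneg_of_ae (by
    exact Filter.Eventually.of_forall fun ω => h0 K ω)
  rw [le_div_iff₀ ha, mul_comm]
  linarith

/-- Hoeffding's lemma for Bernoulli variables. -/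
lemma one_sub_add_mul_exp_le {q : ℝ} (hq : q ∈ Set.Icc (0 : ℝ) 1) (t : ℝ) :
    1 - q + q * Real.exp t ≤ Real.exp (t * q + t ^ 2 / 8) := by
  -- The Bernoulli law on `{0, 1}`, to which the sub-Gaussian bound for bounded variables applies.
  set ν : Measure ℝ := ENNReal.ofReal q • Measure.dirac 1 + ENNReal.ofReal (1 - q) • Measure.dirac 0
    with hν
  have hint : ∀ g : ℝ → ℝ, ∫ x, g x ∂ν = q * g 1 + (1 - q) * g 0 := fun g => by
    rw [hν, integral_add_measure, integral_smul_measure, integral_smul_measure, integral_dirac,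
      integral_dirac, ENNReal.toReal_ofReal hq.1, ENNReal.toReal_ofReal (by linarith [hq.2])]
    · simp
    · exact (integrable_dirac (by simp)).smul_measure ENNReal.ofReal_ne_top
    · exact (integrable_dirac (by simp)).smul_measure ENNReal.ofReal_ne_top
  have hprob : IsProbabilityMeasure ν := ⟨by
    simp only [hν, Measure.coe_add, Measure.coe_smul, Pi.add_apply, Pi.smul_apply,
      measure_univ, smul_eq_mul, mul_one]
    rw [← ENNReal.ofReal_add hq.1 (by linarith [hq.2])]
    simp⟩
  have h := (hasSubgaussianMGF_of_mem_Icc (μ := ν) (X := id) (a := 0) (b := 1)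
    measurable_id.aemeasurable (by
      rw [hν, ae_add_measure_iff]
      refine ⟨Measure.ae_smul_measure ?_ _, Measure.ae_smul_measure ?_ _⟩ <;>
      · rw [ae_dirac_eq]; simp)).mgf_le t
  simp only [mgf, hint, id] at h
  norm_num at h
  have h2 : 1 - q + q * Real.exp t =
      (q * Real.exp (t * (1 - q)) + (1 - q) * Real.exp (-(t * q))) * Real.exp (t * q) := by
    rw [add_mul, mul_assoc, mul_assoc, ← Real.exp_add, ← Real.exp_add]
    rw [show t * (1 - q) + t * q = t by ring, neg_add_cancel, Real.exp_zero]
    ring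
  rw [h2, add_comm (t * q), Real.exp_add]
  refine mul_le_mul_of_nonneg_right (h.trans (Real.exp_le_exp.2 ?_)) (Real.exp_pos _).le
  linarith

/-- A Hoeffding bound for the averages over the times at which `J` holds, uniformly over
time. -/
lemma measureReal_lt_abs_sum_le {J : ℕ → Ω → Prop} [∀ k ω, Decidable (J k ω)] {Y : ℕ → Ω → ℝ}
    {q θ : ℝ} (hJ : ∀ k ∈ Finset.Icc 1 K, MeasurableSet[ℱ k] {ω | J k ω})
    (hY : ∀ k ∈ Finset.Icc 1 K, Measurable[ℱ k] (Y k))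
    (hY01 : ∀ k ∈ Finset.Icc 1 K, ∀ ω, Y k ω ∈ Set.Icc (0 : ℝ) 1) (hq : q ∈ Set.Icc (0 : ℝ) 1)
    (hmean : ∀ t : ℝ, ∀ k ∈ Finset.Icc 1 K, ∀ U : Ω → ℝ, Measurable[ℱ (k - 1)] U →
      (∀ ω, 0 ≤ U ω) → (∃ C, ∀ ω, U ω ≤ C) →
      ∫ ω, U ω * (if J k ω then Real.exp (t * (Y k ω - q) - t ^ 2 / 8) else 1) ∂μ ≤ ∫ ω, U ω ∂μ)
    (hθ : 0 < θ) :
    μ.real {ω | ∃ k ∈ Finset.Icc 1 K, 0 < ((Finset.Ico 1 k).filter fun k' => J k' ω).card ∧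
      Real.sqrt (θ * ((Finset.Ico 1 k).filter fun k' => J k' ω).card) <
        |∑ k' ∈ (Finset.Ico 1 k).filter fun k' => J k' ω, (Y k' ω - q)|} ≤
      2 * K * Real.exp (-(2 * θ)) := by
  set w : ℝ → ℕ → Ω → ℝ := fun t k ω =>
    if J k ω then Real.exp (t * (Y k ω - q) - t ^ 2 / 8) else 1 with hw
  set X : ℝ → ℕ → Ω → ℝ := fun t n ω => ∏ k ∈ Finset.Ico 1 (n + 1), w t k ω with hX
  have hw0 : ∀ t k ω, 0 ≤ w t k ω := fun t k ω => by
    simp only [hw]; split_ifs <;> positivity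
  have hw1 : ∀ t, ∀ k ∈ Finset.Icc 1 K, ∀ ω, w t k ω ≤ Real.exp |t| := fun t k hk ω => by
    simp only [hw]
    split_ifs
    · refine Real.exp_le_exp.2 ?_
      have h1 := hY01 k hk ω
      have h2 : |t * (Y k ω - q)| ≤ |t| * 1 := by
        rw [abs_mul]
        refine mul_le_mul_of_nonneg_left (abs_le.2 ⟨?_, ?_⟩) (abs_nonneg _) <;>
          linarith [h1.1, h1.2, hq.1, hq.2]
      have := le_abs_self (t * (Y k ω - q))
      nlinarith [sq_nonneg t]
    · exact Real.one_le_exp (abs_nonneg _)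
  have hwm : ∀ t, ∀ k ∈ Finset.Icc 1 K, Measurable[ℱ k] (w t k) := fun t k hk => by
    refine Measurable.ite (hJ k hk) ?_ measurable_const
    exact Real.measurable_exp.comp ((((hY k hk).sub_const q).const_mul t).sub_const _)
  have hX0 : ∀ t n ω, 0 ≤ X t n ω := fun t n ω => Finset.prod_nonneg fun _ _ => hw0 _ _ _
  have hXle : ∀ t, ∀ n ≤ K, ∀ ω, X t n ω ≤ Real.exp |t| ^ n := fun t n hn ω => by
    refine (Finset.prod_le_prod (fun k _ => hw0 t k ω) fun k hk => hw1 t k ?_ ω).trans ?_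
    · rw [Finset.mem_Ico] at hk
      exact Finset.mem_Icc.2 ⟨hk.1, by omega⟩
    · rw [Finset.prod_const, Nat.card_Ico, Nat.add_sub_cancel]
  have hXm : ∀ t, ∀ n ≤ K, Measurable[ℱ n] (X t n) := fun t n hn => by
    refine Finset.measurable_prod _ fun k hk => ?_
    rw [Finset.mem_Ico] at hk
    exact (hwm t k (Finset.mem_Icc.2 ⟨hk.1, by omega⟩)).mono (ℱ.mono (by omega)) le_rfl
  have hXi : ∀ t, ∀ n ≤ K, Integrable (X t n) μ := fun t n hn =>
    Integrable.of_bound ((hXm t n hn).mono (ℱ.le n) le_rfl).aestronglyMeasurable _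
      (Filter.Eventually.of_forall fun ω => by
        rw [Real.norm_of_nonneg (hX0 t n ω)]; exact hXle t n hn ω)
  have hV : ∀ t, μ.real {ω | ∃ n ≤ K, Real.exp (2 * θ) ≤ X t n ω} ≤ Real.exp (-(2 * θ)) := by
    intro t
    refine (measureReal_exists_le (ℱ := ℱ) (hX0 t) (hXm t) (hXi t) ?_ ?_
      (Real.exp_pos _)).trans (le_of_eq ?_)
    · intro k hk G hG
      have hG' := ℱ.le _ _ hG
      have h1 := hmean t (k + 1) (Finset.mem_Icc.2 ⟨by omega, hk⟩) (G.indicator (X t k))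
        ((hXm t k hk.le).indicator hG)
        (fun ω => Set.indicator_nonneg (fun ω _ => hX0 t k ω) ω)
        ⟨_, fun ω => (Set.indicator_le_self' (fun _ _ => hX0 t k _) ω).trans (hXle t k hk.le ω)⟩
      rw [← integral_indicator hG', ← integral_indicator hG']
      refine le_trans (le_of_eq ?_) h1
      refine integral_congr_ae (Filter.Eventually.of_forall fun ω => ?_)
      by_cases hω : ω ∈ G
      · simp only [Set.indicator_of_mem hω]
        simp only [hX]
        rw [Finset.prod_Ico_succ_top (by omega)]
      · simp only [Set.indicator_of_notMem hω, zero_mul]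
    · intro ω; simp [hX]
    · rw [one_div, Real.exp_neg]
  -- The best slope `t = 4 √(θ/n)` depends on the random number `n` of occurrences, so a union is
  -- taken over `n ≤ K` and both signs. For this slope the exponent is at least `4θ - 2θ`.
  have hsub : {ω | ∃ k ∈ Finset.Icc 1 K, 0 < ((Finset.Ico 1 k).filter fun k' => J k' ω).card ∧
      Real.sqrt (θ * ((Finset.Ico 1 k).filter fun k' => J k' ω).card) <
        |∑ k' ∈ (Finset.Ico 1 k).filter fun k' => J k' ω, (Y k' ω - q)|} ⊆
      ⋃ n ∈ Finset.Icc 1 K, ({ω | ∃ j ≤ K, Real.exp (2 * θ) ≤ X (4 * Real.sqrt (θ / n)) j ω} ∪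
        {ω | ∃ j ≤ K, Real.exp (2 * θ) ≤ X (-(4 * Real.sqrt (θ / n))) j ω}) := by
    rintro ω ⟨k, hk, hn0, hlt⟩
    set n := ((Finset.Ico 1 k).filter fun k' => J k' ω).card with hn
    set σ := ∑ k' ∈ (Finset.Ico 1 k).filter fun k' => J k' ω, (Y k' ω - q) with hσ
    rw [Finset.mem_Icc] at hk
    have hnK : n ≤ K := by
      refine (Finset.card_filter_le _ _).trans ?_
      rw [Nat.card_Ico]; omega
    have hn0' : (0 : ℝ) < n := by exact_mod_cast hn0
    have hXeq : ∀ t, X t (k - 1) ω = Real.exp (t * σ - n * (t ^ 2 / 8)) := fun t => by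
      simp only [hX, hw]
      rw [Nat.sub_add_cancel hk.1, ← Finset.prod_filter, ← Real.exp_sum,
        Finset.sum_sub_distrib, ← Finset.mul_sum, Finset.sum_const, nsmul_eq_mul]
    set t := 4 * Real.sqrt (θ / n) with ht
    have ht0 : 0 < t := by positivity
    have ht2 : n * (t ^ 2 / 8) = 2 * θ := by
      rw [ht, mul_pow, Real.sq_sqrt (by positivity)]
      field_simp; norm_num
    have ht3 : t * Real.sqrt (θ * n) = 4 * θ := by
      rw [ht, mul_assoc, ← Real.sqrt_mul (by positivity)]
      rw [show θ / n * (θ * n) = θ ^ 2 by field_simp, Real.sqrt_sq hθ.le]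
    have hge : 4 * θ ≤ t * |σ| := by
      rw [← ht3]; exact mul_le_mul_of_nonneg_left hlt.le ht0.le
    simp only [Set.mem_iUnion]
    refine ⟨n, Finset.mem_Icc.2 ⟨hn0, hnK⟩, ?_⟩
    rcases le_total 0 σ with hs | hs
    · left
      refine ⟨k - 1, by omega, ?_⟩
      rw [hXeq, ht2]
      rw [abs_of_nonneg hs] at hge
      exact Real.exp_le_exp.2 (by linarith)
    · right
      refine ⟨k - 1, by omega, ?_⟩
      rw [hXeq, neg_sq, ht2]
      rw [abs_of_nonpos hs] at hge
      exact Real.exp_le_exp.2 (by linarith)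
  refine (measureReal_mono hsub (measure_ne_top _ _)).trans ?_
  refine (measureReal_biUnion_finset_le _ _).trans ?_
  calc _ ≤ ∑ n ∈ Finset.Icc 1 K, (Real.exp (-(2 * θ)) + Real.exp (-(2 * θ))) :=
        Finset.sum_le_sum fun n _ => (measureReal_union_le _ _).trans (add_le_add (hV _) (hV _))
    _ = _ := by
        rw [Finset.sum_const, Nat.card_Icc, nsmul_eq_mul, Nat.add_sub_cancel]; ring

end Maximal

/-! ### Conditional laws along a run -/

section Runs

open MeasureTheory ProbabilityTheory

variable {S A : Type*} [Fintype S] [Fintype A] [DecidableEq S] [DecidableEq A] {M H : ℕ}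

namespace Model

namespace IsRun

variable {m : Model S A M H} {b : Feat S A M H} {lam L δ : ℝ} {K : ℕ} {Ω : Type*}
  [mΩ : MeasurableSpace Ω] {μ : Measure Ω} [IsProbabilityMeasure μ] {ℱ : Filtration ℕ mΩ}
  {init : ℕ → Ω → S} {fbar : ℕ → Ω → Feat S A M H} {pol : ℕ → Ω → Hist S A M → S → A}
  {D : ℕ → Ω → Traj S A M H} {R : ℕ → Fin H → Ω → ℝ}

/-- Functions of the past episodes are known at the beginning of an episode. -/
lemma measurable_past (hr : m.IsRun b lam L δ K μ ℱ init fbar pol D R) {β : Type*}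
    [MeasurableSpace β] {k : ℕ} (hk : k ≤ K + 1) {Φ : (ℕ → Traj S A M H) → β}
    (hΦ : ∀ D₁ D₂ : ℕ → Traj S A M H, (∀ k' ∈ Finset.Ico 1 k, D₁ k' = D₂ k') → Φ D₁ = Φ D₂) :
    Measurable[ℱ (k - 1)] fun ω => Φ fun k' => D k' ω := by
  set e₀ : Traj S A M H := (fun _ => m.start.1, fun _ => m.start.2.1, fun _ => m.start.2.2)
  let _ : MeasurableSpace (Finset.Ico 1 k → Traj S A M H) := ⊤
  have h1 : Measurable[ℱ (k - 1)] fun ω => fun i : Finset.Ico 1 k => D i.1 ω := by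
    refine @measurable_to_countable' _ _ _ _ (ℱ (k - 1)) _ fun r => ?_
    have : (fun ω => fun i : Finset.Ico 1 k => D i.1 ω) ⁻¹' {r} = ⋂ i, {ω | D i.1 ω = r i} := by
      ext ω; simp [funext_iff]
    rw [this]
    refine MeasurableSet.iInter fun i => ?_
    have hi := Finset.mem_Ico.1 i.2
    exact ℱ.mono (by omega) _ (hr.traj_adapted i.1 (Finset.mem_Icc.2 ⟨hi.1, by omega⟩) _)
  have h2 : (fun ω => Φ fun k' => D k' ω) =
      (fun r : Finset.Ico 1 k → Traj S A M H =>
        Φ fun k' => if h : k' ∈ Finset.Ico 1 k then r ⟨k', h⟩ else e₀) ∘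
      fun ω => fun i : Finset.Ico 1 k => D i.1 ω := by
    funext ω
    refine hΦ _ _ fun k' hk' => ?_
    simp only [dif_pos hk']
  rw [h2]
  exact measurable_from_top.comp h1

lemma measurable_trajProb (hr : m.IsRun b lam L δ K μ ℱ init fbar pol D R) {k : ℕ}
    (hk : k ∈ Finset.Icc 1 K) (e : Traj S A M H) :
    Measurable[ℱ (k - 1)] fun ω => m.trajProb (detPolicy (pol k ω)) (init k ω) e := by
  unfold trajProb
  refine Measurable.mul ?_ (Finset.measurable_prod _ fun h _ => ?_)
  · refine Measurable.ite ?_ measurable_const measurable_const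
    convert hr.init_adapted k hk (e.1 0) using 2
    simp [eq_comm]
  · refine Measurable.mul_const (Measurable.mul_const ?_ _) _
    simp only [detPolicy_apply]
    refine Measurable.ite ?_ measurable_const measurable_const
    convert hr.pol_adapted k hk (Traj.hist e h) (e.1 h.castSucc) (e.2.1 h) using 2
    simp [eq_comm]

/-- The mean of a function of the next episode, with coefficients known before the episode. -/
lemma integral_apply_traj (hr : m.IsRun b lam L δ K μ ℱ init fbar pol D R) {k : ℕ}
    (hk : k ∈ Finset.Icc 1 K) {W : Ω → Traj S A M H → ℝ}
    (hW : ∀ e, Measurable[ℱ (k - 1)] fun ω => W ω e) {C : ℝ} (hC : ∀ ω e, |W ω e| ≤ C) :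
    ∫ ω, W ω (D k ω) ∂μ =
      ∫ ω, ∑ e, m.trajProb (detPolicy (pol k ω)) (init k ω) e * W ω e ∂μ := by
  set ind : Traj S A M H → Ω → ℝ := fun e => Set.indicator {ω | D k ω = e} (fun _ => (1 : ℝ))
  have hset : ∀ e, MeasurableSet {ω | D k ω = e} := fun e => ℱ.le _ _ (hr.traj_adapted k hk e)
  have hind : ∀ e, Integrable (ind e) μ := fun e =>
    (integrable_const (1 : ℝ)).indicator (hset e)
  have hmul : ∀ e, μ[(fun ω => W ω e) * ind e | ℱ (k - 1)] =ᵐ[μ]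
      fun ω => m.trajProb (detPolicy (pol k ω)) (init k ω) e * W ω e := fun e => by
    refine (condExp_stronglyMeasurable_mul_of_bound (ℱ.le _) (hW e).stronglyMeasurable (hind e) C
      (Filter.Eventually.of_forall fun ω => hC ω e)).trans ?_
    filter_upwards [hr.traj_law k hk e] with ω hω
    rw [Pi.mul_apply, hω, mul_comm]
  have hint : ∀ e, Integrable (fun ω => W ω e * ind e ω) μ := fun e =>
    (hind e).bdd_mul ((hW e).mono (ℱ.le _) le_rfl).aestronglyMeasurable
      (Filter.Eventually.of_forall fun ω => hC ω e)
  have heq : ∀ ω, W ω (D k ω) = ∑ e, W ω e * ind e ω := fun ω => by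
    rw [Finset.sum_eq_single (D k ω)]
    · simp [ind]
    · intro e _ he
      simp [ind, Ne.symm he]
    · simp
  simp_rw [heq]
  rw [integral_finsetSum _ fun e _ => hint e, integral_finsetSum]
  · refine Finset.sum_congr rfl fun e _ => ?_
    rw [← integral_congr_ae (hmul e), integral_condExp (ℱ.le _)]
    rfl
  · exact fun e _ => integrable_condExp.congr (hmul e)

lemma integrable_apply_traj (hr : m.IsRun b lam L δ K μ ℱ init fbar pol D R) {k : ℕ}
    (hk : k ∈ Finset.Icc 1 K) {W : Ω → Traj S A M H → ℝ}
    (hW : ∀ e, Measurable[ℱ k] fun ω => W ω e) {C : ℝ} (hC : ∀ ω e, |W ω e| ≤ C) :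
    Measurable[ℱ k] (fun ω => W ω (D k ω)) ∧ Integrable (fun ω => W ω (D k ω)) μ := by
  have heq : (fun ω => W ω (D k ω)) = fun ω => ∑ e, if D k ω = e then W ω e else 0 := by
    funext ω; simp
  have h1 : Measurable[ℱ k] (fun ω => W ω (D k ω)) := by
    rw [heq]
    exact Finset.measurable_sum _ fun e _ =>
      Measurable.ite (hr.traj_adapted k hk e) (hW e) measurable_const
  exact ⟨h1, Integrable.of_bound (h1.mono (ℱ.le _) le_rfl).aestronglyMeasurable C
    (Filter.Eventually.of_forall fun ω => hC ω _)⟩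

/-- A pathwise bound for the conditional means gives a bound for the integrals. -/
lemma setIntegral_apply_traj_le (hr : m.IsRun b lam L δ K μ ℱ init fbar pol D R) {k : ℕ}
    (hk : k ∈ Finset.Icc 1 K) {W : Ω → Traj S A M H → ℝ}
    (hW : ∀ e, Measurable[ℱ (k - 1)] fun ω => W ω e) {C : ℝ} (hC : ∀ ω e, |W ω e| ≤ C)
    {X : Ω → ℝ} (hX : Integrable X μ)
    (hle : ∀ ω, ∑ e, m.trajProb (detPolicy (pol k ω)) (init k ω) e * W ω e ≤ X ω)
    {G : Set Ω} (hG : MeasurableSet[ℱ (k - 1)] G) :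
    ∫ ω in G, W ω (D k ω) ∂μ ≤ ∫ ω in G, X ω ∂μ := by
  classical
  have hG' := ℱ.le _ _ hG
  have h := hr.integral_apply_traj hk (W := fun ω e => if ω ∈ G then W ω e else 0)
    (fun e => Measurable.ite hG (hW e) measurable_const) (C := C) (fun ω e => by
      split_ifs
      · exact hC ω e
      · rw [abs_zero]; exact (abs_nonneg _).trans (hC ω e))
  rw [← integral_indicator hG', ← integral_indicator hG']
  have h1 : (G.indicator fun ω => W ω (D k ω)) = fun ω => if ω ∈ G then W ω (D k ω) else 0 := by
    funext ω; simp [Set.indicator_apply]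
  rw [h1, h]
  have hP := fun ω => m.sum_trajProb (detPolicy (pol k ω)) (init k ω)
  have hP0 := fun ω => m.trajProb_nonneg (detPolicy (pol k ω)) (init k ω)
  refine integral_mono ?_ (hX.indicator hG') fun ω => ?_
  · refine Integrable.of_bound (Measurable.aestronglyMeasurable ?_) C
      (Filter.Eventually.of_forall fun ω => ?_)
    · refine Finset.measurable_sum _ fun e _ => Measurable.mul
        ((hr.measurable_trajProb hk e).mono (ℱ.le _) le_rfl) ?_
      exact Measurable.ite hG' ((hW e).mono (ℱ.le _) le_rfl) measurable_const
    · rw [Real.norm_eq_abs]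
      refine (Finset.abs_sum_le_sum_abs _ _).trans ?_
      calc _ ≤ ∑ e, m.trajProb (detPolicy (pol k ω)) (init k ω) e * C := by
            refine Finset.sum_le_sum fun e _ => ?_
            rw [abs_mul, abs_of_nonneg (hP0 ω e)]
            refine mul_le_mul_of_nonneg_left ?_ (hP0 ω e)
            split_ifs
            · exact hC ω e
            · rw [abs_zero]; exact (abs_nonneg _).trans (hC ω e)
        _ = C := by rw [← Finset.sum_mul, hP, one_mul]
  · by_cases hω : ω ∈ G
    · simpa [hω] using hle ω
    · simp [hω]

/-- The mean of the reward in a visited cell, with coefficients known before the episode. -/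
lemma integral_mul_rew (hr : m.IsRun b lam L δ K μ ℱ init fbar pol D R) {k : ℕ}
    (hk : k ∈ Finset.Icc 1 K) (h : Fin H) (s : S) (a : A) (x : Fin (M + 1)) {U : Ω → ℝ}
    (hU : Measurable[ℱ (k - 1)] U) {C : ℝ} (hC : ∀ ω, |U ω| ≤ C) :
    ∫ ω, (if (D k ω).1 h.castSucc = s ∧ (D k ω).2.1 h = a ∧ (D k ω).2.2 h = x
        then U ω else 0) * R k h ω ∂μ =
      m.rew h s a x * ∫ ω, (if (D k ω).1 h.castSucc = s ∧ (D k ω).2.1 h = a ∧ (D k ω).2.2 h = x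
        then U ω else 0) ∂μ := by
  set g : Ω → ℝ := fun ω => if (D k ω).1 h.castSucc = s ∧ (D k ω).2.1 h = a ∧ (D k ω).2.2 h = x
        then U ω else 0 with hg
  have hle : ℱ (k - 1) ⊔
      MeasurableSpace.comap (fun ω => (Traj.steps (D k ω)).take (h + 1)) ⊤ ≤ mΩ := by
    classical
    refine sup_le (ℱ.le _) ?_
    rintro _ ⟨T, -, rfl⟩
    have : (fun ω => (Traj.steps (D k ω)).take (h + 1)) ⁻¹' T =
        ⋃ e ∈ (Finset.univ : Finset (Traj S A M H)).filter
          (fun e => (Traj.steps e).take (h + 1) ∈ T), {ω | D k ω = e} := by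
      ext ω; simp
    rw [this]
    exact Finset.measurableSet_biUnion _ fun e _ => ℱ.le _ _ (hr.traj_adapted k hk e)
  -- The cell at step `h` is the entry with index `h` of the prefix of length `h + 1`, so it belongs
  -- to the σ-algebra given which the mean reward is known.
  have hgm : Measurable[ℱ (k - 1) ⊔
      MeasurableSpace.comap (fun ω => (Traj.steps (D k ω)).take (h + 1)) ⊤] g := by
    refine Measurable.ite ?_ (hU.mono le_sup_left le_rfl) measurable_const
    refine (le_sup_right : _ ≤ ℱ (k - 1) ⊔
      MeasurableSpace.comap (fun ω => (Traj.steps (D k ω)).take (h + 1)) ⊤) _ ⟨{l | l[h.1]? = some (s, a, x)}, trivial, ?_⟩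
    ext ω
    simp [Traj.steps]
  have hgC : ∀ ω, ‖g ω‖ ≤ C := fun ω => by
    simp only [hg]
    split_ifs
    · exact hC ω
    · rw [norm_zero]; exact (abs_nonneg _).trans (hC ω)
  have hR : Integrable (R k h) μ := Integrable.of_bound
    ((hr.rew_adapted k hk h).mono (ℱ.le _) le_rfl).aestronglyMeasurable 1
    (Filter.Eventually.of_forall fun ω => by
      have := hr.rew_mem k hk h ω
      rw [Real.norm_of_nonneg this.1]; exact this.2)
  have h1 := condExp_stronglyMeasurable_mul_of_bound hle hgm.stronglyMeasurable hR C
    (Filter.Eventually.of_forall hgC)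
  have h2 := integral_condExp (μ := μ) (f := g * R k h) hle
  rw [← integral_const_mul]
  change ∫ ω, (g * R k h) ω ∂μ = _
  rw [← h2]
  refine integral_congr_ae (h1.trans ?_)
  filter_upwards [hr.rew_mean k hk h] with ω hω
  rw [Pi.mul_apply, hω]
  simp only [hg]
  split_ifs with hc
  · rw [hc.1, hc.2.1, hc.2.2, mul_comm]
  · simp

end IsRun

end Model

end Runs

/-! ### Validity of the estimates of rewards and transitions -/

section Estimates

open MeasureTheory ProbabilityTheory

variable {S A : Type*} [Fintype S] [Fintype A] [DecidableEq S] [DecidableEq A] {M H : ℕ}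

/-- Two weights are close in `ℓ¹` if their masses of all sets are close. -/
lemma sum_abs_sub_le_of_forall_finset {p q : S → ℝ} {r : ℝ}
    (h : ∀ B : Finset S, |∑ s ∈ B, (p s - q s)| ≤ r) : ∑ s, |p s - q s| ≤ 2 * r := by
  have h1 := (abs_le.1 (h (Finset.univ.filter fun s => 0 ≤ p s - q s))).2
  have h2 := (abs_le.1 (h (Finset.univ.filter fun s => ¬ 0 ≤ p s - q s))).1
  have h3 : ∑ s, |p s - q s| = ∑ s ∈ Finset.univ.filter fun s => 0 ≤ p s - q s, (p s - q s) -
      ∑ s ∈ Finset.univ.filter fun s => ¬ 0 ≤ p s - q s, (p s - q s) := by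
    rw [← Finset.sum_filter_add_sum_filter_not Finset.univ (fun s => 0 ≤ p s - q s),
      sub_eq_add_neg, ← Finset.sum_neg_distrib]
    congr 1
    · exact Finset.sum_congr rfl fun s hs => abs_of_nonneg (Finset.mem_filter.1 hs).2
    · exact Finset.sum_congr rfl fun s hs => abs_of_neg (not_le.1 (Finset.mem_filter.1 hs).2)
  linarith

lemma abs_div_sub_le {σ q c : ℝ} {n : ℕ} (hn : 0 < n) (h : |σ - n * q| ≤ Real.sqrt (c * n)) :
    |σ / n - q| ≤ Real.sqrt (c / n) := by
  have hn' : (0 : ℝ) < n := by exact_mod_cast hn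
  have h1 : σ / n - q = (σ - n * q) / n := by field_simp
  rw [h1, abs_div, abs_of_pos hn', div_le_iff₀ hn']
  refine h.trans (le_of_eq ?_)
  rw [show c * n = c / n * (n : ℝ) ^ 2 by field_simp, Real.sqrt_mul' _ (sq_nonneg _),
    Real.sqrt_sq hn'.le]

namespace Model

/-- The ℓ¹ error of the transitions is at most twice the largest discrepancy over sets of states.
Controlling every set means a union over `2 ^ S` sets, and this is the origin of the factor `S` in
the transition bonus. -/
lemma estimatesValid_of_sums (m : Model S A M H) {D : ℕ → Traj S A M H} {R : ℕ → Fin H → ℝ}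
    {K k : ℕ} {δ : ℝ} (hι : 1 ≤ bonusLog S A M H K δ)
    (hR : ∀ k' ∈ Finset.Ico 1 k, ∀ h, R k' h ∈ Set.Icc (0 : ℝ) 1)
    (hrew : ∀ h s a x, 0 < visits D k h s a x →
      |∑ k' ∈ (Finset.Ico 1 k).filter fun k' =>
        (D k').1 h.castSucc = s ∧ (D k').2.1 h = a ∧ (D k').2.2 h = x, (R k' h - m.rew h s a x)| ≤
      Real.sqrt (bonusLog S A M H K δ * visits D k h s a x))
    (htr : ∀ h s a x (B : Finset S), 0 < visits D k h s a x →
      |∑ k' ∈ (Finset.Ico 1 k).filter fun k' =>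
        (D k').1 h.castSucc = s ∧ (D k').2.1 h = a ∧ (D k').2.2 h = x,
          ((if (D k').1 h.succ ∈ B then 1 else 0) - ∑ s' ∈ B, (m.trans h s a x).1 s')| ≤
      Real.sqrt (Fintype.card S * bonusLog S A M H K δ * visits D k h s a x)) :
    m.EstimatesValid D R K δ k := by
  intro h s a x
  set n := visits D k h s a x with hn
  set F := (Finset.Ico 1 k).filter fun k' =>
        (D k').1 h.castSucc = s ∧ (D k').2.1 h = a ∧ (D k').2.2 h = x with hF
  have hFn : F.card = n := rfl
  set ι := bonusLog S A M H K δ with hιd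
  have hS1 : (1 : ℝ) ≤ Fintype.card S := by
    have : 0 < Fintype.card S := Fintype.card_pos_iff.2 ⟨s⟩
    exact_mod_cast this
  have hq := m.rew_mem h s a x
  have hP0 : ∀ s', 0 ≤ (m.trans h s a x).1 s' := (m.trans h s a x).2.1
  have hP1 : ∑ s', (m.trans h s a x).1 s' = 1 := (m.trans h s a x).2.2
  have htH : ∀ s', transHat D k h s a x s' =
      (∑ k' ∈ F, if (D k').1 h.succ = s' then (1 : ℝ) else 0) / n := fun s' => by
    unfold transHat
    congr 1
    rw [Finset.card_filter, hF, Finset.sum_filter]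
    push_cast
    refine Finset.sum_congr rfl fun k' _ => ?_
    by_cases h1 : (D k').1 h.castSucc = s <;> by_cases h2 : (D k').2.1 h = a <;>
      by_cases h3 : (D k').2.2 h = x <;> simp [h1, h2, h3]
  -- Without visits both estimates are 0 by convention, since division by 0 gives 0. The bonuses
  -- still cover the error because the logarithm is at least 1.
  rcases Nat.eq_zero_or_pos n with h0 | hpos
  · have hr0 : rewHat D R k h s a x = 0 := by
      unfold rewHat; rw [← hn, h0]; simp
    have ht0 : ∀ s', transHat D k h s a x s' = 0 := fun s' => by rw [htH, h0]; simp
    have hs1 : 1 ≤ Real.sqrt ι := Real.one_le_sqrt.2 hι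
    have hs2 : 1 ≤ Real.sqrt (4 * Fintype.card S * ι) := Real.one_le_sqrt.2 (by nlinarith)
    constructor
    · rw [hr0, zero_sub, abs_neg, abs_of_nonneg hq.1, bonusRew, h0]
      refine le_min ?_ hq.2
      simpa using hq.2.trans hs1
    · simp only [ht0, zero_sub, abs_neg, abs_of_nonneg (hP0 _), hP1, mul_one, bonusTrans, h0]
      refine le_min ?_ ?_
      · simpa using le_mul_of_one_le_right (Nat.cast_nonneg H) hs2
      · linarith [(Nat.cast_nonneg H : (0 : ℝ) ≤ H)]
  · have hpos' : (0 : ℝ) < n := by exact_mod_cast hpos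
    have hmax : max (n : ℝ) 1 = n := max_eq_left (by exact_mod_cast hpos)
    constructor
    · have h1 := hrew h s a x hpos
      rw [Finset.sum_sub_distrib, Finset.sum_const, nsmul_eq_mul, ← hF, hFn] at h1
      have h2 : 0 ≤ rewHat D R k h s a x := div_nonneg
        (Finset.sum_nonneg fun k' hk' => (hR k' (Finset.mem_filter.1 hk').1 h).1) hpos'.le
      have h3 : rewHat D R k h s a x ≤ 1 := by
        unfold rewHat
        rw [← hn, div_le_one hpos']
        refine (Finset.sum_le_card_nsmul _ _ 1
          fun k' hk' => (hR k' (Finset.mem_filter.1 hk').1 h).2).trans ?_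
        rw [← hF, hFn, nsmul_eq_mul, mul_one]
      unfold bonusRew
      rw [hmax]
      refine le_min (abs_div_sub_le hpos h1) (abs_le.2 ⟨?_, ?_⟩) <;> linarith [hq.1, hq.2]
    · have hB : ∀ B : Finset S, |∑ s' ∈ B, (transHat D k h s a x s' - (m.trans h s a x).1 s')| ≤
          Real.sqrt (Fintype.card S * ι / n) := fun B => by
        have h1 := htr h s a x B hpos
        rw [Finset.sum_sub_distrib, Finset.sum_const, nsmul_eq_mul, ← hF, hFn] at h1
        have h2 := abs_div_sub_le hpos h1
        rw [Finset.sum_sub_distrib]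
        simp only [htH]
        rw [← Finset.sum_div, Finset.sum_comm]
        simpa using h2
      have h1 := sum_abs_sub_le_of_forall_finset hB
      have hT1 : ∑ s', transHat D k h s a x s' = 1 := by
        simp only [htH]
        rw [← Finset.sum_div, Finset.sum_comm]
        simp [hFn, hpos'.ne']
      have hT0 : ∀ s', 0 ≤ transHat D k h s a x s' := fun s' => by unfold transHat; positivity
      have h2 : ∑ s', |transHat D k h s a x s' - (m.trans h s a x).1 s'| ≤ 2 := by
        calc _ ≤ ∑ s', (transHat D k h s a x s' + (m.trans h s a x).1 s') :=
              Finset.sum_le_sum fun s' _ => abs_le.2 ⟨by linarith [hT0 s', hP0 s'],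
                by linarith [hT0 s', hP0 s']⟩
          _ = 2 := by rw [Finset.sum_add_distrib, hT1, hP1]; norm_num
      unfold bonusTrans
      rw [hmax]
      have hH0 : (0 : ℝ) ≤ H := Nat.cast_nonneg H
      refine le_min (mul_le_mul_of_nonneg_left (h1.trans (le_of_eq ?_)) hH0)
        ((mul_le_mul_of_nonneg_left h2 hH0).trans (le_of_eq (mul_comm _ _)))
      rw [show 4 * (Fintype.card S : ℝ) * ι / n = 2 ^ 2 * (Fintype.card S * ι / n) by ring,
        Real.sqrt_mul (by norm_num), Real.sqrt_sq (by norm_num)]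

namespace IsRun

variable {m : Model S A M H} {b : Feat S A M H} {lam L δ : ℝ} {K : ℕ} {Ω : Type*}
  [mΩ : MeasurableSpace Ω] {μ : Measure Ω} [IsProbabilityMeasure μ] {ℱ : Filtration ℕ mΩ}
  {init : ℕ → Ω → S} {fbar : ℕ → Ω → Feat S A M H} {pol : ℕ → Ω → Hist S A M → S → A}
  {D : ℕ → Ω → Traj S A M H} {R : ℕ → Fin H → Ω → ℝ}

lemma measurableSet_traj (hr : m.IsRun b lam L δ K μ ℱ init fbar pol D R) {k : ℕ}
    (hk : k ∈ Finset.Icc 1 K) (p : Traj S A M H → Prop) : MeasurableSet[ℱ k] {ω | p (D k ω)} := by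
  classical
  have : {ω | p (D k ω)} = ⋃ e ∈ Finset.univ.filter p, {ω | D k ω = e} := by
    ext ω; simp
  rw [this]
  exact Finset.measurableSet_biUnion _ fun e _ => hr.traj_adapted k hk e

/-- Only the conditional mean of a reward is given, not its law. Convexity replaces the exponential
on `[0,1]` by its chord, which is affine in the reward, and reduces the claim to the Bernoulli case.
-/
lemma integral_mul_exp_rew_le (hr : m.IsRun b lam L δ K μ ℱ init fbar pol D R) {k : ℕ}
    (hk : k ∈ Finset.Icc 1 K) (h : Fin H) (s : S) (a : A) (x : Fin (M + 1)) (t : ℝ) {U : Ω → ℝ}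
    (hU : Measurable[ℱ (k - 1)] U) (hU0 : ∀ ω, 0 ≤ U ω) {C : ℝ} (hC : ∀ ω, U ω ≤ C) :
    ∫ ω, U ω * (if (D k ω).1 h.castSucc = s ∧ (D k ω).2.1 h = a ∧ (D k ω).2.2 h = x
        then Real.exp (t * (R k h ω - m.rew h s a x) - t ^ 2 / 8) else 1) ∂μ ≤ ∫ ω, U ω ∂μ := by
  set q := m.rew h s a x with hq
  set c := Real.exp (-(t * q + t ^ 2 / 8)) with hc
  have hc0 : 0 < c := Real.exp_pos _
  set V : Ω → ℝ := fun ω => if (D k ω).1 h.castSucc = s ∧ (D k ω).2.1 h = a ∧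
    (D k ω).2.2 h = x then U ω else 0 with hV
  have hUi : Integrable U μ := Integrable.of_bound (hU.mono (ℱ.le _) le_rfl).aestronglyMeasurable C
    (Filter.Eventually.of_forall fun ω => by rw [Real.norm_of_nonneg (hU0 ω)]; exact hC ω)
  have hJ : MeasurableSet {ω | (D k ω).1 h.castSucc = s ∧ (D k ω).2.1 h = a ∧
      (D k ω).2.2 h = x} := ℱ.le _ _ (hr.measurableSet_traj hk
        fun e => e.1 h.castSucc = s ∧ e.2.1 h = a ∧ e.2.2 h = x)
  have hVm : Measurable V := Measurable.ite hJ (hU.mono (ℱ.le _) le_rfl) measurable_const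
  have hV0 : ∀ ω, 0 ≤ V ω := fun ω => by
    simp only [hV]; split_ifs
    · exact hU0 ω
    · exact le_rfl
  have hVC : ∀ ω, V ω ≤ C := fun ω => by
    simp only [hV]; split_ifs
    · exact hC ω
    · exact (hU0 ω).trans (hC ω)
  have hVi : Integrable V μ := Integrable.of_bound hVm.aestronglyMeasurable C
    (Filter.Eventually.of_forall fun ω => by rw [Real.norm_of_nonneg (hV0 ω)]; exact hVC ω)
  have hVR : Integrable (fun ω => V ω * R k h ω) μ := hVi.mul_bdd (c := 1)
    ((hr.rew_adapted k hk h).mono (ℱ.le _) le_rfl).aestronglyMeasurable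
    (Filter.Eventually.of_forall fun ω => by
      have := hr.rew_mem k hk h ω
      rw [Real.norm_of_nonneg this.1]; exact this.2)
  have hmean := hr.integral_mul_rew hk h s a x hU (C := C) fun ω => by
    rw [abs_of_nonneg (hU0 ω)]; exact hC ω
  have hpt : ∀ ω, U ω * (if (D k ω).1 h.castSucc = s ∧ (D k ω).2.1 h = a ∧ (D k ω).2.2 h = x
        then Real.exp (t * (R k h ω - q) - t ^ 2 / 8) else 1) ≤
      U ω + ((c - 1) * V ω + c * (Real.exp t - 1) * (V ω * R k h ω)) := fun ω => by
    simp only [hV]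
    split_ifs with hcell
    · have hR := hr.rew_mem k hk h ω
      have hconv : Real.exp (t * R k h ω) ≤ 1 - R k h ω + R k h ω * Real.exp t := by
        have := convexOn_exp.2 (Set.mem_univ 0) (Set.mem_univ t)
          (by linarith [hR.2] : 0 ≤ 1 - R k h ω) hR.1 (by ring)
        simpa [mul_comm] using this
      have hexp : Real.exp (t * (R k h ω - q) - t ^ 2 / 8) = c * Real.exp (t * R k h ω) := by
        rw [hc, ← Real.exp_add]; ring_nf
      rw [hexp]
      have := mul_le_mul_of_nonneg_left (mul_le_mul_of_nonneg_left hconv hc0.le) (hU0 ω)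
      linarith
    · simp
  have hVs : Integrable (fun ω => (c - 1) * V ω + c * (Real.exp t - 1) * (V ω * R k h ω)) μ :=
    (hVi.const_mul _).add (hVR.const_mul _)
  have hrhs : Integrable (fun ω => U ω + ((c - 1) * V ω +
      c * (Real.exp t - 1) * (V ω * R k h ω))) μ := hUi.add hVs
  calc _ ≤ ∫ ω, (U ω + ((c - 1) * V ω + c * (Real.exp t - 1) * (V ω * R k h ω))) ∂μ := by
        refine integral_mono_of_nonneg (Filter.Eventually.of_forall fun ω => ?_) hrhs
          (Filter.Eventually.of_forall hpt)
        exact mul_nonneg (hU0 ω) (by split_ifs <;> positivity)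
    _ = ∫ ω, U ω ∂μ + (c * (1 - q + q * Real.exp t) - 1) * ∫ ω, V ω ∂μ := by
        rw [integral_add hUi hVs,
          integral_add (hVi.const_mul _) (hVR.const_mul _), integral_const_mul,
          integral_const_mul, hmean]
        ring
    _ ≤ _ := by
        have h1 : c * (1 - q + q * Real.exp t) ≤ 1 := by
          calc _ ≤ c * Real.exp (t * q + t ^ 2 / 8) :=
                mul_le_mul_of_nonneg_left (one_sub_add_mul_exp_le (m.rew_mem h s a x) t) hc0.le
            _ = 1 := by rw [hc, ← Real.exp_add, neg_add_cancel, Real.exp_zero]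
        have h2 : 0 ≤ ∫ ω, V ω ∂μ := integral_nonneg hV0
        nlinarith

end IsRun

lemma sum_trans_mem (m : Model S A M H) (h : Fin H) (s : S) (a : A) (x : Fin (M + 1))
    (B : Finset S) : ∑ s' ∈ B, (m.trans h s a x).1 s' ∈ Set.Icc (0 : ℝ) 1 := by
  refine ⟨Finset.sum_nonneg fun s' _ => (m.trans h s a x).2.1 s', ?_⟩
  rw [← (m.trans h s a x).2.2]
  exact Finset.sum_le_univ_sum_of_nonneg (m.trans h s a x).2.1

/-- Hoeffding's lemma for the next state of a cell. -/
lemma sum_trajProb_mul_exp_trans_le (m : Model S A M H) (π : Policy S A M) (s₁ : S) (h : Fin H)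
    (s : S) (a : A) (x : Fin (M + 1)) (B : Finset S) (t : ℝ) :
    ∑ e : Traj S A M H, m.trajProb π s₁ e *
      (if e.1 h.castSucc = s ∧ e.2.1 h = a ∧ e.2.2 h = x then
        Real.exp (t * ((if e.1 h.succ ∈ B then 1 else 0) - ∑ s' ∈ B, (m.trans h s a x).1 s') -
          t ^ 2 / 8) else 1) ≤ 1 := by
  set q := ∑ s' ∈ B, (m.trans h s a x).1 s' with hq
  -- The weight is 1 except in the given cell at step `h`, so the product over the steps collapses
  -- to a single factor.
  set w : Hist S A M → S → A → Fin (M + 1) → S → ℝ := fun τ s₀ a₀ x₀ s' =>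
    if τ.length = h ∧ s₀ = s ∧ a₀ = a ∧ x₀ = x then
      Real.exp (t * ((if s' ∈ B then 1 else 0) - q) - t ^ 2 / 8) else 1 with hw
  have key := sum_pathProb_mul_prod_le (m.stepProb_nonneg π) w
    (fun τ s₀ a₀ x₀ s' => by simp only [hw]; split_ifs <;> positivity) s₁ H (fun τ s₀ hτ => by
      rw [← m.sum_stepProb π hτ s₀]
      refine Finset.sum_le_sum fun a₀ _ => Finset.sum_le_sum fun x₀ _ => ?_
      simp only [hw]
      by_cases hc : τ.length = h ∧ s₀ = s ∧ a₀ = a ∧ x₀ = x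
      · simp only [if_pos hc]
        obtain ⟨hl, rfl, rfl, rfl⟩ := hc
        have hh : (⟨τ.length, hτ⟩ : Fin H) = h := Fin.ext hl
        simp only [stepProb, atLen_of_lt _ hτ, hh, mul_assoc]
        simp only [← Finset.mul_sum]
        refine mul_le_mul_of_nonneg_left (mul_le_mul_of_nonneg_left ?_ (m.ctxProb_pos _ _ _).le)
          ((π τ s₀).2.1 a₀)
        have hP1 : ∑ s', (m.trans h s₀ a₀ x₀).1 s' = 1 := (m.trans h s₀ a₀ x₀).2.2
        rw [hP1]
        have hexp : ∀ s' : S, Real.exp (t * ((if s' ∈ B then 1 else 0) - q) - t ^ 2 / 8) =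
            Real.exp (-(t * q + t ^ 2 / 8)) * (1 + (if s' ∈ B then 1 else 0) * (Real.exp t - 1)) :=
          fun s' => by
          split_ifs
          · rw [one_mul, add_sub_cancel, ← Real.exp_add]; ring_nf
          · rw [zero_mul, add_zero, mul_one]; ring_nf
        have hsum : ∑ s', (m.trans h s₀ a₀ x₀).1 s' *
            Real.exp (t * ((if s' ∈ B then 1 else 0) - q) - t ^ 2 / 8) =
            Real.exp (-(t * q + t ^ 2 / 8)) * (1 - q + q * Real.exp t) := by
          have h1 : ∑ s', (m.trans h s₀ a₀ x₀).1 s' * (if s' ∈ B then 1 else 0) = q := by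
            simp [hq]
          calc _ = Real.exp (-(t * q + t ^ 2 / 8)) * (∑ s', (m.trans h s₀ a₀ x₀).1 s' +
                (∑ s', (m.trans h s₀ a₀ x₀).1 s' * (if s' ∈ B then 1 else 0)) *
                  (Real.exp t - 1)) := by
                rw [Finset.sum_mul, ← Finset.sum_add_distrib, Finset.mul_sum]
                refine Finset.sum_congr rfl fun s' _ => ?_
                rw [hexp]; ring
            _ = _ := by rw [hP1, h1]; ring
        rw [hsum]
        calc _ ≤ Real.exp (-(t * q + t ^ 2 / 8)) * Real.exp (t * q + t ^ 2 / 8) :=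
              mul_le_mul_of_nonneg_left (one_sub_add_mul_exp_le (m.sum_trans_mem _ _ _ _ _) t)
                (Real.exp_pos _).le
          _ = 1 := by rw [← Real.exp_add, neg_add_cancel, Real.exp_zero]
      · simp only [if_neg hc, mul_one]; exact le_rfl)
  refine le_trans (le_of_eq (Finset.sum_congr rfl fun e _ => ?_)) key
  rw [trajProb_eq]
  congr 1
  rw [Finset.prod_eq_single h]
  · simp [hw, Traj.length_hist]
  · intro h' _ hne
    have : (h' : ℕ) ≠ h := fun hc => hne (Fin.ext hc)
    simp [hw, Traj.length_hist, this]
  · simp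

/-- With `u = exp (-ι)` for the bonus logarithm `ι`, the `2 ^ S` sets cost `(2u²)^S ≤ 2u²`, so they
are no worse than a constant number of reward bounds. One factor `u` pays for all cells and
episodes, the other is at most 1/8. -/
lemma card_mul_exp_bonusLog_le {K : ℕ} {δ : ℝ} (hS : 0 < Fintype.card S) (hA : 0 < Fintype.card A)
    (hM : 1 ≤ M) (hH : 1 ≤ H) (hK : 1 ≤ K) (hδ : 0 < δ) (hδ1 : δ < 1) :
    1 ≤ bonusLog S A M H K δ ∧
      (H * (Fintype.card S * (Fintype.card A * (M + 1))) : ℝ) *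
        (2 * K * Real.exp (-(2 * bonusLog S A M H K δ)) + 2 ^ Fintype.card S *
          (2 * K * Real.exp (-(2 * (Fintype.card S * bonusLog S A M H K δ))))) ≤ δ / 4 := by
  set s : ℝ := (Fintype.card S : ℝ) with hs
  set a : ℝ := (Fintype.card A : ℝ) with ha
  set ι := bonusLog S A M H K δ with hι
  have hs1 : (1 : ℝ) ≤ s := by rw [hs]; exact_mod_cast hS
  have ha1 : (1 : ℝ) ≤ a := by rw [ha]; exact_mod_cast hA
  have hM1 : (1 : ℝ) ≤ M := by exact_mod_cast hM
  have hH1 : (1 : ℝ) ≤ H := by exact_mod_cast hH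
  have hK1 : (1 : ℝ) ≤ K := by exact_mod_cast hK
  set P : ℝ := s * a * M * H * K with hP
  have hP1 : 1 ≤ P := by
    rw [hP]
    exact one_le_mul_of_one_le_of_one_le (one_le_mul_of_one_le_of_one_le
      (one_le_mul_of_one_le_of_one_le (one_le_mul_of_one_le_of_one_le hs1 ha1) hM1) hH1) hK1
  have hx : 8 * s * a * M * H * K / δ = 8 * P / δ := by rw [hP]; ring
  have hx8 : 8 ≤ 8 * P / δ := by rw [le_div_iff₀ hδ]; nlinarith
  have hιe : ι = Real.log (8 * P / δ) := by rw [hι, bonusLog, hx]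
  have hι1 : 1 ≤ ι := by
    rw [hιe, Real.le_log_iff_exp_le (by linarith)]
    exact exp_one_le_three.trans (by linarith)
  refine ⟨hι1, ?_⟩
  set u := δ / (8 * P) with hu
  have hu0 : 0 < u := by positivity
  have hexp : Real.exp (-ι) = u := by
    rw [hιe, ← Real.log_inv, Real.exp_log (by positivity), inv_div]
  have hu8 : u ≤ 1 / 8 := by rw [hu, div_le_iff₀ (by positivity)]; nlinarith
  have h1 : Real.exp (-(2 * ι)) = u ^ 2 := by
    rw [← hexp, ← Real.exp_nat_mul]; congr 1; push_cast; ring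
  have h2 : 2 ^ Fintype.card S * Real.exp (-(2 * (s * ι))) ≤ 2 * u ^ 2 := by
    have : Real.exp (-(2 * (s * ι))) = (u ^ 2) ^ Fintype.card S := by
      rw [← h1, ← Real.exp_nat_mul, ← hs]; ring_nf
    rw [this, ← mul_pow]
    refine pow_le_of_le_one (by positivity) (by nlinarith) hS.ne'
  have h3 : 2 * K * Real.exp (-(2 * ι)) + 2 ^ Fintype.card S *
      (2 * K * Real.exp (-(2 * (s * ι)))) ≤ 6 * K * u ^ 2 := by
    rw [h1]
    have := mul_le_mul_of_nonneg_left h2 (by positivity : (0 : ℝ) ≤ 2 * K)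
    linarith
  calc _ ≤ (H * (s * (a * (2 * M)))) * (6 * K * u ^ 2) := by
        gcongr
        linarith
    _ = 12 * u * (P * u) := by rw [hP]; ring
    _ = 12 * u * (δ / 8) := by congr 1; rw [hu]; field_simp
    _ ≤ 12 * (1 / 8) * (δ / 8) := by gcongr
    _ ≤ δ / 4 := by linarith

namespace IsRun

variable {m : Model S A M H} {b : Feat S A M H} {lam L δ : ℝ} {K : ℕ} {Ω : Type*}
  [mΩ : MeasurableSpace Ω] {μ : Measure Ω} [IsProbabilityMeasure μ] {ℱ : Filtration ℕ mΩ}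
  {init : ℕ → Ω → S} {fbar : ℕ → Ω → Feat S A M H} {pol : ℕ → Ω → Hist S A M → S → A}
  {D : ℕ → Ω → Traj S A M H} {R : ℕ → Fin H → Ω → ℝ}

/-- With high probability the estimates are within their bonuses in all episodes. -/
lemma measureReal_not_estimatesValid_le (hr : m.IsRun b lam L δ K μ ℱ init fbar pol D R)
    (hM : 1 ≤ M) (hH : 1 ≤ H) (hK : 1 ≤ K) (hδ : 0 < δ) (hδ1 : δ < 1) :
    μ.real {ω | ¬ ∀ k ∈ Finset.Icc 1 K, m.EstimatesValid (fun k' => D k' ω)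
      (fun k' h => R k' h ω) K δ k} ≤ δ / 4 := by
  have hS : 0 < Fintype.card S := Fintype.card_pos_iff.2 ⟨m.start.1⟩
  have hA : 0 < Fintype.card A := Fintype.card_pos_iff.2 ⟨m.start.2.1⟩
  obtain ⟨hι1, hprob⟩ := card_mul_exp_bonusLog_le (S := S) (A := A) hS hA hM hH hK hδ hδ1
  set ι := bonusLog S A M H K δ with hι
  set J : Fin H × S × A × Fin (M + 1) → ℕ → Ω → Prop := fun c k ω =>
    (D k ω).1 c.1.castSucc = c.2.1 ∧ (D k ω).2.1 c.1 = c.2.2.1 ∧ (D k ω).2.2 c.1 = c.2.2.2 with hJ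
  have hJm : ∀ c, ∀ k ∈ Finset.Icc 1 K, MeasurableSet[ℱ k] {ω | J c k ω} := fun c k hk =>
    hr.measurableSet_traj hk fun e =>
      e.1 c.1.castSucc = c.2.1 ∧ e.2.1 c.1 = c.2.2.1 ∧ e.2.2 c.1 = c.2.2.2
  let _ : ∀ c k ω, Decidable (J c k ω) := fun c k ω => inferInstanceAs (Decidable (_ ∧ _ ∧ _))
  set Er : Fin H × S × A × Fin (M + 1) → Set Ω := fun c =>
    {ω | ∃ k ∈ Finset.Icc 1 K, 0 < ((Finset.Ico 1 k).filter fun k' => J c k' ω).card ∧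
      Real.sqrt (ι * ((Finset.Ico 1 k).filter fun k' => J c k' ω).card) <
        |∑ k' ∈ (Finset.Ico 1 k).filter fun k' => J c k' ω,
          (R k' c.1 ω - m.rew c.1 c.2.1 c.2.2.1 c.2.2.2)|} with hEr
  set Y : Fin H → Finset S → ℕ → Ω → ℝ := fun h B k ω =>
    if (D k ω).1 h.succ ∈ B then 1 else 0 with hY
  set Et : Fin H × S × A × Fin (M + 1) → Finset S → Set Ω := fun c B =>
    {ω | ∃ k ∈ Finset.Icc 1 K, 0 < ((Finset.Ico 1 k).filter fun k' => J c k' ω).card ∧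
      Real.sqrt (Fintype.card S * ι * ((Finset.Ico 1 k).filter fun k' => J c k' ω).card) <
        |∑ k' ∈ (Finset.Ico 1 k).filter fun k' => J c k' ω,
          (Y c.1 B k' ω - ∑ s' ∈ B, (m.trans c.1 c.2.1 c.2.2.1 c.2.2.2).1 s')|} with hEt
  have hEr_le : ∀ c, μ.real (Er c) ≤ 2 * K * Real.exp (-(2 * ι)) := fun c =>
    measureReal_lt_abs_sum_le (ℱ := ℱ) (hJm c) (fun k hk => hr.rew_adapted k hk c.1)
      (fun k hk => hr.rew_mem k hk c.1) (m.rew_mem _ _ _ _)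
      (fun t k hk U hU hU0 ⟨C, hC⟩ => by
        convert hr.integral_mul_exp_rew_le hk c.1 c.2.1 c.2.2.1 c.2.2.2 t hU hU0 hC)
      (by linarith)
  have hEt_le : ∀ c B, μ.real (Et c B) ≤ 2 * K * Real.exp (-(2 * (Fintype.card S * ι))) :=
    fun c B => by
    refine measureReal_lt_abs_sum_le (ℱ := ℱ) (hJm c) (fun k hk => ?_) (fun k hk ω => ?_)
      (m.sum_trans_mem _ _ _ _ _) (fun t k hk U hU hU0 ⟨C, hC⟩ => ?_) (by positivity)
    · exact Measurable.ite (hr.measurableSet_traj hk fun e => e.1 c.1.succ ∈ B)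
        measurable_const measurable_const
    · simp only [hY]; split_ifs <;> simp
    · set q := ∑ s' ∈ B, (m.trans c.1 c.2.1 c.2.2.1 c.2.2.2).1 s' with hq
      set w : Traj S A M H → ℝ := fun e =>
        if e.1 c.1.castSucc = c.2.1 ∧ e.2.1 c.1 = c.2.2.1 ∧ e.2.2 c.1 = c.2.2.2 then
          Real.exp (t * ((if e.1 c.1.succ ∈ B then 1 else 0) - q) - t ^ 2 / 8) else 1 with hw
      have hw0 : ∀ e, 0 ≤ w e := fun e => by simp only [hw]; split_ifs <;> positivity
      have hUi : Integrable U μ := Integrable.of_bound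
        (hU.mono (ℱ.le _) le_rfl).aestronglyMeasurable C
        (Filter.Eventually.of_forall fun ω => by rw [Real.norm_of_nonneg (hU0 ω)]; exact hC ω)
      have h1 := hr.setIntegral_apply_traj_le hk (W := fun ω e => U ω * w e)
        (fun e => hU.mul_const _) (C := C * ∑ e, w e) (fun ω e => by
          rw [abs_of_nonneg (mul_nonneg (hU0 ω) (hw0 e))]
          exact mul_le_mul (hC ω) (Finset.single_le_sum (fun e _ => hw0 e) (Finset.mem_univ e))
            (hw0 e) ((hU0 ω).trans (hC ω)))
        hUi (fun ω => by
          have h2 := m.sum_trajProb_mul_exp_trans_le (detPolicy (pol k ω)) (init k ω) c.1 c.2.1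
            c.2.2.1 c.2.2.2 B t
          have h3 := mul_le_mul_of_nonneg_left h2 (hU0 ω)
          rw [mul_one, Finset.mul_sum] at h3
          refine le_trans (le_of_eq (Finset.sum_congr rfl fun e _ => ?_)) h3
          simp only [hw, hq]
          ring) MeasurableSet.univ
      rw [Measure.restrict_univ] at h1
      convert h1
  have hsub : {ω | ¬ ∀ k ∈ Finset.Icc 1 K, m.EstimatesValid (fun k' => D k' ω)
      (fun k' h => R k' h ω) K δ k} ⊆
      ⋃ c ∈ (Finset.univ : Finset (Fin H × S × A × Fin (M + 1))),
        (Er c ∪ ⋃ B ∈ (Finset.univ : Finset (Finset S)), Et c B) := by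
    intro ω hω
    by_contra hcon
    refine hω fun k hk => ?_
    simp only [Set.mem_iUnion, Set.mem_union, not_exists, not_or] at hcon
    refine m.estimatesValid_of_sums hι1 (fun k' hk' h => ?_) (fun h s a x hv => ?_)
      (fun h s a x B hv => ?_)
    · rw [Finset.mem_Icc] at hk
      rw [Finset.mem_Ico] at hk'
      exact hr.rew_mem k' (Finset.mem_Icc.2 ⟨hk'.1, by omega⟩) h ω
    · by_contra hlt
      refine (hcon (h, s, a, x) (Finset.mem_univ _)).1 ⟨k, hk, hv, not_le.1 hlt⟩
    · by_contra hlt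
      refine (hcon (h, s, a, x) (Finset.mem_univ _)).2 B (Finset.mem_univ _) ⟨k, hk, hv, not_le.1 hlt⟩
  refine (measureReal_mono hsub (measure_ne_top _ _)).trans ?_
  refine (measureReal_biUnion_finset_le _ _).trans (le_trans ?_ hprob)
  calc _ ≤ ∑ _c : Fin H × S × A × Fin (M + 1), (2 * K * Real.exp (-(2 * ι)) +
        ∑ _B : Finset S, 2 * K * Real.exp (-(2 * (Fintype.card S * ι)))) := by
        refine Finset.sum_le_sum fun c _ => (measureReal_union_le _ _).trans
          (add_le_add (hEr_le c) ((measureReal_biUnion_finset_le _ _).trans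
            (Finset.sum_le_sum fun B _ => hEt_le c B)))
    _ = _ := by
        simp only [Finset.sum_const, Finset.card_univ, Fintype.card_finset, nsmul_eq_mul,
          Fintype.card_prod, Fintype.card_fin]
        push_cast
        ring

end IsRun

end Model

end Estimates

/-! ### Self-normalised bound for the noise -/

section Noise

open MeasureTheory ProbabilityTheory

variable {S A : Type*} [Fintype S] [Fintype A] [DecidableEq S] [DecidableEq A] {M H : ℕ}

namespace Model

/-! ### Exponential weights of the context noise. -/

section Weights

variable (m : Model S A M H)

/-- The exponent of the weight that a history and the next context put on the direction `ξ`. -/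
def ctxExponent (ξ : Feat S A M H) (τ : Hist S A M) (x : Fin (M + 1)) : ℝ :=
  m.logits ξ τ x - gmean (m.logits m.feat τ) (m.logits ξ τ) -
    3 / 4 * gvar (m.logits m.feat τ) (m.logits ξ τ)

/-- The weight that an episode puts on the direction `ξ`. -/
def epWeight (ξ : Feat S A M H) (e : Traj S A M H) : ℝ :=
  ∏ h : Fin H, Real.exp (m.ctxExponent ξ (Traj.hist e h) (e.2.2 h))

lemma epWeight_pos (ξ : Feat S A M H) (e : Traj S A M H) : 0 < m.epWeight ξ e :=
  Finset.prod_pos fun _ _ => Real.exp_pos _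

lemma continuous_logits (τ : Hist S A M) (x : Fin (M + 1)) :
    Continuous fun ξ : Feat S A M H => m.logits ξ τ x := by
  refine LinearMap.continuous_of_finiteDimensional
    ({ toFun := fun ξ => m.logits ξ τ x
       map_add' := fun f g => by rw [logits_add]; rfl
       map_smul' := fun c f => by rw [logits_smul]; rfl } : Feat S A M H →ₗ[ℝ] ℝ)

lemma continuous_epWeight (e : Traj S A M H) : Continuous fun ξ : Feat S A M H =>
    m.epWeight ξ e := by
  refine continuous_finsetProd _ fun h _ => Real.continuous_exp.comp ?_
  unfold ctxExponent gvar gmean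
  have h1 := m.continuous_logits (Traj.hist e h)
  fun_prop

/-- Radius 2/3 is admissible because `2 · 4/9 ≤ 1` and visitation vectors have norm at most one. A
range of 1 is what the quadratic bound for the exponential needs. -/
lemma logits_sub_le_one (hη : m.η ≤ 1 / Real.sqrt (effHorizon m.α H)) {ξ : Feat S A M H}
    (hξ : ξ ⬝ᵥ ξ ≤ 4 / 9) {τ : Hist S A M} (hτ : τ.length < H) (x y : Fin (M + 1)) :
    m.logits ξ τ x - m.logits ξ τ y ≤ 1 := by
  have hξ' : ∑ p, ξ p ^ 2 ≤ 4 / 9 := by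
    simpa only [dotProduct, ← sq] using hξ
  refine (extZero_sub_le _ x y).trans (Real.sqrt_le_one.2 ?_)
  have h1 := sum_blockDot_sq_le ξ (m.visit τ)
  have h2 := m.sum_visit_sq_le hη τ hτ
  have h3 : (∑ p, ξ p ^ 2) * ∑ p, m.visit τ p ^ 2 ≤ 4 / 9 * 1 :=
    mul_le_mul hξ' h2 (Finset.sum_nonneg fun _ _ => sq_nonneg _) (by norm_num)
  linarith

/-- A crude bound, used only for integrability. -/
lemma epWeight_le (hη : m.η ≤ 1 / Real.sqrt (effHorizon m.α H)) {ξ : Feat S A M H}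
    (hξ : ξ ⬝ᵥ ξ ≤ 4 / 9) (e : Traj S A M H) : m.epWeight ξ e ≤ Real.exp 1 ^ H := by
  refine (Finset.prod_le_prod (fun _ _ => (Real.exp_pos _).le) fun h _ =>
    Real.exp_le_exp.2 (?_ : _ ≤ (1 : ℝ))).trans ?_
  · have h1 := abs_sub_gmean_le (m.logits m.feat (Traj.hist e h)) (m.logits ξ (Traj.hist e h))
      (fun x y => m.logits_sub_le_one hη hξ (by rw [Traj.length_hist]; exact h.2) x y) (e.2.2 h)
    have h2 := gvar_nonneg (m.logits m.feat (Traj.hist e h)) (m.logits ξ (Traj.hist e h))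
    have h3 := (abs_le.1 h1).2
    unfold ctxExponent
    linarith
  · simp

/-- Given history, state and action, the context has the Gibbs law of the true logits, so each
step's factor has mean at most one. The next state does not enter the weight. -/
lemma sum_trajProb_mul_epWeight_le (hη : m.η ≤ 1 / Real.sqrt (effHorizon m.α H))
    {ξ : Feat S A M H} (hξ : ξ ⬝ᵥ ξ ≤ 4 / 9) (π : Policy S A M) (s₁ : S) :
    ∑ e, m.trajProb π s₁ e * m.epWeight ξ e ≤ 1 := by
  simp_rw [trajProb_eq]
  refine sum_pathProb_mul_prod_le (m.stepProb_nonneg π)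
    (fun τ _ _ x _ => Real.exp (m.ctxExponent ξ τ x)) (fun _ _ _ _ _ => (Real.exp_pos _).le) s₁ H
    fun τ s hτ => ?_
  rw [m.sum_stepProb_mul π hτ s fun _ x _ => Real.exp (m.ctxExponent ξ τ x)]
  have hP1 : ∀ a x, ∑ s', (m.trans ⟨τ.length, hτ⟩ s a x).1 s' = 1 := fun a x =>
    (m.trans ⟨τ.length, hτ⟩ s a x).2.2
  simp only [← Finset.sum_mul, hP1, one_mul]
  have h1 : ∑ a, (π τ s).1 a = 1 := (π τ s).2.2
  rw [h1, one_mul, ctxProb_eq]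
  exact sum_gibbs_mul_exp_le _ _ (m.logits_sub_le_one hη hξ hτ)

lemma gmean_add (u v w : Fin (M + 1) → ℝ) : gmean u (v + w) = gmean u v + gmean u w := by
  simp [gmean, mul_add, Finset.sum_add_distrib]

lemma gmean_smul (u v : Fin (M + 1) → ℝ) (c : ℝ) : gmean u (c • v) = c * gmean u v := by
  simp [gmean, Finset.mul_sum, mul_left_comm]

lemma exists_noise_eq (D : ℕ → Traj S A M H) (k : ℕ) :
    ∃ s : Feat S A M H, ∀ ξ, m.noise D k ξ = ξ ⬝ᵥ s := by
  set F : Feat S A M H →ₗ[ℝ] ℝ :=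
    { toFun := m.noise D k
      map_add' := fun f g => by
        simp only [noise, logits_add, gmean_add, Pi.add_apply, ← Finset.sum_add_distrib]
        refine Finset.sum_congr rfl fun k' _ => Finset.sum_congr rfl fun h _ => ?_
        ring
      map_smul' := fun c f => by
        simp only [noise, logits_smul, gmean_smul, Pi.smul_apply, smul_eq_mul, Finset.mul_sum,
          RingHom.id_apply]
        refine Finset.sum_congr rfl fun k' _ => Finset.sum_congr rfl fun h _ => ?_
        ring }
  refine ⟨fun p => F fun q => if p = q then 1 else 0, fun ξ => ?_⟩
  change F ξ = _
  rw [LinearMap.pi_apply_eq_sum_univ F ξ]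
  rfl

/-- Identifies the supermartingale with the integrand of the mixture: the linear part is the noise
and the compensators add up to the Hessian without ridge. -/
lemma prod_epWeight (D : ℕ → Traj S A M H) (k : ℕ) (ξ : Feat S A M H) :
    ∏ k' ∈ Finset.Ico 1 k, m.epWeight ξ (D k') =
      Real.exp (m.noise D k ξ - 3 / 4 * (ξ ⬝ᵥ (m.hessMat 0 D k m.feat).mulVec ξ)) := by
  simp only [epWeight, ← Real.exp_sum]
  congr 1
  rw [dotProduct_hessMat, noise, zero_mul, zero_add, Finset.mul_sum, ← Finset.sum_sub_distrib]
  refine Finset.sum_congr rfl fun k' _ => ?_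
  rw [Finset.mul_sum, ← Finset.sum_sub_distrib]
  rfl

lemma hessMat_eq_add (l : ℝ) (D : ℕ → Traj S A M H) (k : ℕ) (f : Feat S A M H) :
    m.hessMat l D k f = l • 1 + m.hessMat 0 D k f := by
  simp [hessMat]

lemma hessMat_zero_posSemidef (D : ℕ → Traj S A M H) (k : ℕ) (f : Feat S A M H) :
    (m.hessMat 0 D k f).PosSemidef := by
  refine Matrix.PosSemidef.of_dotProduct_mulVec_nonneg (m.hessMat_isHermitian 0 D k f) fun x => ?_
  rw [star_trivial, dotProduct_hessMat, zero_mul, zero_add]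
  exact Finset.sum_nonneg fun _ _ => Finset.sum_nonneg fun _ _ => gvar_nonneg _ _

lemma trace_softmaxGrad_le (η : ℝ) (u : Fin M → ℝ) : (softmaxGrad η u).trace ≤ 1 := by
  have h0 : ∀ x, 0 ≤ softmax η u x := fun x => by
    rw [softmax_eq_gibbs]; exact (gibbs_pos _ _).le
  have h1 : ∑ x, softmax η u x = 1 := by
    rw [softmax_eq_gibbs]; exact sum_gibbs _
  rw [Fin.sum_univ_castSucc] at h1
  rw [softmaxGrad, Matrix.trace_sub, Matrix.trace_diagonal, Matrix.trace_vecMulVec]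
  have h2 : 0 ≤ (fun i : Fin M => softmax η u i.castSucc) ⬝ᵥ
      (fun i : Fin M => softmax η u i.castSucc) :=
    Finset.sum_nonneg fun i _ => mul_self_nonneg _
  linarith [h0 (Fin.last M)]

lemma trace_hessMat_le (hη : m.η ≤ 1 / Real.sqrt (effHorizon m.α H)) (l : ℝ)
    (D : ℕ → Traj S A M H) (k : ℕ) (f : Feat S A M H) :
    (m.hessMat l D k f).trace ≤ l * Fintype.card (Fin M × Idx S A M H) + k * H := by
  rw [hessMat, Matrix.trace_add, Matrix.trace_smul, Matrix.trace_one, smul_eq_mul,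
    Matrix.trace_sum]
  refine add_le_add le_rfl ?_
  calc _ ≤ ∑ k' ∈ Finset.Ico 1 k, (H : ℝ) := by
        refine Finset.sum_le_sum fun k' _ => ?_
        rw [Matrix.trace_sum]
        calc _ ≤ ∑ h : Fin H, (1 : ℝ) := by
              refine Finset.sum_le_sum fun h _ => ?_
              rw [Matrix.trace_kronecker, Matrix.trace_vecMulVec]
              have h1 := m.sum_visit_sq_le hη (Traj.hist (D k') h)
                (by rw [Traj.length_hist]; exact h.2)
              have h2 : m.visit (Traj.hist (D k') h) ⬝ᵥ m.visit (Traj.hist (D k') h) =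
                  ∑ p, m.visit (Traj.hist (D k') h) p ^ 2 := by simp only [dotProduct, sq]
              rw [h2]
              have h3 := trace_softmaxGrad_le m.η (m.suff f (Traj.hist (D k') h))
              have h4 : 0 ≤ ∑ p, m.visit (Traj.hist (D k') h) p ^ 2 :=
                Finset.sum_nonneg fun _ _ => sq_nonneg _
              nlinarith
          _ = H := by simp
    _ ≤ k * H := by
        rw [Finset.sum_const, Nat.card_Ico, nsmul_eq_mul]
        refine mul_le_mul_of_nonneg_right ?_ (Nat.cast_nonneg _)
        exact_mod_cast Nat.sub_le _ _

end Weights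

/-- The radius of the self-normalised noise bound, in dimension `d`. -/
def noiseRadius (d : ℝ) (H : ℕ) (l r δ : ℝ) (k : ℕ) : ℝ :=
  5 / 8 * (Real.sqrt l * r) + 4 / (3 * (Real.sqrt l * r)) *
    (Real.log (1 / δ) + d * Real.log 4 + d / 2 * Real.log (1 + k * H / (d * l)))

/-- The deterministic half of the self-normalised bound. Each observation adds at most 1 to the
trace of the Hessian, which bounds the determinant left by the mixture argument. -/
lemma noiseBound_of_mixture (m : Model S A M H) (hM : 1 ≤ M) (hH : 1 ≤ H)
    (hη : m.η ≤ 1 / Real.sqrt (effHorizon m.α H))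
    {D : ℕ → Traj S A M H} {k : ℕ} {l r δ : ℝ} (hl : 0 < l) (hr : 0 < r) (hδ : 0 < δ)
    (hint : ∫ ξ in {y : Feat S A M H | y ⬝ᵥ y ≤ r ^ 2}, ∏ k' ∈ Finset.Ico 1 k, m.epWeight ξ (D k') ≤
      1 / δ * volume.real {y : Feat S A M H | y ⬝ᵥ y ≤ r ^ 2}) :
    m.NoiseBound D k l (noiseRadius (Fintype.card (Fin M × Idx S A M H)) H l r δ k) := by
  have hne : Nonempty (Fin M × Idx S A M H) := ⟨(⟨0, hM⟩, ⟨0, hH⟩, m.start)⟩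
  obtain ⟨s, hs⟩ := m.exists_noise_eq D k
  intro g
  simp_rw [prod_epWeight, hs] at hint
  have h1 := dotProduct_le_of_mixture (m.hessMat_zero_posSemidef D k m.feat) hl hr s
    (by positivity : 0 < 1 / δ) hint g
  rw [hs, hessMat_eq_add]
  refine h1.trans (mul_le_mul_of_nonneg_right ?_ (Real.sqrt_nonneg _))
  unfold noiseRadius
  set d : ℝ := (Fintype.card (Fin M × Idx S A M H) : ℝ) with hd
  have hd0 : 0 < d := by rw [hd]; exact_mod_cast Fintype.card_pos
  have hdet : Real.log (l • 1 + m.hessMat 0 D k m.feat).det ≤ d * Real.log (l + k * H / d) := by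
    rw [← hessMat_eq_add]
    refine log_det_le (m.hessMat_posDef hl D k m.feat) (by positivity) ?_
    refine (m.trace_hessMat_le hη l D k m.feat).trans (le_of_eq ?_)
    rw [← hd]; field_simp
  have hlog : Real.log (l + k * H / d) = Real.log l + Real.log (1 + k * H / (d * l)) := by
    rw [← Real.log_mul hl.ne' (by positivity)]
    congr 1; field_simp
  have hsr : 0 < Real.sqrt l * r := mul_pos (Real.sqrt_pos.2 hl) hr
  rw [hlog] at hdet
  refine add_le_add le_rfl (mul_le_mul_of_nonneg_left ?_ (by positivity))
  linarith

namespace IsRun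

variable {m : Model S A M H} {b : Feat S A M H} {lam L δ : ℝ} {K : ℕ} {Ω : Type*}
  [mΩ : MeasurableSpace Ω] {μ : Measure Ω} [IsProbabilityMeasure μ] {ℱ : Filtration ℕ mΩ}
  {init : ℕ → Ω → S} {fbar : ℕ → Ω → Feat S A M H} {pol : ℕ → Ω → Hist S A M → S → A}
  {D : ℕ → Ω → Traj S A M H} {R : ℕ → Fin H → Ω → ℝ}

/-- With high probability the noise satisfies the self-normalised bound in all episodes. -/
lemma measureReal_not_noiseBound_le (hr : m.IsRun b lam L δ K μ ℱ init fbar pol D R)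
    (hM : 1 ≤ M) (hH : 1 ≤ H) (hη : m.η ≤ 1 / Real.sqrt (effHorizon m.α H)) {l r δ' : ℝ}
    (hl : 0 < l) (hr0 : 0 < r) (hr1 : r ≤ 2 / 3) (hδ' : 0 < δ') :
    μ.real {ω | ¬ ∀ k ∈ Finset.Icc 1 K, m.NoiseBound (fun k' => D k' ω) k l
      (noiseRadius (Fintype.card (Fin M × Idx S A M H)) H l r δ' k)} ≤ δ' := by
  set T : Set (Feat S A M H) := {y | y ⬝ᵥ y ≤ r ^ 2} with hT
  have hTc : IsCompact T := isCompact_dotProduct_self_le _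
  have hTm : MeasurableSet T := hTc.isClosed.measurableSet
  have hT49 : ∀ ξ ∈ T, ξ ⬝ᵥ ξ ≤ 4 / 9 := fun ξ hξ => (show ξ ⬝ᵥ ξ ≤ r ^ 2 from hξ).trans (by nlinarith)
  have hTvol : 0 < volume.real T := by
    rw [hT, volume_real_ball hr0]
    exact mul_pos (by positivity) volume_real_ball_pos
  set P : ℕ → (ℕ → Traj S A M H) → Feat S A M H → ℝ := fun n D' ξ =>
    ∏ k' ∈ Finset.Ico 1 (n + 1), m.epWeight ξ (D' k') with hP
  have hP0 : ∀ n D' ξ, 0 < P n D' ξ := fun n D' ξ => Finset.prod_pos fun _ _ => m.epWeight_pos _ _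
  have hPc : ∀ n D', Continuous (P n D') := fun n D' =>
    continuous_finsetProd _ fun k' _ => m.continuous_epWeight (D' k')
  have hPle : ∀ n D', ∀ ξ ∈ T, P n D' ξ ≤ (Real.exp 1 ^ H) ^ n := fun n D' ξ hξ => by
    refine (Finset.prod_le_prod (fun _ _ => (m.epWeight_pos _ _).le) fun k' _ =>
      m.epWeight_le hη (hT49 ξ hξ) (D' k')).trans ?_
    simp
  have hPi : ∀ n D', IntegrableOn (P n D') T := fun n D' =>
    (hPc n D').continuousOn.integrableOn_compact hTc
  have hPei : ∀ n D' e, IntegrableOn (fun ξ => P n D' ξ * m.epWeight ξ e) T := fun n D' e =>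
    ((hPc n D').mul (m.continuous_epWeight e)).continuousOn.integrableOn_compact hTc
  -- Averaging over the ball of directions keeps the supermartingale property and the initial value
  -- 1, and one process then controls all directions at once.
  set X : ℕ → Ω → ℝ := fun n ω => (∫ ξ in T, P n (fun k' => D k' ω) ξ) / volume.real T with hX
  have hX0 : ∀ n ω, 0 ≤ X n ω := fun n ω =>
    div_nonneg (setIntegral_nonneg hTm fun ξ _ => (hP0 _ _ _).le) hTvol.le
  have hbound : ∀ (g : Feat S A M H → ℝ) (C : ℝ), IntegrableOn g T → (∀ ξ ∈ T, g ξ ≤ C) →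
      (∫ ξ in T, g ξ) / volume.real T ≤ C := fun g C hg hC => by
    rw [div_le_iff₀ hTvol]
    refine (setIntegral_mono_on hg (integrableOn_const hTc.measure_lt_top.ne) hTm hC).trans ?_
    rw [setIntegral_const, smul_eq_mul, mul_comm]
  have hXm : ∀ n ≤ K, Measurable[ℱ n] (X n) := fun n hn => by
    refine hr.measurable_past (k := n + 1) (by omega)
      (Φ := fun D' => (∫ ξ in T, P n D' ξ) / volume.real T) fun D₁ D₂ h12 => ?_
    have : ∀ ξ, P n D₁ ξ = P n D₂ ξ := fun ξ =>
      Finset.prod_congr rfl fun k' hk' => by rw [h12 k' hk']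
    simp only [this]
  have hXi : ∀ n ≤ K, Integrable (X n) μ := fun n hn =>
    Integrable.of_bound ((hXm n hn).mono (ℱ.le n) le_rfl).aestronglyMeasurable
      ((Real.exp 1 ^ H) ^ n) (Filter.Eventually.of_forall fun ω => by
        rw [Real.norm_of_nonneg (hX0 n ω)]
        exact hbound _ _ (hPi _ _) (hPle n _))
  have hville := measureReal_exists_le (μ := μ) (ℱ := ℱ) (K := K) hX0 hXm hXi (a := 1 / δ')
    (fun k hk G hG => by
      have hk1 : k + 1 ∈ Finset.Icc 1 K := Finset.mem_Icc.2 ⟨by omega, hk⟩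
      have h1 := hr.setIntegral_apply_traj_le hk1 (G := G)
        (W := fun ω e => (∫ ξ in T, P k (fun k' => D k' ω) ξ * m.epWeight ξ e) / volume.real T)
        (C := (Real.exp 1 ^ H) ^ k * Real.exp 1 ^ H)
        (fun e => hr.measurable_past (k := k + 1) (by omega)
          (Φ := fun D' => (∫ ξ in T, P k D' ξ * m.epWeight ξ e) / volume.real T)
          fun D₁ D₂ h12 => by
            have : ∀ ξ, P k D₁ ξ = P k D₂ ξ := fun ξ =>
              Finset.prod_congr rfl fun k' hk' => by rw [h12 k' hk']
            simp only [this])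
        (fun ω e => by
          rw [abs_of_nonneg (div_nonneg (setIntegral_nonneg hTm fun ξ _ =>
            (mul_pos (hP0 _ _ _) (m.epWeight_pos _ _)).le) hTvol.le)]
          refine hbound _ _ (hPei _ _ _) fun ξ hξ => ?_
          exact mul_le_mul (hPle _ _ ξ hξ) (m.epWeight_le hη (hT49 ξ hξ) e)
            (m.epWeight_pos _ _).le (by positivity))
        (hXi k hk.le) (fun ω => by
          simp only [hX, mul_div_assoc']
          rw [← Finset.sum_div]
          refine div_le_div_of_nonneg_right ?_ hTvol.le
          simp only [← integral_const_mul]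
          rw [← integral_finsetSum _ fun e _ => (hPei k _ e).const_mul _]
          refine setIntegral_mono_on (integrable_finsetSum _ fun e _ => (hPei k _ e).const_mul _)
            (hPi k _) hTm fun ξ hξ => ?_
          have h2 := m.sum_trajProb_mul_epWeight_le hη (hT49 ξ hξ)
            (detPolicy (pol (k + 1) ω)) (init (k + 1) ω)
          have h3 := mul_le_mul_of_nonneg_left h2 (hP0 k (fun k' => D k' ω) ξ).le
          rw [mul_one, Finset.mul_sum] at h3
          refine le_trans (le_of_eq (Finset.sum_congr rfl fun e _ => ?_)) h3
          ring) hG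
      refine le_trans (le_of_eq ?_) h1
      refine setIntegral_congr_fun (ℱ.le _ _ hG) fun ω _ => ?_
      simp only [hX, hP]
      congr 2
      funext ξ
      rw [Finset.prod_Ico_succ_top (by omega)])
    (fun ω => by
      refine hbound _ _ (hPi _ _) fun ξ _ => ?_
      simp [hP]) (by positivity)
  rw [one_div_one_div] at hville
  refine (measureReal_mono (fun ω hω => ?_) (measure_ne_top _ _)).trans hville
  by_contra hcon
  -- The data before episode `k` are `k - 1` episodes, so the process is read at time `k - 1`.
  refine hω fun k hk => noiseBound_of_mixture m hM hH hη hl hr0 hδ' ?_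
  rw [Finset.mem_Icc] at hk
  have h1 : X (k - 1) ω < 1 / δ' := by
    by_contra h2
    exact hcon ⟨k - 1, by omega, not_lt.1 h2⟩
  have h2 := (div_lt_iff₀ hTvol).1 h1
  simp only [hP, Nat.sub_add_cancel hk.1] at h2
  exact h2.le

end IsRun

end Model

end Noise

/-! ### From expected errors to realised errors -/

section Realised

open MeasureTheory ProbabilityTheory

variable {S A : Type*} [Fintype S] [Fintype A] [DecidableEq S] [DecidableEq A] {M H : ℕ}

lemma exp_neg_le_one_sub_half {y : ℝ} (h0 : 0 ≤ y) (h1 : y ≤ 1) : Real.exp (-y) ≤ 1 - y / 2 := by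
  have h2 : 1 + y ≤ Real.exp y := by linarith [Real.add_one_le_exp y]
  rw [Real.exp_neg]
  refine (inv_anti₀ (by linarith) h2).trans ?_
  rw [inv_le_iff_one_le_mul₀ (by linarith)]
  nlinarith

namespace Model

lemma stepErr_nonneg (m : Model S A M H) (D : ℕ → Traj S A M H) (K : ℕ) (δ : ℝ) (k : ℕ)
    (f : Feat S A M H) (τ : Hist S A M) (h : Fin H) (s : S) (a : A) (x : Fin (M + 1)) :
    0 ≤ m.stepErr D K δ k f τ h s a x := by
  have h1 := bonusRew_nonneg (S := S) (A := A) (M := M) (H := H) (K := K) (δ := δ)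
    (visits D k h s a x)
  have h2 := bonusTrans_nonneg (S := S) (A := A) (M := M) (H := H) (K := K) (δ := δ)
    (visits D k h s a x)
  unfold stepErr
  have h3 : 0 ≤ ∑ y, |m.ctxProb f τ y - m.ctxProb m.feat τ y| :=
    Finset.sum_nonneg fun _ _ => abs_nonneg _
  positivity

lemma stepErr_le (m : Model S A M H) (D : ℕ → Traj S A M H) (K : ℕ) (δ : ℝ) (k : ℕ)
    (f : Feat S A M H) (τ : Hist S A M) (h : Fin H) (s : S) (a : A) (x : Fin (M + 1)) :
    m.stepErr D K δ k f τ h s a x ≤ 22 * H := by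
  have h1 : bonusRew S A M H K δ (visits D k h s a x) ≤ 1 := min_le_right _ _
  have h2 : bonusTrans S A M H K δ (visits D k h s a x) ≤ 2 * H := min_le_right _ _
  have h3 : ∑ y, |m.ctxProb f τ y - m.ctxProb m.feat τ y| ≤ 2 := by
    rw [ctxProb_eq, ctxProb_eq]; exact sum_abs_gibbs_sub_le_two _ _
  have hH : (1 : ℝ) ≤ H := by
    have : 1 ≤ H := Nat.one_le_of_lt h.2
    exact_mod_cast this
  have h4 := mul_le_mul_of_nonneg_left h3 (by positivity : (0 : ℝ) ≤ 8 * H)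
  unfold stepErr
  linarith

lemma trajErr_mem (m : Model S A M H) (D : ℕ → Traj S A M H) (K : ℕ) (δ : ℝ) (k : ℕ)
    (f : Feat S A M H) (e : Traj S A M H) :
    m.trajErr D K δ k f e ∈ Set.Icc (0 : ℝ) (22 * (H : ℝ) ^ 2) := by
  refine ⟨Finset.sum_nonneg fun _ _ => m.stepErr_nonneg .., ?_⟩
  refine (Finset.sum_le_card_nsmul _ _ (22 * (H : ℝ)) fun _ _ => m.stepErr_le ..).trans (le_of_eq ?_)
  simp; ring

lemma continuous_ctxProb (m : Model S A M H) (τ : Hist S A M) (y : Fin (M + 1)) :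
    Continuous fun f : Feat S A M H => m.ctxProb f τ y := by
  simp only [ctxProb_eq, gibbs]
  have h := m.continuous_logits τ
  exact Continuous.div (by fun_prop) (by fun_prop) fun f => (sum_exp_pos _).ne'

namespace IsRun

variable {m : Model S A M H} {b : Feat S A M H} {lam L δ : ℝ} {K : ℕ} {Ω : Type*}
  [mΩ : MeasurableSpace Ω] {μ : Measure Ω} [IsProbabilityMeasure μ] {ℱ : Filtration ℕ mΩ}
  {init : ℕ → Ω → S} {fbar : ℕ → Ω → Feat S A M H} {pol : ℕ → Ω → Hist S A M → S → A}
  {D : ℕ → Ω → Traj S A M H} {R : ℕ → Fin H → Ω → ℝ}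

lemma measurable_trajErr (hr : m.IsRun b lam L δ K μ ℱ init fbar pol D R) {k : ℕ}
    (hk : k ∈ Finset.Icc 1 K) (e : Traj S A M H) :
    Measurable[ℱ (k - 1)] fun ω => m.trajErr (fun k' => D k' ω) K δ k (fbar k ω) e := by
  have hkK : k ≤ K + 1 := by rw [Finset.mem_Icc] at hk; omega
  refine Finset.measurable_sum _ fun h _ => Measurable.add (Measurable.add ?_ ?_) ?_
  · refine Measurable.const_mul (Finset.measurable_sum _ fun y _ => ?_) _
    have hc : Continuous fun f : Feat S A M H =>
        |m.ctxProb f (Traj.hist e h) y - m.ctxProb m.feat (Traj.hist e h) y| :=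
      ((m.continuous_ctxProb _ _).sub continuous_const).abs
    exact hc.measurable.comp (hr.fbar_adapted k hk)
  · refine hr.measurable_past hkK (Φ := fun D' => 2 * bonusRew S A M H K δ
      (visits D' k h (e.1 h.castSucc) (e.2.1 h) (e.2.2 h))) fun D₁ D₂ h12 => ?_
    congr 2
    exact congrArg Finset.card (Finset.filter_congr fun k' hk' => by rw [h12 k' hk'])
  · refine hr.measurable_past hkK (Φ := fun D' => 2 * bonusTrans S A M H K δ
      (visits D' k h (e.1 h.castSucc) (e.2.1 h) (e.2.2 h))) fun D₁ D₂ h12 => ?_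
    congr 2
    exact congrArg Finset.card (Finset.filter_congr fun k' hk' => by rw [h12 k' hk'])

/-- With high probability the sum of the conditional means of nonnegative bounded functions of the
episodes is at most about twice the realised sum. -/
lemma measureReal_lt_sum_mean_le (hr : m.IsRun b lam L δ K μ ℱ init fbar pol D R)
    {T : ℕ → Ω → Traj S A M H → ℝ} {B δ' : ℝ} (hB : 0 < B) (hδ' : 0 < δ')
    (hTm : ∀ k ∈ Finset.Icc 1 K, ∀ e, Measurable[ℱ (k - 1)] fun ω => T k ω e)
    (hT : ∀ k ω e, T k ω e ∈ Set.Icc 0 B) :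
    μ.real {ω | 2 * ∑ k ∈ Finset.Icc 1 K, T k ω (D k ω) + 2 * B * Real.log (1 / δ') <
      ∑ k ∈ Finset.Icc 1 K, ∑ e, m.trajProb (detPolicy (pol k ω)) (init k ω) e * T k ω e} ≤ δ' := by
  set E : ℕ → Ω → ℝ := fun k ω =>
    ∑ e, m.trajProb (detPolicy (pol k ω)) (init k ω) e * T k ω e with hE
  have hP := fun k ω => m.sum_trajProb (detPolicy (pol k ω)) (init k ω)
  have hP0 := fun k ω => m.trajProb_nonneg (detPolicy (pol k ω)) (init k ω)
  have hE0 : ∀ k ω, 0 ≤ E k ω := fun k ω =>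
    Finset.sum_nonneg fun e _ => mul_nonneg (hP0 k ω e) (hT k ω e).1
  have hEB : ∀ k ω, E k ω ≤ B := fun k ω => by
    calc E k ω ≤ ∑ e, m.trajProb (detPolicy (pol k ω)) (init k ω) e * B :=
          Finset.sum_le_sum fun e _ => mul_le_mul_of_nonneg_left (hT k ω e).2 (hP0 k ω e)
      _ = B := by rw [← Finset.sum_mul, hP, one_mul]
  have hEm : ∀ k ∈ Finset.Icc 1 K, Measurable[ℱ (k - 1)] (E k) := fun k hk =>
    Finset.measurable_sum _ fun e _ => (hr.measurable_trajProb hk e).mul (hTm k hk e)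
  -- Since `exp (-y) ≤ 1 - y/2` on `[0,1]`, the weight has mean at most `exp (E/2B) (1 - E/2B) ≤ 1`.
  -- Nonnegativity of the errors thus yields a comparison up to the factor 2 with a logarithmic
  -- remainder, rather than a deviation of order `√K`.
  set w : ℕ → Ω → Traj S A M H → ℝ := fun k ω e =>
    Real.exp (E k ω / (2 * B) - T k ω e / B) with hw
  have hw0 : ∀ k ω e, 0 < w k ω e := fun k ω e => Real.exp_pos _
  have hw1 : ∀ k ω e, w k ω e ≤ Real.exp 1 := fun k ω e => by
    refine Real.exp_le_exp.2 ?_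
    have h1 : E k ω / (2 * B) ≤ 1 := by
      rw [div_le_one (by positivity)]; linarith [hEB k ω]
    have h2 : 0 ≤ T k ω e / B := div_nonneg (hT k ω e).1 hB.le
    linarith
  have hwm : ∀ k ∈ Finset.Icc 1 K, ∀ e, Measurable[ℱ (k - 1)] fun ω => w k ω e := fun k hk e =>
    Real.measurable_exp.comp (((hEm k hk).div_const _).sub ((hTm k hk e).div_const _))
  have hwmean : ∀ k ω, ∑ e, m.trajProb (detPolicy (pol k ω)) (init k ω) e * w k ω e ≤ 1 := by
    intro k ω
    have h1 : ∀ e, w k ω e ≤ Real.exp (E k ω / (2 * B)) * (1 - T k ω e / B / 2) := fun e => by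
      simp only [hw]
      rw [sub_eq_add_neg, Real.exp_add]
      exact mul_le_mul_of_nonneg_left (exp_neg_le_one_sub_half (div_nonneg (hT k ω e).1 hB.le)
        ((div_le_one hB).2 (hT k ω e).2)) (Real.exp_pos _).le
    calc _ ≤ ∑ e, m.trajProb (detPolicy (pol k ω)) (init k ω) e *
          (Real.exp (E k ω / (2 * B)) * (1 - T k ω e / B / 2)) :=
          Finset.sum_le_sum fun e _ => mul_le_mul_of_nonneg_left (h1 e) (hP0 k ω e)
      _ = Real.exp (E k ω / (2 * B)) * ∑ e, (m.trajProb (detPolicy (pol k ω)) (init k ω) e -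
            m.trajProb (detPolicy (pol k ω)) (init k ω) e * T k ω e * (1 / (2 * B))) := by
          rw [Finset.mul_sum]
          refine Finset.sum_congr rfl fun e _ => ?_
          field_simp
      _ = Real.exp (E k ω / (2 * B)) * (1 - E k ω / (2 * B)) := by
          rw [Finset.sum_sub_distrib, hP, ← Finset.sum_mul]
          simp only [hE]
          ring
      _ ≤ Real.exp (E k ω / (2 * B)) * Real.exp (-(E k ω / (2 * B))) := by
          refine mul_le_mul_of_nonneg_left ?_ (Real.exp_pos _).le
          linarith [Real.add_one_le_exp (-(E k ω / (2 * B)))]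
      _ = 1 := by rw [← Real.exp_add, add_neg_cancel, Real.exp_zero]
  set X : ℕ → Ω → ℝ := fun n ω => ∏ k ∈ Finset.Ico 1 (n + 1), w k ω (D k ω) with hX
  have hX0 : ∀ n ω, 0 ≤ X n ω := fun n ω => Finset.prod_nonneg fun _ _ => (hw0 _ _ _).le
  have hXle : ∀ n ω, X n ω ≤ Real.exp 1 ^ n := fun n ω => by
    refine (Finset.prod_le_prod (fun k _ => (hw0 k ω _).le) fun k _ => hw1 k ω _).trans ?_
    simp
  have hXm : ∀ n ≤ K, Measurable[ℱ n] (X n) := fun n hn => by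
    refine Finset.measurable_prod _ fun k hk => ?_
    rw [Finset.mem_Ico] at hk
    have hk' : k ∈ Finset.Icc 1 K := Finset.mem_Icc.2 ⟨hk.1, by omega⟩
    refine ((hr.integrable_apply_traj hk' (W := w k) (C := Real.exp 1)
      (fun e => (hwm k hk' e).mono (ℱ.mono (Nat.sub_le _ _)) le_rfl) fun ω e => ?_).1).mono
      (ℱ.mono (by omega)) le_rfl
    rw [abs_of_pos (hw0 k ω e)]; exact hw1 k ω e
  have hXi : ∀ n ≤ K, Integrable (X n) μ := fun n hn =>
    Integrable.of_bound ((hXm n hn).mono (ℱ.le n) le_rfl).aestronglyMeasurable (Real.exp 1 ^ n)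
      (Filter.Eventually.of_forall fun ω => by
        rw [Real.norm_of_nonneg (hX0 n ω)]; exact hXle n ω)
  have hville := measureReal_exists_le (μ := μ) (ℱ := ℱ) (K := K) hX0 hXm hXi (a := 1 / δ')
    (fun k hk G hG => by
      have hk1 : k + 1 ∈ Finset.Icc 1 K := Finset.mem_Icc.2 ⟨by omega, hk⟩
      have h1 := hr.setIntegral_apply_traj_le hk1 (G := G)
        (W := fun ω e => X k ω * w (k + 1) ω e) (C := Real.exp 1 ^ k * Real.exp 1)
        (fun e => (hXm k hk.le).mul (hwm (k + 1) hk1 e))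
        (fun ω e => by
          rw [abs_of_nonneg (mul_nonneg (hX0 _ _) (hw0 _ _ _).le)]
          exact mul_le_mul (hXle k ω) (hw1 _ _ _) (hw0 _ _ _).le (by positivity))
        (hXi k hk.le) (fun ω => by
          have h3 := mul_le_mul_of_nonneg_left (hwmean (k + 1) ω) (hX0 k ω)
          rw [mul_one, Finset.mul_sum] at h3
          refine le_trans (le_of_eq (Finset.sum_congr rfl fun e _ => ?_)) h3
          ring) hG
      refine le_trans (le_of_eq ?_) h1
      refine setIntegral_congr_fun (ℱ.le _ _ hG) fun ω _ => ?_
      simp only [hX]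
      rw [Finset.prod_Ico_succ_top (by omega)])
    (fun ω => by simp [hX]) (by positivity)
  rw [one_div_one_div] at hville
  refine (measureReal_mono (fun ω hω => ?_) (measure_ne_top _ _)).trans hville
  refine ⟨K, le_rfl, ?_⟩
  have hlt : 2 * ∑ k ∈ Finset.Icc 1 K, T k ω (D k ω) + 2 * B * Real.log (1 / δ') <
      ∑ k ∈ Finset.Icc 1 K, E k ω := hω
  simp only [hX, hw]
  rw [← Real.exp_sum, Finset.sum_sub_distrib, ← Finset.sum_div, ← Finset.sum_div,
    ← Real.log_le_iff_le_exp (by positivity)]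
  have h1 : (Finset.Ico 1 (K + 1)) = Finset.Icc 1 K := rfl
  rw [h1, le_sub_iff_add_le, le_div_iff₀ (by positivity)]
  have h2 : (Real.log (1 / δ') + (∑ k ∈ Finset.Icc 1 K, T k ω (D k ω)) / B) * (2 * B) =
      2 * ∑ k ∈ Finset.Icc 1 K, T k ω (D k ω) + 2 * B * Real.log (1 / δ') := by
    field_simp; ring
  rw [h2]
  exact hlt.le

end IsRun

end Model

end Realised

/-! ### Bounds for the radii -/

section Radii

variable {S A : Type*} [Fintype S] [Fintype A] [DecidableEq S] [DecidableEq A] {M H : ℕ}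

/-- All logarithms in the analysis are dominated by one logarithm. -/
lemma exists_log_le {c₁ ℓ₀ : ℝ} (hc₁ : 0 < c₁) (hℓ₀ : 0 < ℓ₀) : ∃ Λ : ℝ, 1 ≤ Λ ∧
    ∀ s a M h K L δ lam : ℝ, 1 ≤ s → 1 ≤ a → 1 ≤ M → 1 ≤ h → 1 ≤ K → ℓ₀ ≤ L → 0 < δ → δ < 1 →
      0 < lam → c₁ ≤ lam * L →
      1 ≤ Λ * L ∧ 1 ≤ Λ * Real.log (2 + s * a * M * h * K * L / δ) ∧
      Real.log (8 * s * a * M * h * K / δ) ≤ Λ * Real.log (2 + s * a * M * h * K * L / δ) ∧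
      Real.log (8 / δ) ≤ Λ * Real.log (2 + s * a * M * h * K * L / δ) ∧
      Real.log (M + 1) ≤ Λ * Real.log (2 + s * a * M * h * K * L / δ) ∧
      Real.log K ≤ Λ * Real.log (2 + s * a * M * h * K * L / δ) ∧
      Real.log (1 + K / lam) ≤ Λ * Real.log (2 + s * a * M * h * K * L / δ) ∧
      Real.log (1 + K * h) ≤ Λ * Real.log (2 + s * a * M * h * K * L / δ) := by
  -- Each argument is at most `c` times that of the common logarithm: `8 / ℓ₀` restores the missing
  -- factor `L`, and `1 / c₁` handles `K / lam` through `lam L ≥ c₁`. The common logarithm is at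
  -- least 1/2, so `log c` is absorbed.
  set c : ℝ := 8 / ℓ₀ + 8 + 1 / c₁ with hc
  have hc1 : 1 ≤ c := by
    have : 0 < 8 / ℓ₀ := by positivity
    have : 0 < 1 / c₁ := by positivity
    linarith
  have hlc : 0 ≤ Real.log c := Real.log_nonneg hc1
  refine ⟨2 * Real.log c + 2 + 1 / ℓ₀, by have : 0 < 1 / ℓ₀ := by positivity
                                          linarith, ?_⟩
  intro s a M h K L δ lam hs ha hM hh hK hL hδ hδ1 hlam hlamL
  have hL0 : 0 < L := hℓ₀.trans_le hL
  set P := s * a * M * h * K with hP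
  have hsa : 1 ≤ s * a := one_le_mul_of_one_le_of_one_le hs ha
  have hsaM : 1 ≤ s * a * M := one_le_mul_of_one_le_of_one_le hsa hM
  have hsaMh : 1 ≤ s * a * M * h := one_le_mul_of_one_le_of_one_le hsaM hh
  have hP1 : 1 ≤ P := one_le_mul_of_one_le_of_one_le hsaMh hK
  have hP0 : 0 < P := by linarith
  set Z := 2 + P * L / δ with hZ
  have hq0 : 0 < P * L / δ := by positivity
  have hPδ : P / δ ≤ Z / ℓ₀ := by
    rw [le_div_iff₀ hℓ₀]
    calc P / δ * ℓ₀ ≤ P / δ * L := by gcongr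
      _ ≤ Z := by rw [hZ, div_mul_eq_mul_div]; linarith
  have hPle : P ≤ P / δ := by rw [le_div_iff₀ hδ]; nlinarith
  have hZ2 : 2 ≤ Z := by linarith
  have hℓ : 1 / 2 ≤ Real.log Z := by
    have := Real.log_le_log (by norm_num) hZ2
    linarith [Real.log_two_gt_d9]
  have key : ∀ Q : ℝ, 0 < Q → Q ≤ c * Z → Real.log Q ≤
      (2 * Real.log c + 2 + 1 / ℓ₀) * Real.log Z := fun Q hQ hQZ => by
    have h1 := Real.log_le_log hQ hQZ
    rw [Real.log_mul (by linarith) (by linarith)] at h1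
    have h2 : 0 < 1 / ℓ₀ := by positivity
    nlinarith
  have hbig : ∀ Q : ℝ, Q ≤ 8 * (P / δ) → Q ≤ c * Z := fun Q hQ => by
    refine hQ.trans ?_
    calc 8 * (P / δ) ≤ 8 * (Z / ℓ₀) := by linarith
      _ = 8 / ℓ₀ * Z := by ring
      _ ≤ c * Z := by
        refine mul_le_mul_of_nonneg_right ?_ (by linarith)
        have : 0 < 1 / c₁ := by positivity
        linarith
  have hMP : M ≤ P := by
    calc M ≤ s * a * M := le_mul_of_one_le_left (by linarith) hsa
      _ ≤ s * a * M * h := le_mul_of_one_le_right (by linarith) hh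
      _ ≤ P := le_mul_of_one_le_right (by linarith) hK
  have hhP : h ≤ s * a * M * h := le_mul_of_one_le_left (by linarith) hsaM
  have hKhP : K * h ≤ P := by rw [hP, mul_comm K h]; gcongr
  have hKP : K ≤ K * h := le_mul_of_one_le_right (by linarith) hh
  refine ⟨?_, ?_, ?_, ?_, ?_, ?_, ?_, ?_⟩
  · have h1 : 1 ≤ 1 / ℓ₀ * L := by
      rw [div_mul_eq_mul_div, one_mul, one_le_div hℓ₀]; exact hL
    nlinarith
  · have h2 : 0 < 1 / ℓ₀ := by positivity
    nlinarith
  · refine key _ (by positivity) (hbig _ (le_of_eq ?_))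
    rw [hP]; ring
  · refine key _ (by positivity) (hbig _ ?_)
    rw [mul_div_assoc']; gcongr; linarith
  · exact key _ (by linarith) (hbig _ (by linarith))
  · exact key _ (by linarith) (hbig _ (by linarith))
  · refine key _ (by positivity) ?_
    have h1 : K / lam ≤ 1 / c₁ * Z := by
      rw [div_mul_eq_mul_div, one_mul, div_le_div_iff₀ hlam hc₁]
      calc K * c₁ ≤ K * (lam * L) := by gcongr
        _ = K * L * lam := by ring
        _ ≤ Z * lam := by
          refine mul_le_mul_of_nonneg_right ?_ hlam.le
          calc K * L ≤ P / δ * L := by gcongr; linarith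
            _ ≤ Z := by rw [hZ, div_mul_eq_mul_div]; linarith
    have h2 : 0 < 8 / ℓ₀ * Z := by positivity
    rw [hc]; nlinarith
  · refine key _ (by nlinarith) (hbig _ (by linarith))

lemma card_feat_eq (S A : Type*) [Fintype S] [Fintype A] (M H : ℕ) :
    (Fintype.card (Fin M × Idx S A M H) : ℝ) =
      M * ((M + 1) * Fintype.card S * Fintype.card A * H) := by
  simp only [Fintype.card_prod, Fintype.card_fin]
  push_cast; ring

lemma card_idx_eq (S A : Type*) [Fintype S] [Fintype A] (M H : ℕ) :
    (Fintype.card (Idx S A M H) : ℝ) = (M + 1) * Fintype.card S * Fintype.card A * H := by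
  simp only [Fintype.card_prod, Fintype.card_fin]
  push_cast; ring

lemma rpow_add_half {x : ℝ} (hx : 0 < x) (n : ℕ) :
    x ^ ((n : ℝ) + 1 / 2) = x ^ n * Real.sqrt x := by
  rw [Real.rpow_add hx, Real.rpow_natCast, Real.sqrt_eq_rpow]

/-- The noise bound fits into the confidence radius. -/
lemma noiseRadius_add_le_radius (hS : 0 < Fintype.card S) (hA : 0 < Fintype.card A) (hM : 1 ≤ M)
    (hH : 1 ≤ H) {lam L δ : ℝ} (hlam : 0 < lam) (hδ : 0 < δ) (hδ1 : δ < 1) (k : ℕ) :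
    Model.noiseRadius (Fintype.card (Fin M × Idx S A M H)) H lam (2 / (3 * Real.sqrt M)) (δ / 4) k +
      Real.sqrt lam * L ≤ radius S A M H lam L (δ / 4) k := by
  rw [card_feat_eq]
  unfold Model.noiseRadius radius
  set s : ℝ := (Fintype.card S : ℝ) with hs
  set a : ℝ := (Fintype.card A : ℝ) with ha
  have hs1 : (1 : ℝ) ≤ s := by rw [hs]; exact_mod_cast hS
  have ha1 : (1 : ℝ) ≤ a := by rw [ha]; exact_mod_cast hA
  have hM1 : (1 : ℝ) ≤ M := by exact_mod_cast hM
  have hH1 : (1 : ℝ) ≤ H := by exact_mod_cast hH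
  set d : ℝ := M * ((M + 1) * s * a * H) with hd
  have hd2 : 2 ≤ d := by
    have h1 : 1 ≤ s * a := one_le_mul_of_one_le_of_one_le hs1 ha1
    have h2 : 1 ≤ s * a * H := one_le_mul_of_one_le_of_one_le h1 hH1
    have h3 : 1 ≤ M * (s * a * H) := one_le_mul_of_one_le_of_one_le hM1 h2
    rw [hd]; nlinarith
  have hMs : 0 < Real.sqrt M := Real.sqrt_pos.2 (by linarith)
  have hls : 0 < Real.sqrt lam := Real.sqrt_pos.2 hlam
  have e32 : (M : ℝ) ^ (3 / 2 : ℝ) = M * Real.sqrt M := by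
    have := rpow_add_half (by linarith : (0 : ℝ) < M) 1
    rw [pow_one] at this
    rw [← this]; norm_num
  -- The mixture radius `2 / (3√M)` is fitted to the confidence radius: this term becomes `5/12
  -- √(lam/M)`, below `1/2 √(lam/M)`, and the prefactor of the logarithms becomes `2 √(M/lam)`.
  have h1 : 5 / 8 * (Real.sqrt lam * (2 / (3 * Real.sqrt M))) ≤ Real.sqrt (lam / (4 * M)) := by
    rw [Real.sqrt_div hlam.le, Real.sqrt_mul (by norm_num),
      show (4 : ℝ) = 2 ^ 2 by norm_num, Real.sqrt_sq (by norm_num)]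
    have : 5 / 8 * (Real.sqrt lam * (2 / (3 * Real.sqrt M))) =
        5 / 6 * (Real.sqrt lam / (2 * Real.sqrt M)) := by field_simp; norm_num
    rw [this]
    have : 0 < Real.sqrt lam / (2 * Real.sqrt M) := by positivity
    linarith
  have h2 : 4 / (3 * (Real.sqrt lam * (2 / (3 * Real.sqrt M)))) =
      Real.sqrt M / Real.sqrt lam * 2 := by field_simp; norm_num
  have h3 : (M : ℝ) ^ (3 / 2 : ℝ) * (M + 1) * s * a * H / Real.sqrt lam =
      Real.sqrt M / Real.sqrt lam * d := by rw [e32, hd]; ring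
  rw [h2, h3, mul_assoc _ (2 : ℝ), mul_assoc _ d]
  have hlog2 : 0 < Real.log (2 / δ) := Real.log_pos (by rw [lt_div_iff₀ hδ]; linarith)
  have e1 : Real.log (1 / (δ / 4)) = Real.log (2 / δ) + Real.log 2 := by
    rw [← Real.log_mul (by positivity) (by norm_num)]; congr 1; field_simp; norm_num
  have e2 : Real.log (2 / (δ / 4)) = Real.log (2 / δ) + Real.log 4 := by
    rw [← Real.log_mul (by positivity) (by norm_num)]; congr 1; field_simp
  have h4 : Real.log 2 ≤ Real.log (2 / δ) :=
    Real.log_le_log (by norm_num) (by rw [le_div_iff₀ hδ]; linarith)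
  have h5 : Real.log (1 + k * H / (d * lam)) ≤ Real.log (1 + k / ((M + 1) * s * a * lam)) := by
    refine Real.log_le_log (by positivity) (by
      refine add_le_add le_rfl ?_
      rw [hd, div_le_div_iff₀ (by positivity) (by positivity)]
      have : 0 ≤ (k : ℝ) * H * ((M + 1) * s * a * lam) := by positivity
      nlinarith)
  have h6 : 2 * (Real.log (1 / (δ / 4)) + d * Real.log 4 +
      d / 2 * Real.log (1 + k * H / (d * lam))) ≤
      d * (Real.log (1 + k / ((M + 1) * s * a * lam)) + 2 * Real.log (2 / (δ / 4))) := by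
    rw [e1, e2]
    have h7 := mul_le_mul_of_nonneg_left h5 (by linarith : 0 ≤ d)
    have h8 := mul_le_mul_of_nonneg_right hd2 hlog2.le
    linarith
  have h9 := mul_le_mul_of_nonneg_left h6 (by positivity : 0 ≤ Real.sqrt M / Real.sqrt lam)
  linarith

/-- With the ridge equal to the dimension and a mixture radius of constant order, the two terms of
the radius balance, both of order the square root of the dimension up to logarithms. -/
lemma noiseRadius_le {l x δ : ℝ} {k : ℕ} (hd : 1 ≤ l) (hx : 1 ≤ x)
    (h1 : Real.log (8 / δ) ≤ x) (hδ : 0 < δ) (hδ1 : δ < 1)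
    (h2 : Real.log (1 + k * H) ≤ x) :
    0 ≤ Model.noiseRadius l H l (2 / 3) (δ / 4) k ∧
      Model.noiseRadius l H l (2 / 3) (δ / 4) k ≤ 6 * (Real.sqrt l * x) := by
  have hs : 0 < Real.sqrt l := Real.sqrt_pos.2 (by linarith)
  have hss : Real.sqrt l * Real.sqrt l = l := Real.mul_self_sqrt (by linarith)
  unfold Model.noiseRadius
  have e1 : Real.log (1 / (δ / 4)) ≤ x := by
    refine le_trans (Real.log_le_log (by positivity) ?_) h1
    rw [one_div_div]; gcongr; norm_num
  have e1' : 0 ≤ Real.log (1 / (δ / 4)) := Real.log_nonneg (by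
    rw [one_div_div, le_div_iff₀ hδ]; linarith)
  have e2 : Real.log 4 ≤ x := by
    refine le_trans (Real.log_le_log (by norm_num) ?_) h1
    rw [le_div_iff₀ hδ]; linarith
  have e3 : Real.log (1 + k * H / (l * l)) ≤ x := by
    refine le_trans (Real.log_le_log (by positivity) ?_) h2
    refine add_le_add le_rfl (div_le_self (by positivity) (by nlinarith))
  have e3' : 0 ≤ Real.log (1 + k * H / (l * l)) := Real.log_nonneg (by
    have : 0 ≤ (k : ℝ) * H / (l * l) := by positivity
    linarith)
  have e4 : 0 ≤ Real.log 4 := Real.log_nonneg (by norm_num)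
  have h3 : 4 / (3 * (Real.sqrt l * (2 / 3))) = 2 / Real.sqrt l := by field_simp; norm_num
  rw [h3]
  refine ⟨by positivity, ?_⟩
  have h4 : Real.log (1 / (δ / 4)) + l * Real.log 4 + l / 2 * Real.log (1 + k * H / (l * l)) ≤
      5 / 2 * (l * x) := by
    have := mul_le_mul_of_nonneg_left e2 (by linarith : 0 ≤ l)
    have := mul_le_mul_of_nonneg_left e3 (by linarith : 0 ≤ l / 2)
    nlinarith
  have h5 : 2 / Real.sqrt l * (5 / 2 * (l * x)) = 5 * (Real.sqrt l * x) := by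
    nth_rewrite 2 [← hss]; field_simp
  have h6 := mul_le_mul_of_nonneg_left h4 (by positivity : 0 ≤ 2 / Real.sqrt l)
  have h7 : Real.sqrt l * 1 ≤ Real.sqrt l * x := mul_le_mul_of_nonneg_left hx hs.le
  linarith

/-- The lower bound on `lam` makes the leading coefficient, about `M^{5/2} S A H / √lam`, at most of
order `√lam L`, the size of the ridge bias. -/
lemma radius_le (hM : 1 ≤ M) {c₁ lam L δ x Λ : ℝ} {k : ℕ} (hc₁ : 0 < c₁) (hlam : 0 < lam)
    (hL : 0 < L) (hx : 1 ≤ x) (hΛ : 1 ≤ Λ * L) (hS : 0 < Fintype.card S) (hA : 0 < Fintype.card A)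
    (hlow : c₁ * (H * ((M : ℝ) ^ 2 * Real.sqrt M) * Fintype.card S * Fintype.card A) ≤ lam * L)
    (hδ : 0 < δ) (hδ1 : δ < 1)
    (h1 : Real.log (8 / δ) ≤ x) (h2 : Real.log (1 + k / lam) ≤ x) :
    0 ≤ radius S A M H lam L (δ / 4) k ∧
    radius S A M H lam L (δ / 4) k ≤ (6 / c₁ + Λ + 1) * (Real.sqrt lam * L * x) := by
  unfold radius
  set s : ℝ := (Fintype.card S : ℝ) with hs
  set a : ℝ := (Fintype.card A : ℝ) with ha
  have hs1 : (1 : ℝ) ≤ s := by rw [hs]; exact_mod_cast hS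
  have ha1 : (1 : ℝ) ≤ a := by rw [ha]; exact_mod_cast hA
  have hM1 : (1 : ℝ) ≤ M := by exact_mod_cast hM
  have hMs : 0 < Real.sqrt M := Real.sqrt_pos.2 (by linarith)
  have hls : 0 < Real.sqrt lam := Real.sqrt_pos.2 hlam
  have hlss : Real.sqrt lam * Real.sqrt lam = lam := Real.mul_self_sqrt hlam.le
  have e32 : (M : ℝ) ^ (3 / 2 : ℝ) = M * Real.sqrt M := by
    have := rpow_add_half (by linarith : (0 : ℝ) < M) 1
    rw [pow_one] at this
    rw [← this]; norm_num
  have e2 : Real.log (2 / (δ / 4)) = Real.log (8 / δ) := by congr 1; field_simp; norm_num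
  have e2' : 0 ≤ Real.log (8 / δ) := Real.log_nonneg (by rw [le_div_iff₀ hδ]; linarith)
  have e3 : Real.log (1 + k / ((M + 1) * s * a * lam)) ≤ x := by
    refine le_trans (Real.log_le_log (by positivity) ?_) h2
    refine add_le_add le_rfl (div_le_div_of_nonneg_left (by positivity) hlam ?_)
    refine le_mul_of_one_le_left hlam.le ?_
    exact one_le_mul_of_one_le_of_one_le (one_le_mul_of_one_le_of_one_le (by linarith) hs1) ha1
  have e3' : 0 ≤ Real.log (1 + k / ((M + 1) * s * a * lam)) := Real.log_nonneg (by
    have : 0 ≤ (k : ℝ) / ((M + 1) * s * a * lam) := by positivity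
    linarith)
  rw [e2, e32]
  refine ⟨by positivity, ?_⟩
  have h3 : (M : ℝ) * Real.sqrt M * (M + 1) * s * a * H / Real.sqrt lam ≤
      2 / c₁ * (Real.sqrt lam * L) := by
    rw [div_le_iff₀ hls]
    have h4 : (M : ℝ) * Real.sqrt M * (M + 1) * s * a * H ≤
        2 * (H * ((M : ℝ) ^ 2 * Real.sqrt M) * s * a) := by
      have : 0 ≤ (M : ℝ) * Real.sqrt M * s * a * H := by positivity
      nlinarith
    have h5 : 2 * (H * ((M : ℝ) ^ 2 * Real.sqrt M) * s * a) ≤ 2 / c₁ * (lam * L) := by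
      rw [div_mul_eq_mul_div, le_div_iff₀ hc₁]; linarith
    refine (h4.trans h5).trans (le_of_eq ?_)
    calc 2 / c₁ * (lam * L) = 2 / c₁ * (Real.sqrt lam * Real.sqrt lam * L) := by rw [hlss]
      _ = _ := by ring
  have h4 : (M : ℝ) * Real.sqrt M * (M + 1) * s * a * H / Real.sqrt lam *
      (Real.log (1 + k / ((M + 1) * s * a * lam)) + 2 * Real.log (8 / δ)) ≤
      2 / c₁ * (Real.sqrt lam * L) * (3 * x) :=
    mul_le_mul h3 (by linarith) (by positivity) (by positivity)
  have h5 : Real.sqrt (lam / (4 * M)) ≤ Λ * (Real.sqrt lam * L * x) := by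
    have h6 : Real.sqrt (lam / (4 * M)) ≤ Real.sqrt lam :=
      Real.sqrt_le_sqrt (div_le_self hlam.le (by linarith))
    have h7 : Real.sqrt lam * 1 ≤ Real.sqrt lam * (Λ * L * x) :=
      mul_le_mul_of_nonneg_left (one_le_mul_of_one_le_of_one_le hΛ hx) hls.le
    linarith
  have h6 : Real.sqrt lam * L * 1 ≤ Real.sqrt lam * L * x :=
    mul_le_mul_of_nonneg_left hx (by positivity)
  have h7 : 2 / c₁ * (Real.sqrt lam * L) * (3 * x) = 6 / c₁ * (Real.sqrt lam * L * x) := by ring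
  linarith

/-- The bound for the estimation error, in terms of the common logarithm. -/
lemma estimation_bound_le {c₁ lam L x Λ G β β₀ d logM : ℝ} (hc₁ : 0 < c₁)
    (hlam : 0 < lam) (hL : 0 < L) (hx : 1 ≤ x) (hΛ1 : 1 ≤ Λ) (hΛ : 1 ≤ Λ * L) (hlogM : logM ≤ x)
    (hG : G = 4 * (L + 1) + 2 * logM) (hβ0 : 0 ≤ β)
    (hβ : β ≤ (6 / c₁ + Λ + 1) * (Real.sqrt lam * L * x)) (hβ₀0 : 0 ≤ β₀) (hd0 : 0 ≤ d)
    (hβ₀ : β₀ ≤ 6 * (Real.sqrt d * x)) (hd : d ≤ 2 / c₁ * (lam * L)) :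
    16 * G * β ^ 2 + 12 * β₀ ^ 2 + 4 * (6 * β₀ ^ 2 + β₀ * Real.sqrt d + lam * L) ^ 2 / lam ≤
      (16 * (4 + 6 * Λ) * (6 / c₁ + Λ + 1) ^ 2 + 864 / c₁ * Λ ^ 2 +
        4 * (444 / c₁ + 1) ^ 2 * Λ) * (lam * L ^ 3 * x ^ 4) := by
  have hlss : Real.sqrt lam ^ 2 = lam := Real.sq_sqrt hlam.le
  have hdss : Real.sqrt d ^ 2 = d := Real.sq_sqrt hd0
  have hlL : 0 < lam * L := mul_pos hlam hL
  have hx0 : 0 < x := by linarith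
  have hΛx : 1 ≤ Λ * L * x := one_le_mul_of_one_le_of_one_le hΛ hx
  have hx2 : 1 ≤ x ^ 2 := one_le_pow₀ hx
  have hxx2 : x ≤ x ^ 2 := le_self_pow₀ hx (by norm_num)
  have h1 : G ≤ (4 + 6 * Λ) * (L * x) := by
    have : L * 1 ≤ L * x := mul_le_mul_of_nonneg_left hx hL.le
    have : x * 1 ≤ x * (Λ * L) := mul_le_mul_of_nonneg_left hΛ hx0.le
    rw [hG]; linarith
  have h2 : β ^ 2 ≤ (6 / c₁ + Λ + 1) ^ 2 * (lam * L ^ 2 * x ^ 2) := by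
    refine (pow_le_pow_left₀ hβ0 hβ 2).trans (le_of_eq ?_)
    rw [mul_pow, mul_pow, mul_pow, hlss]
  have h3 : 16 * G * β ^ 2 ≤ 16 * (4 + 6 * Λ) * (6 / c₁ + Λ + 1) ^ 2 * (lam * L ^ 3 * x ^ 4) := by
    calc 16 * G * β ^ 2 ≤ 16 * ((4 + 6 * Λ) * (L * x)) *
          ((6 / c₁ + Λ + 1) ^ 2 * (lam * L ^ 2 * x ^ 2)) :=
          mul_le_mul (by linarith) h2 (sq_nonneg _) (by positivity)
      _ = 16 * (4 + 6 * Λ) * (6 / c₁ + Λ + 1) ^ 2 * (lam * L ^ 3 * x ^ 3) := by ring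
      _ ≤ _ := by
        refine mul_le_mul_of_nonneg_left ?_ (by positivity)
        refine mul_le_mul_of_nonneg_left ?_ (by positivity)
        exact pow_le_pow_right₀ hx (by norm_num)
  have h4 : β₀ ^ 2 ≤ 72 / c₁ * (lam * L * x ^ 2) := by
    calc β₀ ^ 2 ≤ (6 * (Real.sqrt d * x)) ^ 2 := pow_le_pow_left₀ hβ₀0 hβ₀ 2
      _ = 36 * d * x ^ 2 := by rw [mul_pow, mul_pow, hdss]; ring
      _ ≤ 36 * (2 / c₁ * (lam * L)) * x ^ 2 := by gcongr
      _ = _ := by ring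
  have h5 : 12 * β₀ ^ 2 ≤ 864 / c₁ * Λ ^ 2 * (lam * L ^ 3 * x ^ 4) := by
    calc 12 * β₀ ^ 2 ≤ 12 * (72 / c₁ * (lam * L * x ^ 2)) := by linarith
      _ = 864 / c₁ * (lam * L * x ^ 2) * 1 ^ 2 := by ring
      _ ≤ 864 / c₁ * (lam * L * x ^ 2) * (Λ * L * x) ^ 2 := by gcongr
      _ = _ := by ring
  have h6 : β₀ * Real.sqrt d ≤ 12 / c₁ * (lam * L * x ^ 2) := by
    calc β₀ * Real.sqrt d ≤ 6 * (Real.sqrt d * x) * Real.sqrt d := by gcongr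
      _ = 6 * Real.sqrt d ^ 2 * x := by ring
      _ = 6 * d * x := by rw [hdss]
      _ ≤ 6 * (2 / c₁ * (lam * L)) * x ^ 2 := by gcongr
      _ = _ := by ring
  have h7 : 6 * β₀ ^ 2 + β₀ * Real.sqrt d + lam * L ≤ (444 / c₁ + 1) * (lam * L * x ^ 2) := by
    have h8 : lam * L * 1 ≤ lam * L * x ^ 2 := mul_le_mul_of_nonneg_left hx2 hlL.le
    have h9 : (444 / c₁ + 1) * (lam * L * x ^ 2) =
      6 * (72 / c₁ * (lam * L * x ^ 2)) + 12 / c₁ * (lam * L * x ^ 2) + lam * L * x ^ 2 := by ring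
    linarith
  -- Here the second noise bound matters: the bracket has order `lam L` up to logarithms, so its
  -- square over `lam` is of order `lam L²`. Missing powers of `L` are supplied by `1 ≤ Λ * L`,
  -- since `L` may be below 1.
  have h8 : 4 * (6 * β₀ ^ 2 + β₀ * Real.sqrt d + lam * L) ^ 2 / lam ≤
      4 * (444 / c₁ + 1) ^ 2 * Λ * (lam * L ^ 3 * x ^ 4) := by
    rw [div_le_iff₀ hlam]
    calc 4 * (6 * β₀ ^ 2 + β₀ * Real.sqrt d + lam * L) ^ 2
        ≤ 4 * ((444 / c₁ + 1) * (lam * L * x ^ 2)) ^ 2 := by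
          refine mul_le_mul_of_nonneg_left (pow_le_pow_left₀ ?_ h7 2) (by norm_num)
          have := mul_nonneg hβ₀0 (Real.sqrt_nonneg d)
          positivity
      _ = 4 * (444 / c₁ + 1) ^ 2 * (lam ^ 2 * L ^ 2 * x ^ 4) * 1 := by ring
      _ ≤ 4 * (444 / c₁ + 1) ^ 2 * (lam ^ 2 * L ^ 2 * x ^ 4) * (Λ * L) := by gcongr
      _ = _ := by ring
  linarith

end Radii

/-! ### The regret on the good event -/

section Final

variable {S A : Type*} [Fintype S] [Fintype A] [DecidableEq S] [DecidableEq A] {M H : ℕ}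

/-- The argument is polynomial in `Z`, of degree 7: three from `(K L)³` and four from `ℓ ≤ Z`. -/
lemma log_one_add_le {c Λ K L ℓ Z : ℝ} (hc : 0 ≤ c) (hΛ : 1 ≤ Λ) (hK : 1 ≤ K) (hL : 0 < L)
    (hKL : K * L ≤ Z) (hZ : 2 ≤ Z) (hℓ : ℓ = Real.log Z) :
    Real.log (1 + 4 * K ^ 3 * (c * (L ^ 3 * (Λ * ℓ) ^ 4))) ≤
      (2 * Real.log (1 + 4 * c * Λ ^ 4) + 7) * (Λ * ℓ) := by
  have hℓ2 : 1 / 2 ≤ ℓ := by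
    have := Real.log_le_log (by norm_num) hZ
    rw [hℓ]; linarith [Real.log_two_gt_d9]
  have hℓZ : ℓ ≤ Z := by rw [hℓ]; exact (Real.log_le_sub_one_of_pos (by linarith)).trans (by linarith)
  have h1 : 1 + 4 * K ^ 3 * (c * (L ^ 3 * (Λ * ℓ) ^ 4)) ≤ (1 + 4 * c * Λ ^ 4) * Z ^ 7 := by
    have h2 : (K * L) ^ 3 * ℓ ^ 4 ≤ Z ^ 3 * Z ^ 4 := by gcongr
    have h3 : 1 ≤ Z ^ 7 := one_le_pow₀ (by linarith)
    have h4 : 4 * c * Λ ^ 4 * ((K * L) ^ 3 * ℓ ^ 4) ≤ 4 * c * Λ ^ 4 * (Z ^ 3 * Z ^ 4) :=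
      mul_le_mul_of_nonneg_left h2 (by positivity)
    calc _ = 1 + 4 * c * Λ ^ 4 * ((K * L) ^ 3 * ℓ ^ 4) := by ring
      _ ≤ Z ^ 7 + 4 * c * Λ ^ 4 * (Z ^ 3 * Z ^ 4) := add_le_add h3 h4
      _ = _ := by ring
  have h5 := Real.log_le_log (by positivity) h1
  rw [Real.log_mul (by positivity) (by positivity), Real.log_pow, ← hℓ] at h5
  have h6 : 0 ≤ Real.log (1 + 4 * c * Λ ^ 4) := Real.log_nonneg (by
    have : 0 ≤ 4 * c * Λ ^ 4 := by positivity
    linarith)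
  have h7 : (2 * Real.log (1 + 4 * c * Λ ^ 4) + 7) * ℓ ≤
      (2 * Real.log (1 + 4 * c * Λ ^ 4) + 7) * (Λ * ℓ) := by
    refine mul_le_mul_of_nonneg_left ?_ (by linarith)
    exact le_mul_of_one_le_left (by linarith) hΛ
  push_cast at h5
  nlinarith

lemma mul_sqrt_eq {c : ℝ} (hc : 0 ≤ c) (z : ℝ) : c * Real.sqrt z = Real.sqrt (c ^ 2 * z) := by
  rw [Real.sqrt_mul (sq_nonneg c), Real.sqrt_sq hc]

/-- One factor `lam L` of the error budget is replaced by its upper bound of order `H M^{5/2} S A`,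
leaving `κ L²`; the dimension supplies a further `M S A H`. Of the six logarithms, four come from
the budget, one from the counting and one from the dyadic levels. -/
lemma prediction_term_le {s a M h K L κ lam x y c c₂ Λ Λ₂ g lK : ℝ} (hs : 1 ≤ s) (ha : 1 ≤ a)
    (hM : 1 ≤ M) (hh : 1 ≤ h) (hK : 1 ≤ K) (hL : 0 < L) (hκ : 1 ≤ κ) (hx : 1 ≤ x)
    (hc : 0 < c) (hc₂ : 0 < c₂) (hm1 : 1 ≤ y) (hΛL2 : 1 ≤ Λ ^ 2 * L ^ 2) (hΛ₂ : 0 ≤ Λ₂)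
    (hup : lam * L ≤ c₂ * (h * (M ^ 2 * y) * s * a))
    (hg0 : 0 ≤ g) (hg : g ≤ Λ₂ * x) (hlK0 : 0 ≤ lK) (hlK : lK ≤ x) :
    h ^ 4 * (K * ((32 * κ * (c * (lam * L ^ 3 * x ^ 4)) + 1) *
      (3 * ((M + 1) * s * a * h) * g) * (1 + 2 * lK))) ≤ 18 * Λ₂ * (32 * c * c₂ + Λ ^ 2) *
      (h ^ 6 * (M ^ 4 * y) * s ^ 2 * a ^ 2 * L ^ 2 * κ * K) * x ^ 6 := by
  set U := h * (M ^ 2 * y) * s * a with hU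
  have hU1 : 1 ≤ U := one_le_mul_of_one_le_of_one_le (one_le_mul_of_one_le_of_one_le
    (one_le_mul_of_one_le_of_one_le hh (one_le_mul_of_one_le_of_one_le (one_le_pow₀ hM) hm1))
    hs) ha
  have h1 : 32 * κ * (c * (lam * L ^ 3 * x ^ 4)) + 1 ≤
      (32 * c * c₂ + Λ ^ 2) * (κ * U * L ^ 2 * x ^ 4) := by
    have h2 : 32 * κ * (c * (lam * L ^ 3 * x ^ 4)) ≤ 32 * c * c₂ * (κ * U * L ^ 2 * x ^ 4) := by
      calc _ = 32 * κ * c * L ^ 2 * x ^ 4 * (lam * L) := by ring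
        _ ≤ 32 * κ * c * L ^ 2 * x ^ 4 * (c₂ * U) := by gcongr
        _ = _ := by ring
    have h3 : 1 ≤ Λ ^ 2 * (κ * U * L ^ 2 * x ^ 4) := by
      have : 1 ≤ (Λ ^ 2 * L ^ 2) * (κ * U * x ^ 4) := one_le_mul_of_one_le_of_one_le hΛL2
        (one_le_mul_of_one_le_of_one_le (one_le_mul_of_one_le_of_one_le hκ hU1) (one_le_pow₀ hx))
      linarith
    linarith
  have h4 : 3 * ((M + 1) * s * a * h) * g ≤ 3 * (2 * M * s * a * h) * (Λ₂ * x) := by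
    gcongr; linarith
  have h5 : 1 + 2 * lK ≤ 3 * x := by linarith
  have h6 : K * ((32 * κ * (c * (lam * L ^ 3 * x ^ 4)) + 1) *
      (3 * ((M + 1) * s * a * h) * g) * (1 + 2 * lK)) ≤ K * ((32 * c * c₂ + Λ ^ 2) * (κ * U * L ^ 2 * x ^ 4) *
      (3 * (2 * M * s * a * h) * (Λ₂ * x)) * (3 * x)) := by
    refine mul_le_mul_of_nonneg_left ?_ (by linarith)
    refine mul_le_mul (mul_le_mul h1 h4 (by positivity) (by positivity)) h5 (by linarith)
      (by positivity)
  refine (mul_le_mul_of_nonneg_left h6 (by positivity)).trans ?_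
  -- The computation produces only `M^{7/2}`; a power of `M` is given away.
  have h7 : M ^ 3 * y ≤ M ^ 4 * y :=
    mul_le_mul_of_nonneg_right (pow_le_pow_right₀ hM (by norm_num)) (by linarith)
  have h8 := mul_le_mul_of_nonneg_left h7 (by positivity : 0 ≤ 18 * Λ₂ * (32 * c * c₂ + Λ ^ 2) *
    (h ^ 6 * s ^ 2 * a ^ 2 * L ^ 2 * κ * K) * x ^ 6)
  refine (le_of_eq ?_).trans (h8.trans (le_of_eq ?_))
  · rw [hU]; ring
  · ring

/-- The final summation of all error terms. -/
lemma total_bound_le {s a M h K L κ lam x c c₂ Λ Λ₂ g lK ι lδ : ℝ} (hs : 1 ≤ s) (ha : 1 ≤ a)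
    (hM : 1 ≤ M) (hh : 1 ≤ h) (hK : 1 ≤ K) (hL : 0 < L) (hκ : 1 ≤ κ) (hx : 1 ≤ x)
    (hc : 0 < c) (hc₂ : 0 < c₂) (hΛ : 1 ≤ Λ) (hΛL : 1 ≤ Λ * L) (hΛ₂ : 0 ≤ Λ₂)
    (hup : lam * L ≤ c₂ * (h * (M ^ 2 * Real.sqrt M) * s * a))
    (hg0 : 0 ≤ g) (hg : g ≤ Λ₂ * x) (hlK0 : 0 ≤ lK) (hlK : lK ≤ x) (hι : ι ≤ x)
    (hlδ : lδ ≤ x) :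
    2 * (8 * h * (h * (2 * (1 + Real.sqrt (K * ((32 * κ * (c * (lam * L ^ 3 * x ^ 4)) + 1) *
      (3 * ((M + 1) * s * a * h) * g) * (1 + 2 * lK)))))) +
      2 * (h * ((Real.sqrt ι + h * Real.sqrt (4 * s * ι)) *
        (3 * Real.sqrt (s * (a * (M + 1)) * K))))) + 2 * (22 * h ^ 2) * lδ ≤
    (148 * Λ + 32 * Real.sqrt (18 * Λ₂ * (32 * c * c₂ + Λ ^ 2))) *
      Real.sqrt (h ^ 6 * (M ^ 4 * Real.sqrt M) * s ^ 2 * a ^ 2 * L ^ 2 * κ * K) * x ^ 3 := by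
  have hm1 : 1 ≤ Real.sqrt M := Real.one_le_sqrt.2 hM
  set y := Real.sqrt M with hy
  set V := h ^ 6 * (M ^ 4 * y) * s ^ 2 * a ^ 2 * L ^ 2 * κ * K with hV
  have hV0 : 0 ≤ V := by positivity
  set W := Real.sqrt V with hW
  have hW0 : 0 ≤ W := Real.sqrt_nonneg _
  have hx0 : 0 < x := by linarith
  have hΛL2 : 1 ≤ Λ ^ 2 * L ^ 2 := by rw [← mul_pow]; exact one_le_pow₀ hΛL
  -- The bonuses sum to order `H² √(S² A M K)` up to logarithms, which the leading term dominates.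
  have hkey : h ^ 4 * (s ^ 2 * a * M * K) ≤ Λ ^ 2 * V := by
    have e1 : Λ ^ 2 * V = h ^ 4 * (s ^ 2 * a * M * K) *
        ((Λ ^ 2 * L ^ 2) * h ^ 2 * (M ^ 3 * y) * a * κ) := by rw [hV]; ring
    rw [e1]
    refine le_mul_of_one_le_right (by positivity) ?_
    have h2 : 1 ≤ M ^ 3 * y := one_le_mul_of_one_le_of_one_le (one_le_pow₀ hM) hm1
    exact one_le_mul_of_one_le_of_one_le (one_le_mul_of_one_le_of_one_le
      (one_le_mul_of_one_le_of_one_le (one_le_mul_of_one_le_of_one_le hΛL2 (one_le_pow₀ hh)) h2)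
      ha) hκ
  have hh2 : h ^ 2 * Real.sqrt (s ^ 2 * a * M * K) ≤ Λ * W := by
    rw [hW, mul_sqrt_eq (by positivity), mul_sqrt_eq (by linarith),
      show (h ^ 2) ^ 2 = h ^ 4 by ring]
    exact Real.sqrt_le_sqrt hkey
  have hh1 : h ^ 2 ≤ Λ * W := by
    refine le_trans (le_mul_of_one_le_right (by positivity) (Real.one_le_sqrt.2 ?_)) hh2
    exact one_le_mul_of_one_le_of_one_le (one_le_mul_of_one_le_of_one_le
      (one_le_mul_of_one_le_of_one_le (one_le_pow₀ hs) ha) hM) hK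
  set T := K * ((32 * κ * (c * (lam * L ^ 3 * x ^ 4)) + 1) *
      (3 * ((M + 1) * s * a * h) * g) * (1 + 2 * lK)) with hT
  set Ct := 18 * Λ₂ * (32 * c * c₂ + Λ ^ 2) with hCt
  have hTle : h ^ 4 * T ≤ Ct * V * x ^ 6 := by
    exact prediction_term_le hs ha hM hh hK hL hκ hx hc hc₂ hm1 hΛL2 hΛ₂ hup hg0 hg hlK0 hlK
  have hsT : h ^ 2 * Real.sqrt T ≤ Real.sqrt Ct * W * x ^ 3 := by
    have hCt0 : 0 ≤ Ct := by rw [hCt]; positivity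
    rw [hW, mul_sqrt_eq (by positivity), show (h ^ 2) ^ 2 = h ^ 4 by ring, ← Real.sqrt_mul hCt0,
      mul_comm (Real.sqrt (Ct * V)), mul_sqrt_eq (by positivity),
      show (x ^ 3) ^ 2 * (Ct * V) = Ct * V * x ^ 6 by ring]
    exact Real.sqrt_le_sqrt hTle
  have hsι : Real.sqrt ι ≤ x := Real.sqrt_le_iff.2 ⟨hx0.le, by nlinarith⟩
  have hs1 : 1 ≤ Real.sqrt s := Real.one_le_sqrt.2 hs
  have hb1 : Real.sqrt ι + h * Real.sqrt (4 * s * ι) ≤ 3 * h * Real.sqrt s * x := by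
    have e : Real.sqrt (4 * s * ι) = 2 * Real.sqrt s * Real.sqrt ι := by
      rw [Real.sqrt_mul (by positivity), Real.sqrt_mul (by norm_num),
        show (4 : ℝ) = 2 ^ 2 by norm_num, Real.sqrt_sq (by norm_num)]
    rw [e]
    have h1 : 1 * x ≤ (h * Real.sqrt s) * x :=
      mul_le_mul_of_nonneg_right (one_le_mul_of_one_le_of_one_le hh hs1) hx0.le
    have h2 : h * (2 * Real.sqrt s * Real.sqrt ι) ≤ h * (2 * Real.sqrt s * x) := by gcongr
    linarith
  have hb2 : Real.sqrt s * Real.sqrt (s * (a * (M + 1)) * K) ≤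
      2 * Real.sqrt (s ^ 2 * a * M * K) := by
    rw [← Real.sqrt_mul (by linarith), mul_sqrt_eq (by norm_num)]
    refine Real.sqrt_le_sqrt ?_
    have : 0 ≤ s ^ 2 * a * K := by positivity
    nlinarith
  have hb : h * ((Real.sqrt ι + h * Real.sqrt (4 * s * ι)) *
      (3 * Real.sqrt (s * (a * (M + 1)) * K))) ≤ 18 * Λ * W * x := by
    calc _ ≤ h * ((3 * h * Real.sqrt s * x) * (3 * Real.sqrt (s * (a * (M + 1)) * K))) := by gcongr
      _ = 9 * x * h ^ 2 * (Real.sqrt s * Real.sqrt (s * (a * (M + 1)) * K)) := by ring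
      _ ≤ 9 * x * h ^ 2 * (2 * Real.sqrt (s ^ 2 * a * M * K)) := by gcongr
      _ = 18 * x * (h ^ 2 * Real.sqrt (s ^ 2 * a * M * K)) := by ring
      _ ≤ 18 * x * (Λ * W) := by gcongr
      _ = _ := by ring
  have hx3 : x ≤ x ^ 3 := le_self_pow₀ hx (by norm_num)
  have hx31 : 1 ≤ x ^ 3 := one_le_pow₀ hx
  have hΛW : 0 ≤ Λ * W := by positivity
  have h1 : h ^ 2 * lδ ≤ Λ * W * x ^ 3 := by
    calc h ^ 2 * lδ ≤ h ^ 2 * x := by gcongr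
      _ ≤ Λ * W * x ^ 3 := by gcongr
  have h2 : Λ * W * 1 ≤ Λ * W * x ^ 3 := mul_le_mul_of_nonneg_left hx31 hΛW
  have h3 : Λ * W * x ≤ Λ * W * x ^ 3 := mul_le_mul_of_nonneg_left hx3 hΛW
  linarith

namespace Model

/-- On the good event the regret is at most the sum of the expected errors. -/
lemma regret_le_sum_trajErr (m : Model S A M H) {b : Feat S A M H} {lam L δ : ℝ} {K : ℕ}
    {D : ℕ → Traj S A M H} {R : ℕ → Fin H → ℝ} {init : ℕ → S} {fbar : ℕ → Feat S A M H}
    {pol : ℕ → Hist S A M → S → A}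
    (hplan : ∀ k ∈ Finset.Icc 1 K, m.IsPlan b lam L δ K D R k (init k) (fbar k) (pol k))
    (hE : ∀ k ∈ Finset.Icc 1 K, m.EstimatesValid D R K δ k)
    (hconf : ∀ k ∈ Finset.Icc 1 K, ∀ fhat, IsMaxOn (m.logLik lam D k) Set.univ fhat →
      m.feat ∈ m.confSet b lam L (δ / 4) D k fhat) :
    (∀ k ∈ Finset.Icc 1 K, ∃ fhat, IsMaxOn (m.logLik lam D k) Set.univ fhat ∧
      fbar k ∈ m.confSet b lam L (δ / 4) D k fhat) ∧
    m.regret K init pol ≤ ∑ k ∈ Finset.Icc 1 K,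
      ∑ e, m.trajProb (detPolicy (pol k)) (init k) e * m.trajErr D K δ k (fbar k) e := by
  refine ⟨fun k hk => ?_, Finset.sum_le_sum fun k hk => ?_⟩
  · obtain ⟨fhat, hmax, h⟩ := hplan k hk
    exact ⟨fhat, hmax, (h ⟨_, hconf k hk fhat hmax⟩).1⟩
  · obtain ⟨fhat, hmax, h⟩ := hplan k hk
    obtain ⟨-, hopt, hgreedy⟩ := h ⟨_, hconf k hk fhat hmax⟩
    -- Optimal value, planner's value at the truth, planner's value at the chosen features, true
    -- value plus expected error: each is at most the next.
    have h1 := m.optValue_le_optimisticV (hE k hk) (init k)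
    have h2 := hopt _ (hconf k hk fhat hmax)
    have h3 := m.optimisticV_le_value_add (hE k hk) (fbar k) hgreedy (init k)
    linarith

lemma sum_trajErr_le (m : Model S A M H) {K : ℕ} {δ B₁ B₂ : ℝ} {D : ℕ → Traj S A M H}
    {f : ℕ → Feat S A M H}
    (h1 : ∀ h : Fin H, ∑ k ∈ Finset.Icc 1 K, ∑ y, |m.ctxProb (f k) (Traj.hist (D k) h) y -
        m.ctxProb m.feat (Traj.hist (D k) h) y| ≤ B₁)
    (h2 : ∀ h : Fin H, ∑ k ∈ Finset.Icc 1 K,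
      (bonusRew S A M H K δ (visits D k h ((D k).1 h.castSucc) ((D k).2.1 h) ((D k).2.2 h)) +
        bonusTrans S A M H K δ
          (visits D k h ((D k).1 h.castSucc) ((D k).2.1 h) ((D k).2.2 h))) ≤ B₂) :
    ∑ k ∈ Finset.Icc 1 K, m.trajErr D K δ k (f k) (D k) ≤ 8 * H * (H * B₁) + 2 * (H * B₂) := by
  unfold trajErr
  rw [Finset.sum_comm]
  calc _ ≤ ∑ _h : Fin H, (8 * H * B₁ + 2 * B₂) := by
        refine Finset.sum_le_sum fun h _ => ?_
        have h3 := mul_le_mul_of_nonneg_left (h1 h) (by positivity : (0 : ℝ) ≤ 8 * H)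
        have h4 := mul_le_mul_of_nonneg_left (h2 h) (by norm_num : (0 : ℝ) ≤ 2)
        refine le_trans (le_of_eq ?_) (add_le_add h3 h4)
        rw [Finset.mul_sum, Finset.mul_sum, ← Finset.sum_add_distrib]
        refine Finset.sum_congr rfl fun k _ => ?_
        unfold stepErr
        ring
    _ = _ := by simp; ring

end Model

end Final

/-! ### The regret bound on the good event, with explicit constants. -/

section Assembly

set_option maxHeartbeats 800000 in
/-- The regret bound, for data on which the estimates and noise bounds hold and the realised errors
control the expected ones. -/
theorem Model.exists_regret_le {c₁ c₂ ℓ₀ : ℝ} (hc₁ : 0 < c₁) (hc₂ : 0 < c₂) (hℓ₀ : 0 < ℓ₀) :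
    ∃ C : ℝ, 0 < C ∧ ∀ (S A : Type*) [Fintype S] [Fintype A] [DecidableEq S] [DecidableEq A]
      (M H K : ℕ) (m : Model S A M H) (L lam δ : ℝ) (b : Feat S A M H) (D : ℕ → Traj S A M H)
      (R : ℕ → Fin H → ℝ) (init : ℕ → S) (fbar : ℕ → Feat S A M H)
      (pol : ℕ → Hist S A M → S → A), 1 ≤ M → 1 ≤ H → 1 ≤ K →
      m.η ≤ 1 / Real.sqrt (effHorizon m.α H) → ℓ₀ ≤ L → Real.sqrt (∑ p, m.feat p ^ 2) ≤ L →
      (∀ p, |m.feat p| ≤ b p) → 0 < lam →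
      c₁ * (H * ((M : ℝ) ^ 2 * Real.sqrt M) * Fintype.card S * Fintype.card A) ≤ lam * L →
      lam * L ≤ c₂ * (H * ((M : ℝ) ^ 2 * Real.sqrt M) * Fintype.card S * Fintype.card A) →
      0 < δ → δ < 1 →
      (∀ k ∈ Finset.Icc 1 K, m.IsPlan b lam L δ K D R k (init k) (fbar k) (pol k)) →
      (∀ k ∈ Finset.Icc 1 K, m.EstimatesValid D R K δ k) →
      (∀ k ∈ Finset.Icc 1 K, m.NoiseBound D k lam
        (noiseRadius (Fintype.card (Fin M × Idx S A M H)) H lam (2 / (3 * Real.sqrt M))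
          (δ / 4) k)) →
      (∀ k ∈ Finset.Icc 1 K, m.NoiseBound D k (Fintype.card (Fin M × Idx S A M H))
        (noiseRadius (Fintype.card (Fin M × Idx S A M H)) H
          (Fintype.card (Fin M × Idx S A M H)) (2 / 3) (δ / 4) k)) →
      (∑ k ∈ Finset.Icc 1 K,
          ∑ e, m.trajProb (detPolicy (pol k)) (init k) e * m.trajErr D K δ k (fbar k) e ≤
        2 * ∑ k ∈ Finset.Icc 1 K, m.trajErr D K δ k (fbar k) (D k) +
          2 * (22 * (H : ℝ) ^ 2) * Real.log (1 / (δ / 4))) →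
      m.regret K init pol ≤ C * Real.sqrt ((H : ℝ) ^ 6 * ((M : ℝ) ^ 4 * Real.sqrt M) *
          (Fintype.card S : ℝ) ^ 2 * (Fintype.card A : ℝ) ^ 2 * L ^ 2 * m.kappa * K) *
        Real.log (2 + Fintype.card S * Fintype.card A * M * H * K * L / δ) ^ 3 := by
  obtain ⟨Λ, hΛ1, hΛ⟩ := exists_log_le hc₁ hℓ₀
  set c : ℝ := 16 * (4 + 6 * Λ) * (6 / c₁ + Λ + 1) ^ 2 + 864 / c₁ * Λ ^ 2 +
        4 * (444 / c₁ + 1) ^ 2 * Λ with hc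
  have hc0 : 0 < c := by positivity
  set Λ₂ : ℝ := 2 * Real.log (1 + 4 * c * Λ ^ 4) + 7 with hΛ₂
  have hΛ₂0 : 0 ≤ Λ₂ := by
    have : 0 ≤ Real.log (1 + 4 * c * Λ ^ 4) := Real.log_nonneg (by
      have : 0 ≤ 4 * c * Λ ^ 4 := by positivity
      linarith)
    positivity
  -- The factor `Λ ^ 3` converts the cube of `x = Λ * ℓ` into the cube of the stated logarithm.
  refine ⟨(148 * Λ + 32 * Real.sqrt (18 * Λ₂ * (32 * c * c₂ + Λ ^ 2))) * Λ ^ 3, by positivity, ?_⟩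
  intro S A _ _ _ _ M H K m L lam δ b D R init fbar pol hM hH hK hη hL hfL hb hlam hlow hup hδ hδ1
    hplan hE hN hN₀ hsum
  have hS : 0 < Fintype.card S := Fintype.card_pos_iff.2 ⟨m.start.1⟩
  have hA : 0 < Fintype.card A := Fintype.card_pos_iff.2 ⟨m.start.2.1⟩
  have hs1 : (1 : ℝ) ≤ (Fintype.card S : ℝ) := by exact_mod_cast hS
  have ha1 : (1 : ℝ) ≤ (Fintype.card A : ℝ) := by exact_mod_cast hA
  have hM1 : (1 : ℝ) ≤ M := by exact_mod_cast hM
  have hH1 : (1 : ℝ) ≤ H := by exact_mod_cast hH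
  have hK1 : (1 : ℝ) ≤ K := by exact_mod_cast hK
  have hL0 : 0 < L := hℓ₀.trans_le hL
  have hm1 : 1 ≤ Real.sqrt M := Real.one_le_sqrt.2 hM1
  have hU1 : 1 ≤ (H * ((M : ℝ) ^ 2 * Real.sqrt M) * Fintype.card S * Fintype.card A : ℝ) :=
    one_le_mul_of_one_le_of_one_le (one_le_mul_of_one_le_of_one_le
      (one_le_mul_of_one_le_of_one_le hH1 (one_le_mul_of_one_le_of_one_le (one_le_pow₀ hM1) hm1))
      hs1) ha1
  have hc₁L : c₁ ≤ lam * L := (le_mul_of_one_le_right hc₁.le hU1).trans hlow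
  obtain ⟨hΛL, hx, hι, h8, hlogM, hlogK, hlamK, hKH⟩ :=
    hΛ _ _ M H K L δ lam hs1 ha1 hM1 hH1 hK1 hL hδ hδ1 hlam hc₁L
  set ℓ := Real.log (2 + Fintype.card S * Fintype.card A * M * H * K * L / δ) with hℓ
  set x := Λ * ℓ with hxdef
  set d : ℝ := (Fintype.card (Fin M × Idx S A M H) : ℝ) with hd
  have hdU : d ≤ 2 * (H * ((M : ℝ) ^ 2 * Real.sqrt M) * Fintype.card S * Fintype.card A) := by
    rw [hd, card_feat_eq]
    have h1 : (M : ℝ) * (M + 1) ≤ 2 * ((M : ℝ) ^ 2 * Real.sqrt M) := by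
      have : (M : ℝ) ^ 2 * 1 ≤ (M : ℝ) ^ 2 * Real.sqrt M :=
        mul_le_mul_of_nonneg_left hm1 (by positivity)
      nlinarith
    have h2 := mul_le_mul_of_nonneg_right h1
      (by positivity : (0 : ℝ) ≤ Fintype.card S * Fintype.card A * H)
    linarith
  have hdL : d ≤ 2 / c₁ * (lam * L) := by
    refine hdU.trans ?_
    rw [div_mul_eq_mul_div, le_div_iff₀ hc₁]; linarith
  have hne : Nonempty (Fin M × Idx S A M H) := ⟨(⟨0, hM⟩, ⟨0, hH⟩, m.start)⟩
  have hd1 : 1 ≤ d := by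
    rw [hd]; exact_mod_cast (Fintype.card_pos : 0 < Fintype.card (Fin M × Idx S A M H))
  have hkK : ∀ k ∈ Finset.Icc 1 K, (k : ℝ) ≤ K := fun k hk => by
    exact_mod_cast (Finset.mem_Icc.1 hk).2
  have hrad : ∀ k ∈ Finset.Icc 1 K, 0 ≤ radius S A M H lam L (δ / 4) k ∧
      radius S A M H lam L (δ / 4) k ≤ (6 / c₁ + Λ + 1) * (Real.sqrt lam * L * x) := fun k hk =>
    radius_le hM hc₁ hlam hL0 hx hΛL hS hA hlow hδ hδ1 h8
      ((Real.log_le_log (by positivity) (by have := hkK k hk; gcongr)).trans hlamK)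
  have hβ₀ : ∀ k ∈ Finset.Icc 1 K, 0 ≤ noiseRadius d H d (2 / 3) (δ / 4) k ∧
      noiseRadius d H d (2 / 3) (δ / 4) k ≤ 6 * (Real.sqrt d * x) := fun k hk =>
    noiseRadius_le hd1 hx h8 hδ hδ1
      ((Real.log_le_log (by positivity) (by have := hkK k hk; gcongr)).trans hKH)
  have hβ : ∀ k : ℕ, 0 ≤ noiseRadius d H lam (2 / (3 * Real.sqrt M)) (δ / 4) k := fun k => by
    have h1 : 0 ≤ Real.log (1 / (δ / 4)) := Real.log_nonneg (by
      rw [one_div_div, le_div_iff₀ hδ]; linarith)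
    have h2 : 0 ≤ Real.log (1 + k * H / (d * lam)) := Real.log_nonneg (by
      have : 0 ≤ (k : ℝ) * H / (d * lam) := by positivity
      linarith)
    have h3 : 0 ≤ Real.log 4 := Real.log_nonneg (by norm_num)
    unfold noiseRadius
    positivity
  obtain ⟨hfbar, hreg⟩ := m.regret_le_sum_trajErr hplan hE fun k hk fhat hmax =>
    m.feat_mem_confSet hlam hfL hb hmax (hβ k) (hN k hk)
      (noiseRadius_add_le_radius hS hA hM hH hlam hδ hδ1 k)
  set Y := c * (lam * L ^ 3 * x ^ 4) with hY
  have hY0 : 0 < Y := by positivity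
  have hX : ∀ k ∈ Finset.Icc 1 K, lam * ∑ p, (fbar k - m.feat) p ^ 2 +
      ∑ k' ∈ Finset.Ico 1 k, ∑ h : Fin H, m.meanGap (fbar k - m.feat) (Traj.hist (D k') h) ≤ Y := by
    intro k hk
    obtain ⟨fhat, hmax, hmem⟩ := hfbar k hk
    refine (m.sum_meanGap_le hlam (by linarith) (hβ₀ k hk).1 hη hfL hmax hmem (hN₀ k hk)).trans ?_
    exact estimation_bound_le hc₁ hlam hL0 hx hΛ1 hΛL hlogM rfl (hrad k hk).1 (hrad k hk).2
      (hβ₀ k hk).1 (by linarith) (hβ₀ k hk).2 hdL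
  have hι1 : 1 ≤ bonusLog S A M H K δ :=
    (Model.card_mul_exp_bonusLog_le hS hA hM hH hK hδ hδ1).1
  have hT := m.sum_trajErr_le (δ := δ)
    (fun h => m.sum_abs_ctxProb_sub_le hK hH hM hη hlam hY0 hX h)
    (fun h => sum_bonus_le (D := D) (K := K) (by linarith : 0 ≤ bonusLog S A M H K δ) h)
  have hκ1 := (m.exists_kappa_inv hH hM).1
  have hYlam : Y / lam = c * (L ^ 3 * (Λ * ℓ) ^ 4) := by
    rw [hY, ← hxdef]; field_simp
  have hKL : (K : ℝ) * L ≤ 2 + Fintype.card S * Fintype.card A * M * H * K * L / δ := by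
    have h1 : 1 ≤ (Fintype.card S * Fintype.card A * M * H : ℝ) :=
      one_le_mul_of_one_le_of_one_le (one_le_mul_of_one_le_of_one_le
        (one_le_mul_of_one_le_of_one_le hs1 ha1) hM1) hH1
    have h2 : (K : ℝ) * L ≤ Fintype.card S * Fintype.card A * M * H * K * L / δ := by
      rw [le_div_iff₀ hδ]
      calc (K : ℝ) * L * δ ≤ K * L * 1 := by gcongr
        _ ≤ K * L * (Fintype.card S * Fintype.card A * M * H) := by gcongr
        _ = _ := by ring
    linarith
  have hZ2 : 2 ≤ 2 + Fintype.card S * Fintype.card A * M * H * K * L / δ := by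
    have : 0 ≤ Fintype.card S * Fintype.card A * M * H * K * L / δ := by positivity
    linarith
  have hlog := log_one_add_le (c := c) (Λ := Λ) hc0.le hΛ1 hK1 hL0 hKL hZ2 hℓ
  rw [← hΛ₂, ← hxdef] at hlog
  rw [← hxdef] at hYlam
  have hlog0 : 0 ≤ Real.log (1 + 4 * K ^ 3 * (Y / lam)) := Real.log_nonneg (by
    have : 0 ≤ 4 * (K : ℝ) ^ 3 * (Y / lam) := by positivity
    linarith)
  have hlδ : Real.log (1 / (δ / 4)) ≤ x := by
    refine le_trans (Real.log_le_log (by positivity) ?_) h8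
    rw [one_div_div]; gcongr; norm_num
  have htot := total_bound_le (lK := Real.log K) (g := Real.log (1 + 4 * K ^ 3 * (Y / lam)))
    (ι := bonusLog S A M H K δ) hs1 ha1 hM1 hH1 hK1 hL0 hκ1 hx hc0 hc₂ hΛ1 hΛL
    hΛ₂0 hup hlog0 (by rw [hYlam]; exact hlog) (Real.log_nonneg hK1) hlogK
    (by unfold bonusLog; exact hι) hlδ
  refine hreg.trans (hsum.trans ?_)
  have h1 := mul_le_mul_of_nonneg_left hT (by norm_num : (0 : ℝ) ≤ 2)
  rw [card_idx_eq] at h1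
  have hcard : ((Fintype.card (S × A × Fin (M + 1)) : ℕ) : ℝ) =
      Fintype.card S * (Fintype.card A * (M + 1)) := by
    simp only [Fintype.card_prod, Fintype.card_fin]; push_cast; ring
  rw [hcard] at h1
  refine (add_le_add h1 le_rfl).trans (htot.trans (le_of_eq ?_))
  rw [hxdef, mul_pow]; ring

end Assembly

end LogisticDCMDP

end

theorem mainTheorem1 :
    ∀ c₁ c₂ ℓ₀ : ℝ, 0 < c₁ → 0 < c₂ → 0 < ℓ₀ →
    -- a constant and a power of the logarithm that depend on nothing else
    ∃ (C : ℝ) (q : ℕ), 0 < C ∧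
    ∀ (S A : Type*) [Fintype S] [Fintype A] [DecidableEq S] [DecidableEq A]
      (M H K : ℕ) (_ : 1 ≤ M) (_ : 1 ≤ H) (_ : 1 ≤ K)
      (m : LogisticDCMDP.Model S A M H)
      (_ : m.η ≤ 1 / Real.sqrt (LogisticDCMDP.effHorizon m.α H))
      (L : ℝ) (_ : ℓ₀ ≤ L) (_ : Real.sqrt (∑ p, m.feat p ^ 2) ≤ L)
      (b : LogisticDCMDP.Feat S A M H) (_ : ∀ p, |m.feat p| ≤ b p)
      (lam : ℝ)
      (_ : c₁ * (H * (M : ℝ) ^ (5 / 2 : ℝ) * Fintype.card S * Fintype.card A / L) ≤ lam)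
      (_ : lam ≤ c₂ * (H * (M : ℝ) ^ (5 / 2 : ℝ) * Fintype.card S * Fintype.card A / L))
      (δ : ℝ) (_ : 0 < δ) (_ : δ < 1)
      (Ω : Type*) [mΩ : MeasurableSpace Ω] (μ : MeasureTheory.Measure Ω)
      [MeasureTheory.IsProbabilityMeasure μ] (ℱ : MeasureTheory.Filtration ℕ mΩ)
      (init : ℕ → Ω → S) (fbar : ℕ → Ω → LogisticDCMDP.Feat S A M H)
      (pol : ℕ → Ω → LogisticDCMDP.Hist S A M → S → A)
      (D : ℕ → Ω → LogisticDCMDP.Traj S A M H) (R : ℕ → Fin H → Ω → ℝ)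
      (_ : m.IsRun b lam L δ K μ ℱ init fbar pol D R),
      ENNReal.ofReal (1 - δ) ≤
        μ {ω | m.regret K (fun k => init k ω) (fun k => pol k ω) ≤
          C * Real.sqrt ((H : ℝ) ^ 6 * (M : ℝ) ^ (9 / 2 : ℝ) * (Fintype.card S : ℝ) ^ 2 *
              (Fintype.card A : ℝ) ^ 2 * L ^ 2 * m.kappa * K) *
            Real.log (2 + Fintype.card S * Fintype.card A * M * H * K * L / δ) ^ q} := by
  intro c₁ c₂ ℓ₀ hc₁ hc₂ hℓ₀
  obtain ⟨C, hC, hbound⟩ := LogisticDCMDP.Model.exists_regret_le hc₁ hc₂ hℓ₀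
  refine ⟨C, 3, hC, ?_⟩
  intro S A _ _ _ _ M H K hM hH hK m hη L hL hfL b hb lam hlow hup δ hδ hδ1 Ω mΩ μ _ ℱ init fbar pol
    D R hr
  have hL0 : 0 < L := hℓ₀.trans_le hL
  have hM0 : (0 : ℝ) < M := by exact_mod_cast hM
  have hH0 : (0 : ℝ) < H := by exact_mod_cast hH
  have hS0 : (0 : ℝ) < Fintype.card S := by exact_mod_cast Fintype.card_pos_iff.2 ⟨m.start.1⟩
  have hA0 : (0 : ℝ) < Fintype.card A := by exact_mod_cast Fintype.card_pos_iff.2 ⟨m.start.2.1⟩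
  have e52 : (M : ℝ) ^ (5 / 2 : ℝ) = (M : ℝ) ^ 2 * Real.sqrt M := by
    rw [← LogisticDCMDP.rpow_add_half hM0 2]; norm_num
  have e92 : (M : ℝ) ^ (9 / 2 : ℝ) = (M : ℝ) ^ 4 * Real.sqrt M := by
    rw [← LogisticDCMDP.rpow_add_half hM0 4]; norm_num
  have hM1 : 1 ≤ Real.sqrt M := Real.one_le_sqrt.2 (by exact_mod_cast hM)
  rw [e52] at hlow hup
  have hlam : 0 < lam := lt_of_lt_of_le (by positivity) hlow
  have hlow' : c₁ * (H * ((M : ℝ) ^ 2 * Real.sqrt M) * Fintype.card S * Fintype.card A) ≤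
      lam * L := by
    rw [← mul_div_assoc, div_le_iff₀ hL0] at hlow; exact hlow
  have hup' : lam * L ≤
      c₂ * (H * ((M : ℝ) ^ 2 * Real.sqrt M) * Fintype.card S * Fintype.card A) := by
    rw [← mul_div_assoc, le_div_iff₀ hL0] at hup; exact hup
  rw [e92]
  have hdpos : (0 : ℝ) < Fintype.card (Fin M × LogisticDCMDP.Idx S A M H) := by
    rw [LogisticDCMDP.card_feat_eq]; positivity
  have hδ4 : 0 < δ / 4 := by positivity
  have hr0 : 0 < 2 / (3 * Real.sqrt M) := by positivity
  have hr1 : 2 / (3 * Real.sqrt M) ≤ 2 / 3 := by gcongr; linarith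
  have h1 := hr.measureReal_not_estimatesValid_le hM hH hK hδ hδ1
  -- Two calibrations of one inequality: ridge `lam` and radius `2 / (3√M)` for membership in the
  -- confidence set, ridge equal to the dimension and radius 2/3 for the estimation error.
  have h2 := hr.measureReal_not_noiseBound_le hM hH hη hlam hr0 hr1 hδ4
  have h3 := hr.measureReal_not_noiseBound_le hM hH hη hdpos (by norm_num : (0 : ℝ) < 2 / 3) le_rfl
    hδ4
  have h4 := hr.measureReal_lt_sum_mean_le (T := fun k ω e => m.trajErr (fun k' => D k' ω) K δ k
    (fbar k ω) e) (by positivity : (0 : ℝ) < 22 * (H : ℝ) ^ 2) hδ4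
    (fun k hk e => hr.measurable_trajErr hk e) (fun k ω e => m.trajErr_mem _ _ _ _ _ _)
  set B₁ := {ω | ¬ ∀ k ∈ Finset.Icc 1 K, m.EstimatesValid (fun k' => D k' ω)
      (fun k' h => R k' h ω) K δ k}
  set B₂ := {ω | ¬ ∀ k ∈ Finset.Icc 1 K, m.NoiseBound (fun k' => D k' ω) k lam
      (LogisticDCMDP.Model.noiseRadius (Fintype.card (Fin M × LogisticDCMDP.Idx S A M H)) H lam
        (2 / (3 * Real.sqrt M)) (δ / 4) k)}
  set B₃ := {ω | ¬ ∀ k ∈ Finset.Icc 1 K, m.NoiseBound (fun k' => D k' ω) k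
      (Fintype.card (Fin M × LogisticDCMDP.Idx S A M H))
      (LogisticDCMDP.Model.noiseRadius (Fintype.card (Fin M × LogisticDCMDP.Idx S A M H)) H
        (Fintype.card (Fin M × LogisticDCMDP.Idx S A M H)) (2 / 3) (δ / 4) k)}
  set B₄ := {ω | 2 * ∑ k ∈ Finset.Icc 1 K, m.trajErr (fun k' => D k' ω) K δ k (fbar k ω) (D k ω) +
      2 * (22 * (H : ℝ) ^ 2) * Real.log (1 / (δ / 4)) < ∑ k ∈ Finset.Icc 1 K,
        ∑ e, m.trajProb (LogisticDCMDP.detPolicy (pol k ω)) (init k ω) e *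
          m.trajErr (fun k' => D k' ω) K δ k (fbar k ω) e}
  set G := {ω | m.regret K (fun k => init k ω) (fun k => pol k ω) ≤
    C * Real.sqrt ((H : ℝ) ^ 6 * ((M : ℝ) ^ 4 * Real.sqrt M) * (Fintype.card S : ℝ) ^ 2 *
      (Fintype.card A : ℝ) ^ 2 * L ^ 2 * m.kappa * K) *
      Real.log (2 + Fintype.card S * Fintype.card A * M * H * K * L / δ) ^ 3}
  -- Subadditivity is applied to a cover of the whole space, so measurability of the regret event is
  -- not needed.
  have hcover : (Set.univ : Set Ω) ⊆ G ∪ (B₁ ∪ B₂ ∪ (B₃ ∪ B₄)) := by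
    intro ω _
    by_contra hω
    simp only [Set.mem_union, not_or] at hω
    obtain ⟨hG, ⟨hω₁, hω₂⟩, hω₃, hω₄⟩ := hω
    exact hG (hbound S A M H K m L lam δ b (fun k => D k ω) (fun k h => R k h ω)
      (fun k => init k ω) (fun k => fbar k ω) (fun k => pol k ω) hM hH hK hη hL hfL hb hlam hlow'
      hup' hδ hδ1 (fun k hk => hr.plan k hk ω) (not_not.1 hω₁) (not_not.1 hω₂) (not_not.1 hω₃)
      (not_lt.1 hω₄))
  have h5 : 1 ≤ μ.real G + (δ / 4 + δ / 4 + (δ / 4 + δ / 4)) := by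
    calc 1 = μ.real (Set.univ : Set Ω) := by simp
      _ ≤ μ.real (G ∪ (B₁ ∪ B₂ ∪ (B₃ ∪ B₄))) :=
        MeasureTheory.measureReal_mono hcover (MeasureTheory.measure_ne_top _ _)
      _ ≤ μ.real G + μ.real (B₁ ∪ B₂ ∪ (B₃ ∪ B₄)) := MeasureTheory.measureReal_union_le _ _
      _ ≤ _ := by
        refine add_le_add le_rfl ((MeasureTheory.measureReal_union_le _ _).trans (add_le_add
          ((MeasureTheory.measureReal_union_le _ _).trans (add_le_add h1 h2))
          ((MeasureTheory.measureReal_union_le _ _).trans (add_le_add h3 h4))))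
  rw [← MeasureTheory.ofReal_measureReal (MeasureTheory.measure_ne_top _ _)]
  exact ENNReal.ofReal_le_ofReal (by linarith)
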